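/- Let $\Omega\subset\mathbb R^d$ be a bounded open set, $\|\cdot\|$ the norm of $L^2(\Omega)$, and let $A$ be the Laplacian with zero Dirichlet boundary condition: its domain $\check H^2$ consists of the $v\in H^1_0(\Omega)$ whose weak Laplacian $Av$ lies in $L^2(\Omega)$, and $\|v\|_{\check H^2}=\|Av\|$, $\|v\|_{\check H^0}=\|v\|$. (If $\Omega$ is simply connected with piecewise smooth boundary and convex corners, then $\check H^2=H^2(\Omega)\cap H^1_0(\Omega)$.) Let $T,\kappa>0$, and let $\alpha:[0,T]\to(1,2)$ be three times differentiable with $|\alpha'|+|\alpha''|+|\alpha'''|$ bounded and $\alpha'(0)=\alpha''(0)=0$. Put $\alpha_0=\alpha(0)$, $\bar\alpha=\alpha_0-1$, $\beta_{\mu}(t)=t^{\mu-1}/\Gamma(\mu)$ and $$g(t)=\int_0^1\frac{(tz)^{\alpha_0-\alpha(tz)}}{\Gamma(\alpha_0-1)\Gamma(2-\alpha(tz))}(1-z)^{\alpha_0-2}z^{1-\alpha_0}\,dz .$$ Let $f\in C([0,T];L^2(\Omega))$, $u_0,\bar u_0\in\check H^2$, and $\bar f(t)=\int_0^t\beta_{\bar\alpha}(t-s)f(s)\,ds+g(t)\bar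 u_0$. Let $u\in W^{2,1}(0,T;L^2)\cap L^1(0,T;\check H^2)$, with $u(t)\in\check H^2$ for $t\in[0,T]$, be a solution of $$\partial_t u+\int_0^t g'(t-s)\,\partial_su(s)\,ds-\kappa\int_0^t\beta_{\bar\alpha}(t-s)Au(s)\,ds=\bar f(t)\quad(0<t\le T),\qquad u(0)=u_0,\ \ \partial_tu(0)=\bar u_0,$$ and suppose that it has the regularity that smooth data produce: for some constant $M$, $\|\partial_t^2u(t)\|_{\check H^{2m}}\le M\,t^{\alpha_0-2}$ for $m=0,1$ and almost every $t\in(0,T)$. For $N\ge1$ let $\tau=T/N$, $t_n=n\tau$, $w_k=g(t_{k+1})-g(t_k)$, $v^{n-1/2}=(v^n+v^{n-1})/2$, $\bar F^n=\tau^{-1}\int_{t_{n-1}}^{t_n}\bar f(t)\,dt$, $$\omega_{n,j}=\frac1\tau\int_{t_{n-1}}^{t_n}\int_{t_{j-1}}^{\min(t,t_j)}\beta_{\bar\alpha}(t-s)\,ds\,dt,\qquad I^{n-1/2}_{\bar\alpha}(\varphi)=\omega_{n,1}\varphi^1+\sum_{j=2}^n\omega_{n,j}\varphi^{j-1/2}.$$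 Then there is a constant $Q>0$, independent of $N$ (hence of $\tau$), such that for every $N\ge1$, whenever $U^0=u_0$ and $U^1,\dots,U^N\in\check H^2$ satisfy the semi-discrete scheme $$\frac{U^n-U^{n-1}}{\tau}+\frac1\tau\Big[w_0U^{n-1/2}-\sum_{k=1}^{n-1}(w_{k-1}-w_k)U^{n-k-1/2}-w_{n-1}U^0\Big]-\kappa I^{n-1/2}_{\bar\alpha}(AU)=\bar F^n,\qquad 1\le n\le N,$$ one has $$\|u(t_m)-U^m\|\le Q\,\tau^2,\qquad 1\le m\le N.$$ -/

import Mathlib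

open MeasureTheory Set
open scoped ContDiff

/-! ### The space `L²(Ω)` and the Laplacian with zero Dirichlet boundary condition -/

/-- `L²(Ω)`, real valued, for the Lebesgue measure. -/
abbrev L2 {d : ℕ} (Ω : Set (EuclideanSpace ℝ (Fin d))) : Type :=
  Lp ℝ 2 (volume.restrict Ω)

/-- `φ ∈ C_c^∞(Ω)`. -/
structure IsTestFunction {d : ℕ} (Ω : Set (EuclideanSpace ℝ (Fin d)))
    (φ : EuclideanSpace ℝ (Fin d) → ℝ) : Prop where
  smooth : ContDiff ℝ ∞ φ
  hasCompactSupport : HasCompactSupport φ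
  tsupport_subset : tsupport φ ⊆ Ω

/-- The partial derivative `∂_i φ`. -/
noncomputable def partialDeriv {d : ℕ} (i : Fin d) (φ : EuclideanSpace ℝ (Fin d) → ℝ)
    (x : EuclideanSpace ℝ (Fin d)) : ℝ :=
  fderiv ℝ φ x (EuclideanSpace.single i 1)

/-- The graph `{(φ, ∇φ) : φ ∈ C_c^∞(Ω)}` of the gradient in `L²(Ω) × L²(Ω)^d`. -/
def testGradientGraph {d : ℕ} (Ω : Set (EuclideanSpace ℝ (Fin d))) :
    Set (L2 Ω × (Fin d → L2 Ω)) :=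
  {p | ∃ φ : EuclideanSpace ℝ (Fin d) → ℝ, IsTestFunction Ω φ ∧
    p.1 =ᵐ[volume.restrict Ω] φ ∧ ∀ i, p.2 i =ᵐ[volume.restrict Ω] partialDeriv i φ}

/-- `v ∈ H¹₀(Ω)` with weak gradient `w`: the closure in the `H¹` norm of `C_c^∞(Ω)`. -/
def HasH10Gradient {d : ℕ} (Ω : Set (EuclideanSpace ℝ (Fin d)))
    (v : L2 Ω) (w : Fin d → L2 Ω) : Prop :=
  (v, w) ∈ closure (testGradientGraph Ω)

/-- `v ∈ H¹₀(Ω)` and its weak Laplacian is `q ∈ L²(Ω)`: `(∇v, ∇φ) = -(q, φ)` for all test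
functions `φ`. -/
def HasDirichletLaplacian {d : ℕ} (Ω : Set (EuclideanSpace ℝ (Fin d))) (v q : L2 Ω) : Prop :=
  ∃ w : Fin d → L2 Ω, HasH10Gradient Ω v w ∧
    ∀ φ : EuclideanSpace ℝ (Fin d) → ℝ, IsTestFunction Ω φ →
      ∑ i, ∫ x in Ω, w i x * partialDeriv i φ x = -∫ x in Ω, q x * φ x

theorem IsTestFunction.partialDeriv {d : ℕ} {Ω : Set (EuclideanSpace ℝ (Fin d))}
    {φ : EuclideanSpace ℝ (Fin d) → ℝ} (h : IsTestFunction Ω φ) (i : Fin d) :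
    IsTestFunction Ω (partialDeriv i φ) where
  smooth := (h.smooth.fderiv_right (m := ∞) (by simp)).clm_apply contDiff_const
  hasCompactSupport := h.hasCompactSupport.fderiv_apply (𝕜 := ℝ) _
  tsupport_subset := (tsupport_fderiv_apply_subset ℝ _).trans h.tsupport_subset

theorem IsTestFunction.memLp {d : ℕ} {Ω : Set (EuclideanSpace ℝ (Fin d))}
    {φ : EuclideanSpace ℝ (Fin d) → ℝ} (h : IsTestFunction Ω φ) :
    MemLp φ 2 (volume.restrict Ω) :=
  (h.smooth.continuous.memLp_of_hasCompactSupport h.hasCompactSupport).restrict Ω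

theorem IsTestFunction.inner_toLp {d : ℕ} {Ω : Set (EuclideanSpace ℝ (Fin d))}
    {φ : EuclideanSpace ℝ (Fin d) → ℝ} (h : IsTestFunction Ω φ) (v : L2 Ω) :
    inner ℝ h.memLp.toLp v = ∫ x in Ω, v x * φ x := by
  rw [L2.inner_def]
  refine integral_congr_ae ?_
  filter_upwards [h.memLp.coeFn_toLp] with x hx
  simp [hx]

theorem L2.eq_of_forall_testFunction {d : ℕ} {Ω : Set (EuclideanSpace ℝ (Fin d))}
    (hΩ : IsOpen Ω) {v w : L2 Ω}
    (h : ∀ φ : EuclideanSpace ℝ (Fin d) → ℝ, IsTestFunction Ω φ →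
      ∫ x in Ω, v x * φ x = ∫ x in Ω, w x * φ x) : v = w := by
  rw [← sub_eq_zero]
  have hz : ∀ᵐ x ∂(volume.restrict Ω), x ∈ Ω → (v - w : L2 Ω) x = 0 := by
    refine hΩ.ae_eq_zero_of_integral_contDiff_smul_eq_zero ?_ ?_
    · exact ((Lp.memLp (v - w)).locallyIntegrable (by norm_num)).locallyIntegrableOn Ω
    · intro φ h1 h2 h3
      have hφ : IsTestFunction Ω φ := ⟨h1, h2, h3⟩
      have := hφ.inner_toLp (v - w)
      rw [inner_sub_right, hφ.inner_toLp, hφ.inner_toLp, h φ hφ, sub_self] at this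
      simpa [mul_comm] using this.symm
  rw [Lp.eq_zero_iff_ae_eq_zero]
  filter_upwards [hz, ae_restrict_mem hΩ.measurableSet] with x hx hxΩ using hx hxΩ

/-- Functions in `H¹₀(Ω)` satisfy the integration by parts formula with test functions. -/
theorem HasH10Gradient.integral_mul_test {d : ℕ} {Ω : Set (EuclideanSpace ℝ (Fin d))}
    {v : L2 Ω} {w : Fin d → L2 Ω} (h : HasH10Gradient Ω v w) (i : Fin d)
    {ψ : EuclideanSpace ℝ (Fin d) → ℝ} (hψ : IsTestFunction Ω ψ) :
    ∫ x in Ω, w i x * ψ x = -∫ x in Ω, v x * partialDeriv i ψ x := by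
  have hcl : IsClosed {p : L2 Ω × (Fin d → L2 Ω) |
      inner ℝ hψ.memLp.toLp (p.2 i) = -inner ℝ (hψ.partialDeriv i).memLp.toLp p.1} :=
    isClosed_eq (by fun_prop) (by fun_prop)
  have hsub : testGradientGraph Ω ⊆ {p : L2 Ω × (Fin d → L2 Ω) |
      inner ℝ hψ.memLp.toLp (p.2 i) = -inner ℝ (hψ.partialDeriv i).memLp.toLp p.1} := by
    rintro ⟨v, w⟩ ⟨φ, hφ, hv, hw⟩
    simp only [mem_ofPred_eq] at hv hw ⊢
    rw [hψ.inner_toLp, (hψ.partialDeriv i).inner_toLp]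
    have e1 : ∫ x in Ω, w i x * ψ x = ∫ x, _root_.partialDeriv i φ x * ψ x := by
      rw [← setIntegral_eq_integral_of_forall_compl_eq_zero (s := Ω)
        (f := fun x => _root_.partialDeriv i φ x * ψ x)]
      · refine integral_congr_ae ?_
        filter_upwards [hw i] with x hx
        rw [hx]
      · intro x hx
        rw [image_eq_zero_of_notMem_tsupport (f := ψ) (fun hx' => hx (hψ.tsupport_subset hx')),
          mul_zero]
    have e2 : ∫ x in Ω, v x * _root_.partialDeriv i ψ x
        = ∫ x, φ x * _root_.partialDeriv i ψ x := by
      rw [← setIntegral_eq_integral_of_forall_compl_eq_zero (s := Ω)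
        (f := fun x => φ x * _root_.partialDeriv i ψ x)]
      · refine integral_congr_ae ?_
        filter_upwards [hv] with x hx
        rw [hx]
      · intro x hx
        rw [image_eq_zero_of_notMem_tsupport (f := φ) (fun hx' => hx (hφ.tsupport_subset hx')),
          zero_mul]
    have cφ := hφ.smooth.continuous
    have cψ := hψ.smooth.continuous
    have cφ' := (hφ.partialDeriv i).smooth.continuous
    have cψ' := (hψ.partialDeriv i).smooth.continuous
    rw [e1, e2]
    have := integral_mul_fderiv_eq_neg_fderiv_mul_of_integrable (𝕜 := ℝ)
      (μ := (volume : Measure (EuclideanSpace ℝ (Fin d)))) (f := φ) (g := ψ)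
      (v := EuclideanSpace.single i 1)
      ((cφ'.mul cψ).integrable_of_hasCompactSupport hψ.hasCompactSupport.mul_left)
      ((cφ.mul cψ').integrable_of_hasCompactSupport hφ.hasCompactSupport.mul_right)
      ((cφ.mul cψ).integrable_of_hasCompactSupport hφ.hasCompactSupport.mul_right)
      (fun x _ => hφ.smooth.differentiable (by simp) x)
      (fun x _ => hψ.smooth.differentiable (by simp) x)
    simp only [_root_.partialDeriv]
    linarith
  have := (hcl.closure_subset_iff.2 hsub) h
  simp only [mem_ofPred_eq] at this
  rwa [hψ.inner_toLp, (hψ.partialDeriv i).inner_toLp] at this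

/-- The weak Laplacian is unique. -/
theorem HasDirichletLaplacian.unique {d : ℕ} {Ω : Set (EuclideanSpace ℝ (Fin d))}
    (hΩ : IsOpen Ω) {v q q' : L2 Ω} (h : HasDirichletLaplacian Ω v q)
    (h' : HasDirichletLaplacian Ω v q') : q = q' := by
  obtain ⟨w, hw, hq⟩ := h
  obtain ⟨w', hw', hq'⟩ := h'
  have hww : w = w' := funext fun i => L2.eq_of_forall_testFunction hΩ fun ψ hψ => by
    rw [hw.integral_mul_test i hψ, hw'.integral_mul_test i hψ]
  subst hww
  refine L2.eq_of_forall_testFunction hΩ fun φ hφ => ?_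
  have := (hq φ hφ).symm.trans (hq' φ hφ)
  linarith

/-- The domain of the Dirichlet Laplacian `A`, that is, the space `Ȟ²(Ω)` (it is
`H²(Ω) ∩ H¹₀(Ω)` when `∂Ω` is piecewise smooth with convex corners). -/
def HCheckTwo {d : ℕ} (Ω : Set (EuclideanSpace ℝ (Fin d))) : Set (L2 Ω) :=
  {v | ∃ q, HasDirichletLaplacian Ω v q}

open Classical in
/-- The Dirichlet Laplacian `A`. Its value is meaningful on `HCheckTwo Ω` only, and is put to `0`
elsewhere; on `HCheckTwo Ω` it does not depend on a choice, see
`HasDirichletLaplacian.dirichletLaplacian_eq` below. The norm of `Ȟ²(Ω)` is `‖v‖_{Ȟ²} = ‖A v‖`. -/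
noncomputable def dirichletLaplacian {d : ℕ} (Ω : Set (EuclideanSpace ℝ (Fin d)))
    (v : L2 Ω) : L2 Ω :=
  if h : ∃ q, HasDirichletLaplacian Ω v q then h.choose else 0

theorem HasDirichletLaplacian.dirichletLaplacian_eq {d : ℕ}
    {Ω : Set (EuclideanSpace ℝ (Fin d))} (hΩ : IsOpen Ω) {v q : L2 Ω}
    (h : HasDirichletLaplacian Ω v q) : dirichletLaplacian Ω v = q := by
  have hex : ∃ q, HasDirichletLaplacian Ω v q := ⟨q, h⟩
  rw [dirichletLaplacian, dif_pos hex]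
  exact hex.choose_spec.unique hΩ h

/-! ### The kernels -/

/-- The Abel kernel `β_μ(t) = t^{μ-1} / Γ(μ)`, `t > 0`. -/
noncomputable def abelKernel (μ t : ℝ) : ℝ := t ^ (μ - 1) / Real.Gamma μ

/-- The generalized identity function
`g(t) = ∫₀¹ (tz)^{α(0)-α(tz)} / (Γ(α(0)-1) Γ(2-α(tz))) (1-z)^{α(0)-2} z^{1-α(0)} dz`,
which for `t > 0` is the convolution of `β_{α(0)-1}` and `t^{1-α(t)} / Γ(2-α(t))`. -/
noncomputable def genIdentity (α : ℝ → ℝ) (t : ℝ) : ℝ :=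
  ∫ z in (0 : ℝ)..1,
    (t * z) ^ (α 0 - α (t * z)) / (Real.Gamma (α 0 - 1) * Real.Gamma (2 - α (t * z)))
      * (1 - z) ^ (α 0 - 2) * z ^ (1 - α 0)

/-- The exponent: `1 < α < 2` on `[0,T]`, `α` is three times differentiable on `[0,T]` with
`|α'| + |α''| + |α'''|` bounded. -/
structure IsSmoothExponent (T : ℝ) (α : ℝ → ℝ) : Prop where
  mem_Ioo : ∀ t ∈ Icc 0 T, α t ∈ Ioo (1 : ℝ) 2
  differentiable : ∀ j < 3, DifferentiableOn ℝ (iteratedDerivWithin j α (Icc 0 T)) (Icc 0 T)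
  bounded : ∃ L : ℝ, ∀ t ∈ Icc 0 T,
    |iteratedDerivWithin 1 α (Icc 0 T) t| + |iteratedDerivWithin 2 α (Icc 0 T) t|
      + |iteratedDerivWithin 3 α (Icc 0 T) t| ≤ L

/-! ### The model -/

section Model

variable {d : ℕ} {Ω : Set (EuclideanSpace ℝ (Fin d))}

/-- The right-hand side `f̄(t) = ∫₀ᵗ β_{α(0)-1}(t-s) f(s) ds + g(t) ū₀`. -/
noncomputable def modelRhs (α : ℝ → ℝ) (f : ℝ → L2 Ω) (v₀ : L2 Ω) (t : ℝ) : L2 Ω :=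
  (∫ s in (0 : ℝ)..t, abelKernel (α 0 - 1) (t - s) • f s) + genIdentity α t • v₀

/-- `u` solves
`∂ₜu + ∫₀ᵗ g'(t-s) ∂ₛu(s) ds - κ ∫₀ᵗ β_{α(0)-1}(t-s) A u(s) ds = f̄(t)` on `(0,T]`,
`u(0) = u₀`, `∂ₜu(0) = v₀`, `u = 0` on `∂Ω`. Here `ut` and `utt` are the first and second time
derivatives of `u ∈ W^{2,1}(0,T;L²) ∩ L¹(0,T;Ȟ²)`: `u` and `ut` are the absolutely continuous
representatives, with the initial values `u₀` and `v₀`. -/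
structure IsModelSolution (T κ : ℝ) (α : ℝ → ℝ) (f : ℝ → L2 Ω) (u₀ v₀ : L2 Ω)
    (u ut utt : ℝ → L2 Ω) : Prop where
  integrable_utt : IntegrableOn utt (Ioc 0 T)
  ut_eq : ∀ t ∈ Icc 0 T, ut t = v₀ + ∫ s in (0 : ℝ)..t, utt s
  u_eq : ∀ t ∈ Icc 0 T, u t = u₀ + ∫ s in (0 : ℝ)..t, ut s
  mem_HCheckTwo : ∀ t ∈ Icc 0 T, u t ∈ HCheckTwo Ω
  integrable_laplacian : IntegrableOn (fun t => dirichletLaplacian Ω (u t)) (Ioc 0 T)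
  equation : ∀ t ∈ Ioc 0 T,
    ut t + (∫ s in (0 : ℝ)..t, deriv (genIdentity α) (t - s) • ut s)
      - κ • (∫ s in (0 : ℝ)..t, abelKernel (α 0 - 1) (t - s) • dirichletLaplacian Ω (u s))
      = modelRhs α f v₀ t

/-! ### The scheme, with step size `τ` and `t_n = n τ` -/

/-- `v^{n-1/2} = (v^n + v^{n-1}) / 2`, for `n ≥ 1`. -/
noncomputable def midValue (v : ℕ → L2 Ω) (n : ℕ) : L2 Ω :=
  (1 / 2 : ℝ) • (v n + v (n - 1))

/-- `w_k = ∫_{t_k}^{t_{k+1}} g'(t) dt = g(t_{k+1}) - g(t_k)`. -/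
noncomputable def convWeight (α : ℝ → ℝ) (τ : ℝ) (k : ℕ) : ℝ :=
  genIdentity α ((k + 1) * τ) - genIdentity α (k * τ)

/-- `ω_{n,j} = τ⁻¹ ∫_{t_{n-1}}^{t_n} ∫_{t_{j-1}}^{min(t,t_j)} β_μ(t-s) ds dt`. -/
noncomputable def piWeight (μ τ : ℝ) (n j : ℕ) : ℝ :=
  (1 / τ) * ∫ t in (((n : ℝ) - 1) * τ)..(n * τ),
    ∫ s in (((j : ℝ) - 1) * τ)..(min t (j * τ)), abelKernel μ (t - s)

/-- The averaged product-integration rule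
`I_μ^{n-1/2}(φ) = ω_{n,1} φ^1 + ∑_{j=2}^n ω_{n,j} φ^{j-1/2}`. -/
noncomputable def averagedPI (μ τ : ℝ) (φ : ℕ → L2 Ω) (n : ℕ) : L2 Ω :=
  piWeight μ τ n 1 • φ 1 + ∑ j ∈ Finset.Icc 2 n, piWeight μ τ n j • midValue φ j

/-- `F̄^n = τ⁻¹ ∫_{t_{n-1}}^{t_n} f̄(t) dt`. -/
noncomputable def averagedRhs (α : ℝ → ℝ) (f : ℝ → L2 Ω) (v₀ : L2 Ω) (τ : ℝ) (n : ℕ) : L2 Ω :=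
  (1 / τ) • ∫ t in (((n : ℝ) - 1) * τ)..(n * τ), modelRhs α f v₀ t

/-- `U^0, …, U^N` is a solution of the semi-discrete second-order scheme with `N` steps of
size `τ`. -/
structure IsSecondOrderScheme (κ : ℝ) (α : ℝ → ℝ) (f : ℝ → L2 Ω) (u₀ v₀ : L2 Ω)
    (τ : ℝ) (N : ℕ) (U : ℕ → L2 Ω) : Prop where
  init : U 0 = u₀
  mem_HCheckTwo : ∀ n ∈ Finset.Icc 1 N, U n ∈ HCheckTwo Ω
  equation : ∀ n ∈ Finset.Icc 1 N,
    (1 / τ) • (U n - U (n - 1))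
      + (1 / τ) • (convWeight α τ 0 • midValue U n
          - ∑ k ∈ Finset.Icc 1 (n - 1),
              (convWeight α τ (k - 1) - convWeight α τ k) • midValue U (n - k)
          - convWeight α τ (n - 1) • U 0)
      - κ • averagedPI (α 0 - 1) τ (fun j => dirichletLaplacian Ω (U j)) n
      = averagedRhs α f v₀ τ n

end Model

/-! Since `α'(0) = α''(0) = 0`, one has `α(0) - α(s) = O(s³)`, which beats the singularities at `0`
of `log s` and its derivatives. Hence `g` has a bounded second derivative `k`, with `g(0) = 1` and
`g'(0) = 0` (`IsSmoothExponent.exists_kernel`). Integration by parts turns the memory term into `k ⋆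
u - g'(t) u₀`. The scheme times `τ` is then the equation integrated over one cell, with `u` and `A
u` replaced by step functions inside the convolutions with `k` and with the Abel kernel. So the
error `e` solves the scheme with zero initial value, and its right-hand side consists of cell
integrals of `kernel ⋆ ε`, where `ε` is the step function minus the function.

Consistency: `ε` is only `O(τ)` pointwise, and `∂ₜ²u` may blow up like `t^{α(0)-2}`. However, second
differences are controlled by increments of a primitive `μ` of this bound, so that away from the
first cell the integral of `ε` over a window of length `τ` is `τ²` times an increment of `μ`.
Integrating a convolution over a cell slides such a window along the kernel. Summed over `n`, this
gives the `L¹` norm of the kernel times a telescoping sum, hence `O(τ²)`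
(`GridApprox.sum_norm_integral_volterraConv_le`). For `A u` the estimates are obtained by duality
with test functions.

Stability: the `n`-th equation is tested with `e¹` for `n = 1` and with `e^{n-1/2}` afterwards, the
very averages to which `A` is applied in the scheme. The difference quotients produce `‖e‖² / 2`.
The Abel weights are second differences of `|x|^{α(0)}` with half the diagonal; these form a
nonnegative, nonincreasing, convex sequence, hence a positive semidefinite Toeplitz form
(`sum_toeplitz_inner_nonneg`), and by Green's formula the elliptic term has the good sign. The
weights of `k` are `O(τ²)` and are handled by Grönwall's lemma if `τ` is small (`energy_stability`).
Only finitely many `N` remain; for each of them the scheme has at most one solution, by `g ≥ 0`, so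
each costs just a constant. -/

/-! ### Volterra convolution on `[0, T]` -/

section Volterra

variable {E : Type*} [NormedAddCommGroup E] [NormedSpace ℝ E]

/-- The Volterra convolution `(k ⋆ F)(t) = ∫₀ᵗ k(t-s) F(s) ds`. -/
noncomputable def volterraConv (k : ℝ → ℝ) (F : ℝ → E) (t : ℝ) : E :=
  ∫ s in (0 : ℝ)..t, k (t - s) • F s

theorem intervalIntegrable_of_Ioc_subset {E : Type*} [NormedAddCommGroup E] {F : ℝ → E} {T a b : ℝ}
    (hF : IntegrableOn F (Ioc 0 T)) (ha : a ∈ Icc 0 T) (hb : b ∈ Icc 0 T) :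
    IntervalIntegrable F volume a b := by
  rw [intervalIntegrable_iff]
  refine hF.mono_set fun x hx => ?_
  rw [uIoc, mem_Ioc] at hx
  exact ⟨lt_of_le_of_lt (le_min ha.1 hb.1) hx.1, hx.2.trans (max_le ha.2 hb.2)⟩

theorem intervalIntegrable_volterra_integrand {T : ℝ} {k : ℝ → ℝ} {F : ℝ → E} {C : ℝ}
    (hk : IntegrableOn k (Ioc 0 T)) (hF : AEStronglyMeasurable F (volume.restrict (Ioc 0 T)))
    (hC : ∀ s ∈ Ioc 0 T, ‖F s‖ ≤ C) {t : ℝ} (ht : t ∈ Icc 0 T) :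
    IntervalIntegrable (fun s => k (t - s) • F s) volume 0 t := by
  have h1 : IntervalIntegrable (fun s => k (t - s)) volume 0 t := by
    have := (intervalIntegrable_of_Ioc_subset hk ⟨le_rfl, ht.1.trans ht.2⟩ ht).comp_sub_left t
    simpa using this.symm
  rw [intervalIntegrable_iff, uIoc_of_le ht.1] at h1 ⊢
  have hsub : Ioc 0 t ⊆ Ioc 0 T := Ioc_subset_Ioc_right ht.2
  refine Integrable.smul_bdd h1 C (hF.mono_set hsub) ?_
  filter_upwards [ae_restrict_mem measurableSet_Ioc] with s hs using hC s (hsub hs)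

/-- Extending both factors by zero gives a convolution on the whole line, for which integrability
and Fubini's theorem are available. -/
theorem volterraConv_eq_convolution {T : ℝ} (k : ℝ → ℝ) (F : ℝ → E) {t : ℝ}
    (ht : t ∈ Icc 0 T) :
    volterraConv k F t =
      ∫ r, (Ioc 0 T).indicator k r • (Ioc 0 T).indicator F (t - r) := by
  have h1 : volterraConv k F t = ∫ r in (0 : ℝ)..t, k r • F (t - r) := by
    have := intervalIntegral.integral_comp_sub_left (a := 0) (b := t)
      (fun r => k r • F (t - r)) t
    simpa [volterraConv] using this
  rw [h1, intervalIntegral.integral_of_le ht.1, integral_Ioc_eq_integral_Ioo,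
    ← integral_indicator measurableSet_Ioo]
  congr 1
  ext r
  by_cases hr : r ∈ Ioo 0 t
  · have h2 : r ∈ Ioc 0 T := ⟨hr.1, hr.2.le.trans ht.2⟩
    have h3 : t - r ∈ Ioc 0 T := ⟨sub_pos.2 hr.2, by linarith [hr.1, ht.2]⟩
    simp [indicator_of_mem hr, indicator_of_mem h2, indicator_of_mem h3]
  · rw [indicator_of_notMem hr]
    by_cases h2 : r ∈ Ioc 0 T
    · have h3 : t - r ∉ Ioc 0 T := fun h => hr ⟨h2.1, sub_pos.1 h.1⟩
      simp [indicator_of_notMem h3]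
    · simp [indicator_of_notMem h2]

theorem integrableOn_volterraConv {T : ℝ} {k : ℝ → ℝ} {F : ℝ → E}
    (hk : IntegrableOn k (Ioc 0 T)) (hF : IntegrableOn F (Ioc 0 T)) :
    IntegrableOn (volterraConv k F) (Ioc 0 T) := by
  have h1 := (integrable_indicator_iff measurableSet_Ioc).2 hk
  have h2 := (integrable_indicator_iff measurableSet_Ioc).2 hF
  have h3 := (h1.integrable_convolution (ContinuousLinearMap.lsmul ℝ ℝ) h2).integrableOn
    (s := Ioc 0 T)
  refine h3.congr_fun (fun t ht => ?_) measurableSet_Ioc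
  rw [volterraConv_eq_convolution k F (Ioc_subset_Icc_self ht)]
  rfl

/-- The primitive of a convolution is the convolution with the primitive. -/
theorem integral_volterraConv {T : ℝ} {k : ℝ → ℝ} {F : ℝ → E}
    (hk : IntegrableOn k (Ioc 0 T)) (hF : IntegrableOn F (Ioc 0 T)) {x : ℝ} (hx : x ∈ Icc 0 T) :
    ∫ t in (0 : ℝ)..x, volterraConv k F t =
      ∫ r in (0 : ℝ)..x, k r • ∫ s in (0 : ℝ)..(x - r), F s := by
  have h1 := (integrable_indicator_iff measurableSet_Ioc).2 hk
  have h2 := (integrable_indicator_iff measurableSet_Ioc).2 hF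
  have h3 := h1.convolution_integrand (ContinuousLinearMap.lsmul ℝ ℝ) h2
  have h4 : Integrable (Function.uncurry fun t r =>
      (Ioc 0 T).indicator k r • (Ioc 0 T).indicator F (t - r))
      ((volume.restrict (Ioc 0 x)).prod volume) := by
    refine h3.mono_measure ?_
    exact Measure.prod_mono Measure.restrict_le_self le_rfl
  calc ∫ t in (0 : ℝ)..x, volterraConv k F t
      = ∫ t in Ioc 0 x, ∫ r, (Ioc 0 T).indicator k r • (Ioc 0 T).indicator F (t - r) := by
        rw [intervalIntegral.integral_of_le hx.1]
        refine setIntegral_congr_fun measurableSet_Ioc fun t ht => ?_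
        exact volterraConv_eq_convolution k F ⟨ht.1.le, ht.2.trans hx.2⟩
    _ = ∫ r, ∫ t in Ioc 0 x, (Ioc 0 T).indicator k r • (Ioc 0 T).indicator F (t - r) :=
        integral_integral_swap h4
    _ = ∫ r, (Ioc 0 x).indicator (fun r => k r • ∫ s in (0 : ℝ)..(x - r), F s) r := by
        congr 1
        ext r
        rw [integral_smul, ← intervalIntegral.integral_of_le hx.1,
          intervalIntegral.integral_comp_sub_right (fun t => (Ioc 0 T).indicator F t) r]
        by_cases hr : r ∈ Ioc 0 T
        · rw [indicator_of_mem hr]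
          have hi : ∀ a b, IntervalIntegrable ((Ioc 0 T).indicator F) volume a b :=
            fun a b => h2.intervalIntegrable
          have hneg : ∀ y ≤ 0, ∫ s in (0 - r)..y, (Ioc 0 T).indicator F s = 0 := by
            intro y hy
            have : ∫ s in (0 - r)..y, (Ioc 0 T).indicator F s = ∫ s in (0 - r)..y, (0 : E) := by
              refine intervalIntegral.integral_congr fun s hs => ?_
              have : s ∉ Ioc 0 T := by
                intro h
                rw [mem_uIcc] at hs
                rcases hs with hs | hs <;> linarith [h.1, hr.1, hs.1, hs.2]
              exact indicator_of_notMem this _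
            rw [this, intervalIntegral.integral_zero]
          by_cases hrx : r ≤ x
          · rw [indicator_of_mem (show r ∈ Ioc 0 x from ⟨hr.1, hrx⟩),
              ← intervalIntegral.integral_add_adjacent_intervals (hi (0 - r) 0) (hi 0 (x - r)),
              hneg 0 le_rfl, zero_add]
            congr 1
            refine intervalIntegral.integral_congr_ae ?_
            refine Filter.Eventually.of_forall fun s hs => ?_
            rw [uIoc_of_le (by linarith)] at hs
            exact indicator_of_mem (show s ∈ Ioc 0 T from ⟨hs.1, by linarith [hs.2, hr.1, hx.2]⟩) _
          · rw [indicator_of_notMem (fun h => hrx h.2), hneg _ (by linarith), smul_zero]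
        · rw [indicator_of_notMem hr, indicator_of_notMem, zero_smul]
          exact fun h => hr ⟨h.1, h.2.trans hx.2⟩
    _ = _ := by
        rw [integral_indicator measurableSet_Ioc, intervalIntegral.integral_of_le hx.1]

end Volterra

/-! ### Consistency of the averaged product-integration rule -/

theorem sum_Icc_one_eq_sum_range {M : Type*} [AddCommMonoid M] (N : ℕ) (F : ℕ → M) :
    ∑ n ∈ Finset.Icc 1 N, F n = ∑ n ∈ Finset.range N, F (n + 1) := by
  rw [Finset.range_eq_Ico, Finset.sum_Ico_add' F 0 N 1]
  rfl

/-- The subtraction is truncated: all `n ≤ i` hit the index `0`, where `δ` vanishes, and the other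
terms form an initial piece of the unshifted sum. -/
theorem sum_range_sub_le_of_nonneg {δ : ℕ → ℝ} (hδ : ∀ j, 0 ≤ δ j) (h0 : δ 0 = 0) (N i : ℕ) :
    ∑ n ∈ Finset.range N, δ (n - i) ≤ ∑ n ∈ Finset.range N, δ n := by
  induction i with
  | zero => simp
  | succ i ih =>
    refine le_trans ?_ ih
    cases N with
    | zero => simp
    | succ M =>
      rw [Finset.sum_range_succ', Finset.sum_range_succ]
      have h1 : ∀ n ∈ Finset.range M, δ (n + 1 - (i + 1)) = δ (n - i) := fun n _ => by
        congr 1; omega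
      rw [Finset.sum_congr rfl h1]
      simp only [Nat.zero_sub, h0]
      linarith [hδ (M - i)]

theorem ceil_div_eq {τ s : ℝ} (hτ : 0 < τ) {j : ℕ} (hj : 1 ≤ j)
    (hs : s ∈ Ioc (((j : ℝ) - 1) * τ) (j * τ)) : ⌈s / τ⌉₊ = j := by
  rw [Nat.ceil_eq_iff (by omega), lt_div_iff₀ hτ, div_le_iff₀ hτ]
  push_cast [hj]
  exact hs

theorem exists_mem_Ioc_grid {τ s : ℝ} (hτ : 0 < τ) {N : ℕ} (hs : s ∈ Ioc 0 (N * τ)) :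
    ∃ j : ℕ, 1 ≤ j ∧ j ≤ N ∧ s ∈ Ioc (((j : ℝ) - 1) * τ) (j * τ) := by
  have h1 : 1 ≤ ⌈s / τ⌉₊ := Nat.one_le_ceil_iff.2 (div_pos hs.1 hτ)
  refine ⟨⌈s / τ⌉₊, h1, ?_, ?_, ?_⟩
  · rw [Nat.ceil_le, div_le_iff₀ hτ]
    exact hs.2
  · have := Nat.ceil_lt_add_one (div_pos hs.1 hτ).le
    rw [← lt_div_iff₀ hτ]
    linarith
  · rw [← div_le_iff₀ hτ]
    exact Nat.le_ceil _

section Consistency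

variable {E : Type*} [NormedAddCommGroup E] [NormedSpace ℝ E]

/-- A function with a second derivative dominated by the derivative of `μ`, and a grid function
that approximates it by mean values, except on the first interval. -/
structure GridApprox (T C : ℝ) (μ : ℝ → ℝ) (Y : ℝ → E) (τ : ℝ) (N : ℕ) (y : ℕ → E) : Prop where
  step_pos : 0 < τ
  steps : N * τ = T
  mono : Monotone μ
  lipschitz : ∀ s ∈ Icc 0 T, ∀ t ∈ Icc 0 T, ‖Y s - Y t‖ ≤ C * |s - t|
  second_diff : ∀ s h l, 0 ≤ s → 0 ≤ h → 0 ≤ l → s + h + l ≤ T →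
    ‖Y (s + h + l) - Y (s + h) - Y (s + l) + Y s‖ ≤ l * (μ (s + h + l) - μ s)
  first : ∀ s ∈ Icc 0 τ, ‖y 1 - Y s‖ ≤ C * τ
  -- The rule for `A u` takes the right end value on the first cell, so the mean is available from
  -- the second cell on only.
  mean : ∀ j : ℕ, 2 ≤ j → j ≤ N → y j = (1 / 2 : ℝ) • (Y (j * τ) + Y (((j : ℝ) - 1) * τ))

/-- The difference between a piecewise constant function on the grid and `Y`. -/
noncomputable def gridError (Y : ℝ → E) (τ : ℝ) (y : ℕ → E) (s : ℝ) : E := y ⌈s / τ⌉₊ - Y s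

/-- A majorant of `‖∫_r^{r+τ} gridError‖` for `r` in the `j`-th interval of the grid. -/
noncomputable def shiftBound (C : ℝ) (μ : ℝ → ℝ) (τ : ℝ) (j : ℕ) : ℝ :=
  -- The index used later is the truncated difference `n - 1 - ⌊r / τ⌋₊`, which is `0` once `r ≥ (n
  -- - 1) τ`; the value `0` makes those `r` contribute nothing.
  if j = 0 then 0
  else (if j = 1 then C * τ ^ 2 else 0) + 2 * τ ^ 2 * (μ ((j + 1) * τ) - μ (((j : ℝ) - 1) * τ))

namespace GridApprox

variable {T C : ℝ} {μ : ℝ → ℝ} {Y : ℝ → E} {τ : ℝ} {N : ℕ} {y : ℕ → E}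

theorem const_nonneg (h : GridApprox T C μ Y τ N y) : 0 ≤ C := by
  have h1 := (norm_nonneg _).trans (h.first 0 ⟨le_rfl, h.step_pos.le⟩)
  nlinarith [h.step_pos]

theorem continuousOn (h : GridApprox T C μ Y τ N y) : ContinuousOn Y (Icc 0 T) := by
  have : LipschitzOnWith (Real.toNNReal C) Y (Icc 0 T) := by
    refine LipschitzOnWith.of_dist_le_mul fun s hs t ht => ?_
    rw [Real.coe_toNNReal _ h.const_nonneg, dist_eq_norm, Real.dist_eq]
    exact h.lipschitz s hs t ht
  exact this.continuousOn

theorem grid_mem (h : GridApprox T C μ Y τ N y) {j : ℝ} (h0 : 0 ≤ j) (hj : j ≤ N) :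
    j * τ ∈ Icc 0 T := by
  refine ⟨mul_nonneg h0 h.step_pos.le, ?_⟩
  rw [← h.steps]
  exact mul_le_mul_of_nonneg_right hj h.step_pos.le

theorem norm_gridError_le (h : GridApprox T C μ Y τ N y) {s : ℝ} (hs : s ∈ Ioc 0 T) :
    ‖gridError Y τ y s‖ ≤ C * τ := by
  obtain ⟨j, hj, hjN, hsj⟩ := exists_mem_Ioc_grid h.step_pos (N := N) (by rwa [h.steps])
  have hjN' : (j : ℝ) ≤ N := by exact_mod_cast hjN
  have hj' : (1 : ℝ) ≤ j := by exact_mod_cast hj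
  rw [gridError, ceil_div_eq h.step_pos hj hsj]
  rcases hj.eq_or_lt with rfl | hj2
  · exact h.first s ⟨hs.1.le, by simpa using hsj.2⟩
  · rw [h.mean j hj2 hjN]
    have e : (1 / 2 : ℝ) • (Y (j * τ) + Y (((j : ℝ) - 1) * τ)) - Y s
        = (1 / 2 : ℝ) • ((Y (j * τ) - Y s) + (Y (((j : ℝ) - 1) * τ) - Y s)) := by
      module
    have b1 := h.lipschitz _ (h.grid_mem (by linarith) hjN') s ⟨hs.1.le, hs.2⟩
    have b2 := h.lipschitz _ (h.grid_mem (j := (j : ℝ) - 1) (by linarith) (by linarith)) s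
      ⟨hs.1.le, hs.2⟩
    rw [abs_of_nonneg (by linarith [hsj.2])] at b1
    rw [abs_of_nonpos (by linarith [hsj.1])] at b2
    rw [e, norm_smul]
    have b3 := norm_add_le (Y (j * τ) - Y s) (Y (((j : ℝ) - 1) * τ) - Y s)
    have hn : ‖(1 / 2 : ℝ)‖ = 1 / 2 := by norm_num
    rw [hn]
    have : C * (j * τ - s) + C * -((j - 1) * τ - s) = C * τ := by ring
    nlinarith [mul_nonneg h.const_nonneg h.step_pos.le]

theorem aestronglyMeasurable_gridError (h : GridApprox T C μ Y τ N y) :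
    AEStronglyMeasurable (gridError Y τ y) (volume.restrict (Ioc 0 T)) := by
  refine AEStronglyMeasurable.sub ?_ ?_
  · have h1 : Measurable fun s : ℝ => ⌈s / τ⌉₊ := Nat.measurable_ceil.comp (measurable_id.div_const τ)
    exact (StronglyMeasurable.of_discrete (f := y)).comp_measurable h1 |>.aestronglyMeasurable
  · exact (h.continuousOn.mono Ioc_subset_Icc_self).aestronglyMeasurable measurableSet_Ioc

theorem integrableOn_gridError (h : GridApprox T C μ Y τ N y) :
    IntegrableOn (gridError Y τ y) (Ioc 0 T) := by
  refine Integrable.of_bound h.aestronglyMeasurable_gridError (C * τ) ?_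
  filter_upwards [ae_restrict_mem measurableSet_Ioc] with s hs using h.norm_gridError_le hs

theorem norm_integral_gridError_le (h : GridApprox T C μ Y τ N y) {a b : ℝ} (ha : 0 ≤ a)
    (hab : a ≤ b) (hb : b ≤ T) : ‖∫ s in a..b, gridError Y τ y s‖ ≤ C * τ * (b - a) := by
  rw [← abs_of_nonneg (sub_nonneg.2 hab)]
  refine intervalIntegral.norm_integral_le_of_norm_le_const fun s hs => ?_
  rw [uIoc_of_le hab] at hs
  exact h.norm_gridError_le ⟨ha.trans_lt hs.1, hs.2.trans hb⟩

/-- The reflection `s ↦ a + b - s` of the cell preserves the integral. Averaging with it replaces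
the first-order error by `Y b - Y s - Y (a + b - s) + Y a`, a second difference. -/
theorem norm_integral_cell_le (h : GridApprox T C μ Y τ N y) {j : ℕ} (hj : 2 ≤ j) (hjN : j ≤ N) :
    ‖∫ s in (((j : ℝ) - 1) * τ)..(j * τ), gridError Y τ y s‖
      ≤ τ ^ 2 * (μ (j * τ) - μ (((j : ℝ) - 1) * τ)) := by
  have hjN' : (j : ℝ) ≤ N := by exact_mod_cast hjN
  have hj' : (2 : ℝ) ≤ j := by exact_mod_cast hj
  set a := ((j : ℝ) - 1) * τ with ha
  set b := (j : ℝ) * τ with hb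
  have hba : b = a + τ := by rw [ha, hb]; ring
  have ha0 : a ∈ Icc 0 T := h.grid_mem (by linarith) (by linarith)
  have hb0 : b ∈ Icc 0 T := h.grid_mem (by linarith) hjN'
  have hτ := h.step_pos
  have e1 : ∫ s in a..b, gridError Y τ y s = ∫ s in a..b, (y j - Y s) := by
    refine intervalIntegral.integral_congr_ae (Filter.Eventually.of_forall fun s hs => ?_)
    rw [uIoc_of_le (by linarith)] at hs
    rw [gridError, ceil_div_eq hτ (by omega) hs]
  have hYi : IntervalIntegrable (fun s => y j - Y s) volume a b := by
    refine ContinuousOn.intervalIntegrable (continuousOn_const.sub (h.continuousOn.mono ?_))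
    rw [uIcc_of_le (by linarith)]
    exact Icc_subset_Icc ha0.1 hb0.2
  have hYi' : IntervalIntegrable (fun s => y j - Y (a + b - s)) volume a b := by
    have := hYi.comp_sub_left (a + b)
    simpa using this.symm
  have e2 : ∫ s in a..b, (y j - Y (a + b - s)) = ∫ s in a..b, (y j - Y s) := by
    have := intervalIntegral.integral_comp_sub_left (a := a) (b := b) (fun s => y j - Y s) (a + b)
    simpa using this
  have e3 : ∫ s in a..b, gridError Y τ y s
      = (1 / 2 : ℝ) • ∫ s in a..b, ((y j - Y s) + (y j - Y (a + b - s))) := by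
    rw [intervalIntegral.integral_add hYi hYi', e2, e1]
    module
  rw [e3, norm_smul]
  have b1 : ‖∫ s in a..b, ((y j - Y s) + (y j - Y (a + b - s)))‖ ≤ τ * (μ b - μ a) * |b - a| := by
    refine intervalIntegral.norm_integral_le_of_norm_le_const fun s hs => ?_
    rw [uIoc_of_le (by linarith)] at hs
    have b2 := h.second_diff a (s - a) (b - s) ha0.1 (by linarith [hs.1]) (by linarith [hs.2])
      (by linarith [hb0.2])
    rw [show a + (s - a) + (b - s) = b by ring, show a + (s - a) = s by ring,
      show a + (b - s) = a + b - s by ring] at b2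
    have e4 : (y j - Y s) + (y j - Y (a + b - s)) = Y b - Y s - Y (a + b - s) + Y a := by
      rw [h.mean j hj hjN]
      module
    rw [e4]
    refine b2.trans (mul_le_mul_of_nonneg_right (by linarith [hs.1]) ?_)
    exact sub_nonneg.2 (h.mono (by linarith))
  have hμ : 0 ≤ μ b - μ a := sub_nonneg.2 (h.mono (by linarith))
  rw [abs_of_nonneg (by linarith), show b - a = τ by linarith] at b1
  have hn : ‖(1 / 2 : ℝ)‖ = 1 / 2 := by norm_num
  rw [hn]
  nlinarith [mul_nonneg (mul_nonneg hτ.le hτ.le) hμ]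

/-- A window that is not aligned with the grid differs from the cell on its left by the integral of
`gridError (s + τ) - gridError s`, which is half a difference of two second differences of `Y`. If
the window starts in the first cell, the pointwise bound `C τ` on a length `τ` already suffices. -/
theorem norm_integral_shift_le (h : GridApprox T C μ Y τ N y) {j : ℕ} (hj : 1 ≤ j)
    (hjN : j + 1 ≤ N) {r : ℝ} (hr : r ∈ Ioc (((j : ℝ) - 1) * τ) (j * τ)) :
    ‖∫ s in r..(r + τ), gridError Y τ y s‖ ≤ shiftBound C μ τ j := by
  have hjN' : (j : ℝ) + 1 ≤ N := by exact_mod_cast hjN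
  have hj' : (1 : ℝ) ≤ j := by exact_mod_cast hj
  set a := ((j : ℝ) - 1) * τ with ha
  set b := (j : ℝ) * τ with hb
  have hτ := h.step_pos
  have hba : b = a + τ := by rw [ha, hb]; ring
  have hc : ((j : ℝ) + 1) * τ = b + τ := by rw [hb]; ring
  have ha0 : a ∈ Icc 0 T := h.grid_mem (by linarith) (by linarith)
  have hb0 : b ∈ Icc 0 T := h.grid_mem (by linarith) (by linarith)
  have hc0 : b + τ ∈ Icc 0 T := hc ▸ h.grid_mem (by linarith) hjN'
  rw [shiftBound, if_neg (by omega), hc, ← ha]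
  have hμ : 0 ≤ μ (b + τ) - μ a := sub_nonneg.2 (h.mono (by linarith))
  rcases hj.eq_or_lt with hj1 | hj2
  · rw [if_pos hj1.symm]
    have := h.norm_integral_gridError_le (a := r) (b := r + τ) (by linarith [hr.1, ha0.1])
      (by linarith) (by linarith [hr.2, hc0.2])
    nlinarith [mul_nonneg (mul_nonneg hτ.le hτ.le) hμ]
  · rw [if_neg (by omega), zero_add]
    have hint : ∀ x z, x ∈ Icc 0 T → z ∈ Icc 0 T →
        IntervalIntegrable (gridError Y τ y) volume x z := fun x z hx hz =>
      intervalIntegrable_of_Ioc_subset h.integrableOn_gridError hx hz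
    have hr0 : r ∈ Icc 0 T := ⟨by linarith [hr.1, ha0.1], by linarith [hr.2, hb0.2]⟩
    have hr1 : r + τ ∈ Icc 0 T := ⟨by linarith [hr.1, ha0.1], by linarith [hr.2, hc0.2]⟩
    have hsh : IntervalIntegrable (fun s => gridError Y τ y (s + τ)) volume a r := by
      have := (hint b (r + τ) hb0 hr1).comp_add_right τ
      simpa [hba] using this
    have e1 : ∫ s in r..(r + τ), gridError Y τ y s
        = (∫ s in a..b, gridError Y τ y s)
          + ∫ s in a..r, (gridError Y τ y (s + τ) - gridError Y τ y s) := by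
      rw [intervalIntegral.integral_sub hsh (hint a r ha0 hr0),
        intervalIntegral.integral_comp_add_right (fun s => gridError Y τ y s) τ, ← hba,
        ← intervalIntegral.integral_add_adjacent_intervals (hint r a hr0 ha0)
          (hint a (r + τ) ha0 hr1),
        ← intervalIntegral.integral_add_adjacent_intervals (hint a b ha0 hb0)
          (hint b (r + τ) hb0 hr1), intervalIntegral.integral_symm a r]
      abel
    have b1 : ‖∫ s in a..r, (gridError Y τ y (s + τ) - gridError Y τ y s)‖
        ≤ τ * (μ (b + τ) - μ a) * |r - a| := by
      refine intervalIntegral.norm_integral_le_of_norm_le_const fun s hs => ?_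
      rw [uIoc_of_le hr.1.le] at hs
      have hs1 : s ∈ Ioc a b := ⟨hs.1, hs.2.trans hr.2⟩
      have hs2 : s + τ ∈ Ioc ((((j + 1 : ℕ) : ℝ) - 1) * τ) (((j + 1 : ℕ) : ℝ) * τ) := by
        push_cast
        rw [hc, show ((j : ℝ) + 1 - 1) * τ = b by rw [hb]; ring]
        exact ⟨by linarith [hs.1], by linarith [hs1.2]⟩
      rw [gridError, gridError, ceil_div_eq hτ (by omega) hs2, ceil_div_eq hτ (by omega) hs1,
        h.mean j hj2 (by omega), h.mean (j + 1) (by omega) hjN]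
      push_cast
      rw [hc, show ((j : ℝ) + 1 - 1) * τ = b by rw [hb]; ring, ← ha, ← hb]
      have c1 := h.second_diff a (s - a) τ ha0.1 (by linarith [hs.1]) hτ.le
        (by linarith [hs1.2, hc0.2])
      have c2 := h.second_diff s (b - s) τ (by linarith [hs.1, ha0.1]) (by linarith [hs1.2]) hτ.le
        (by linarith [hc0.2])
      rw [show a + (s - a) = s by ring, ← hba] at c1
      rw [show s + (b - s) = b by ring] at c2
      have e4 : (1 / 2 : ℝ) • (Y (b + τ) + Y b) - Y (s + τ) - ((1 / 2 : ℝ) • (Y b + Y a) - Y s)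
          = (1 / 2 : ℝ) • ((Y (b + τ) - Y b - Y (s + τ) + Y s)
            - (Y (s + τ) - Y s - Y b + Y a)) := by module
      have hn : ‖(1 / 2 : ℝ)‖ = 1 / 2 := by norm_num
      rw [e4, norm_smul, hn]
      have c3 := norm_sub_le (Y (b + τ) - Y b - Y (s + τ) + Y s) (Y (s + τ) - Y s - Y b + Y a)
      have m1 : μ (s + τ) ≤ μ (b + τ) := h.mono (by linarith [hs1.2])
      have m2 : μ a ≤ μ s := h.mono hs.1.le
      nlinarith [mul_nonneg hτ.le (sub_nonneg.2 m1), mul_nonneg hτ.le (sub_nonneg.2 m2)]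
    have b2 := h.norm_integral_cell_le hj2 (by omega)
    rw [← ha, ← hb] at b2
    rw [e1]
    refine (norm_add_le _ _).trans ?_
    rw [abs_of_nonneg (by linarith [hr.1])] at b1
    have m1 : μ b ≤ μ (b + τ) := h.mono (by linarith)
    have m3 : τ * (μ (b + τ) - μ a) * (r - a) ≤ τ * (μ (b + τ) - μ a) * τ :=
      mul_le_mul_of_nonneg_left (by linarith [hr.2]) (mul_nonneg hτ.le hμ)
    nlinarith [mul_nonneg (mul_nonneg hτ.le hτ.le) (sub_nonneg.2 m1)]

theorem shiftBound_nonneg (h : GridApprox T C μ Y τ N y) (j : ℕ) : 0 ≤ shiftBound C μ τ j := by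
  have hμ : 0 ≤ μ ((j + 1) * τ) - μ (((j : ℝ) - 1) * τ) :=
    sub_nonneg.2 (h.mono (mul_le_mul_of_nonneg_right (by linarith) h.step_pos.le))
  have := h.const_nonneg
  unfold shiftBound
  split_ifs <;> positivity

theorem sum_shiftBound_le (h : GridApprox T C μ Y τ N y) :
    ∑ j ∈ Finset.range N, shiftBound C μ τ j ≤ (C + 4 * (μ T - μ 0)) * τ ^ 2 := by
  -- The increments of `μ` span two cells, so the sum telescopes as two interlaced sums, each
  -- leaving one term at either end.
  have key : ∀ n : ℕ, 1 ≤ n → ∑ j ∈ Finset.range n, shiftBound C μ τ j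
      ≤ C * τ ^ 2 + 2 * τ ^ 2 * (μ (n * τ) + μ (((n : ℝ) - 1) * τ) - μ τ - μ 0) := by
    intro n hn
    induction n, hn using Nat.le_induction with
    | base => simpa [shiftBound] using mul_nonneg h.const_nonneg (sq_nonneg τ)
    | succ n hn ih =>
      rw [Finset.sum_range_succ]
      rcases hn.eq_or_lt with rfl | hn2
      · simp [shiftBound]
        norm_num
      · rw [shiftBound, if_neg (by omega), if_neg (by omega)]
        push_cast
        rw [show ((n : ℝ) + 1 - 1) = n by ring]
        nlinarith
  have hμ0 : μ 0 ≤ μ T := h.mono (by rw [← h.steps]; have := h.step_pos; positivity)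
  rcases Nat.eq_zero_or_pos N with rfl | hN
  · have := h.const_nonneg
    simp only [Finset.range_zero, Finset.sum_empty]
    have := sub_nonneg.2 hμ0
    positivity
  · refine (key N hN).trans ?_
    rw [h.steps]
    have m1 : μ (((N : ℝ) - 1) * τ) ≤ μ T := h.mono (by rw [← h.steps]; linarith [h.step_pos])
    have m2 : μ 0 ≤ μ τ := h.mono h.step_pos.le
    nlinarith [mul_nonneg (sq_nonneg τ) (sub_nonneg.2 m1), mul_nonneg (sq_nonneg τ) (sub_nonneg.2 m2)]

/-- By Fubini, each `k r` multiplies the integral of the error over the cell moved back by `r`. For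
`r` below the cell this is a window of length `τ` starting in the cell number `n - 1 - ⌊r / τ⌋₊`;
for `r` inside the cell the window is cut at `0` and the pointwise bound is used. Only integrability
of `k` is needed. -/
theorem norm_integral_volterraConv_cell_le (h : GridApprox T C μ Y τ N y) {k : ℝ → ℝ}
    (hk : IntegrableOn k (Ioc 0 T)) {n : ℕ} (hn : 1 ≤ n) (hnN : n ≤ N) :
    ‖∫ t in (((n : ℝ) - 1) * τ)..(n * τ), volterraConv k (gridError Y τ y) t‖
      ≤ C * τ ^ 2 * (∫ r in (((n : ℝ) - 1) * τ)..(n * τ), |k r|)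
        + ∫ r in (0 : ℝ)..T, |k r| * shiftBound C μ τ (n - 1 - ⌊r / τ⌋₊) := by
  have hnN' : (n : ℝ) ≤ N := by exact_mod_cast hnN
  have hn' : (1 : ℝ) ≤ n := by exact_mod_cast hn
  set a := ((n : ℝ) - 1) * τ with ha
  set b := (n : ℝ) * τ with hb
  have hτ := h.step_pos
  have hba : b = a + τ := by rw [ha, hb]; ring
  have ha0 : a ∈ Icc 0 T := h.grid_mem (by linarith) (by linarith)
  have hb0 : b ∈ Icc 0 T := h.grid_mem (by linarith) (by linarith)
  have h00 : (0 : ℝ) ∈ Icc 0 T := ⟨le_rfl, ha0.1.trans ha0.2⟩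
  have hB := h.integrableOn_gridError
  have hBi : ∀ x z, x ∈ Icc 0 T → z ∈ Icc 0 T →
      IntervalIntegrable (gridError Y τ y) volume x z := fun x z hx hz =>
    intervalIntegrable_of_Ioc_subset hB hx hz
  have hci := integrableOn_volterraConv hk hB
  have hki : ∀ x z, x ∈ Icc 0 T → z ∈ Icc 0 T → IntervalIntegrable k volume x z :=
    fun x z hx hz => intervalIntegrable_of_Ioc_subset hk hx hz
  -- the primitive is continuous and bounded, so the products below are integrable
  have hprod : ∀ x ∈ Icc 0 T, IntervalIntegrable
      (fun r => k r • ∫ s in (0 : ℝ)..(x - r), gridError Y τ y s) volume 0 x := by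
    intro x hx
    refine (hki 0 x h00 hx).smul_continuousOn ?_
    have hc : ContinuousOn (fun z => ∫ s in (0 : ℝ)..z, gridError Y τ y s) (Icc 0 T) := by
      have := intervalIntegral.continuousOn_primitive_interval' (hBi 0 T h00 ⟨h00.2, le_rfl⟩)
        (left_mem_uIcc)
      rwa [uIcc_of_le h00.2] at this
    refine hc.comp (continuousOn_const.sub continuousOn_id) fun r hr => ?_
    rw [uIcc_of_le hx.1] at hr
    exact ⟨by simpa using hr.2, by change x - r ≤ T; linarith [hr.1, hx.2]⟩
  have hsub : IntervalIntegrable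
      (fun r => k r • ∫ s in (0 : ℝ)..(b - r), gridError Y τ y s) volume 0 a :=
    (hprod b hb0).mono_set (by
      rw [uIcc_of_le ha0.1, uIcc_of_le hb0.1]; exact Icc_subset_Icc_right (by linarith))
  have hsub2 : IntervalIntegrable
      (fun r => k r • ∫ s in (0 : ℝ)..(b - r), gridError Y τ y s) volume a b :=
    (hprod b hb0).mono_set (by
      rw [uIcc_of_le (by linarith), uIcc_of_le hb0.1]; exact Icc_subset_Icc_left ha0.1)
  have e1 : ∫ t in a..b, volterraConv k (gridError Y τ y) t
      = (∫ r in a..b, k r • ∫ s in (0 : ℝ)..(b - r), gridError Y τ y s)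
        + ∫ r in (0 : ℝ)..a, k r • ∫ s in (a - r)..(b - r), gridError Y τ y s := by
    have f1 := intervalIntegral.integral_add_adjacent_intervals
      (intervalIntegrable_of_Ioc_subset hci h00 ha0) (intervalIntegrable_of_Ioc_subset hci ha0 hb0)
    rw [integral_volterraConv hk hB ha0, integral_volterraConv hk hB hb0,
      ← intervalIntegral.integral_add_adjacent_intervals hsub hsub2] at f1
    have f2 : ∫ r in (0 : ℝ)..a, k r • ∫ s in (a - r)..(b - r), gridError Y τ y s
        = (∫ r in (0 : ℝ)..a, k r • ∫ s in (0 : ℝ)..(b - r), gridError Y τ y s)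
          - ∫ r in (0 : ℝ)..a, k r • ∫ s in (0 : ℝ)..(a - r), gridError Y τ y s := by
      rw [← intervalIntegral.integral_sub hsub (hprod a ha0)]
      refine intervalIntegral.integral_congr fun r hr => ?_
      rw [uIcc_of_le ha0.1] at hr
      have m1 : a - r ∈ Icc 0 T := ⟨by linarith [hr.2], by linarith [hr.1, ha0.2]⟩
      have m2 : b - r ∈ Icc 0 T := ⟨by linarith [hr.2], by linarith [hr.1, hb0.2]⟩
      rw [← intervalIntegral.integral_add_adjacent_intervals (hBi _ _ h00 m1) (hBi _ _ m1 m2),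
        smul_add, add_sub_cancel_left]
    rw [f2, eq_sub_of_add_eq' f1]
    abel
  rw [e1]
  refine (norm_add_le _ _).trans (add_le_add ?_ ?_)
  · rw [← intervalIntegral.integral_const_mul]
    refine intervalIntegral.norm_integral_le_of_norm_le (by linarith)
      (Filter.Eventually.of_forall fun r hr => ?_) ((hki a b ha0 hb0).abs.const_mul _)
    rw [norm_smul, Real.norm_eq_abs, mul_comm]
    refine mul_le_mul_of_nonneg_right ?_ (abs_nonneg _)
    have c1 := h.norm_integral_gridError_le (a := 0) (b := b - r) le_rfl (by linarith [hr.2])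
      (by linarith [hr.1, ha0.1, hb0.2])
    refine c1.trans ?_
    have : C * τ * (b - r - 0) ≤ C * τ * τ :=
      mul_le_mul_of_nonneg_left (by linarith [hr.1]) (mul_nonneg h.const_nonneg hτ.le)
    linarith [this, show C * τ ^ 2 = C * τ * τ by ring]
  · have hδm : AEStronglyMeasurable (fun r : ℝ => shiftBound C μ τ (n - 1 - ⌊r / τ⌋₊))
        (volume.restrict (Ioc 0 T)) := by
      have h1 : Measurable fun s : ℝ => ⌊s / τ⌋₊ :=
        Nat.measurable_floor.comp (measurable_id.div_const τ)
      have h2 : Measurable fun i : ℕ => shiftBound C μ τ (n - 1 - i) := measurable_from_nat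
      exact (h2.comp h1).aestronglyMeasurable
    have hδi : IntervalIntegrable (fun r => |k r| * shiftBound C μ τ (n - 1 - ⌊r / τ⌋₊))
        volume 0 T := by
      rw [intervalIntegrable_iff, uIoc_of_le h00.2]
      refine Integrable.mul_bdd (c := ∑ j ∈ Finset.range N, shiftBound C μ τ j) hk.abs hδm ?_
      refine Filter.Eventually.of_forall fun r => ?_
      rw [Real.norm_of_nonneg (h.shiftBound_nonneg _)]
      exact Finset.single_le_sum (f := fun j => shiftBound C μ τ j)
        (fun j _ => h.shiftBound_nonneg j) (Finset.mem_range.2 (by omega))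
    refine le_trans (intervalIntegral.norm_integral_le_of_norm_le ha0.1
      (g := fun r => |k r| * shiftBound C μ τ (n - 1 - ⌊r / τ⌋₊)) ?_ ?_) ?_
    -- At `r = a` the index `n - 1 - ⌊r / τ⌋₊` drops to `0`, where `shiftBound` is `0` and bounds
    -- nothing; this single point is discarded.
    · have hne : ∀ᵐ r : ℝ, r ≠ a := by simp [ae_iff, measure_singleton]
      filter_upwards [hne] with r hra hr
      rw [norm_smul, Real.norm_eq_abs]
      refine mul_le_mul_of_nonneg_left ?_ (abs_nonneg _)
      have hra' : r < a := lt_of_le_of_ne hr.2 hra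
      have hfl := Nat.floor_le (div_nonneg hr.1.le hτ.le)
      have hfl2 := Nat.lt_floor_add_one (r / τ)
      rw [le_div_iff₀ hτ] at hfl
      rw [div_lt_iff₀ hτ] at hfl2
      have hlt : ⌊r / τ⌋₊ < n - 1 := by
        rw [Nat.floor_lt (div_nonneg hr.1.le hτ.le), div_lt_iff₀ hτ]
        push_cast [hn]
        exact hra'
      have hcast : ((n - 1 - ⌊r / τ⌋₊ : ℕ) : ℝ) = (n : ℝ) - 1 - ⌊r / τ⌋₊ := by
        push_cast [hn, hlt.le]
        ring
      have := h.norm_integral_shift_le (j := n - 1 - ⌊r / τ⌋₊) (r := a - r) (by omega) (by omega)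
        (by rw [hcast]; constructor <;> nlinarith)
      rwa [show a - r + τ = b - r by linarith] at this
    · exact hδi.mono_set (by
        rw [uIcc_of_le ha0.1, uIcc_of_le h00.2]; exact Icc_subset_Icc_right ha0.2)
    · refine intervalIntegral.integral_mono_interval le_rfl ha0.1 ha0.2 ?_ hδi
      exact Filter.Eventually.of_forall fun r =>
        mul_nonneg (abs_nonneg _) (h.shiftBound_nonneg _)

/-- The averaged product-integration rule is of second order, summed over the time levels. -/
theorem sum_norm_integral_volterraConv_le (h : GridApprox T C μ Y τ N y) {k : ℝ → ℝ}
    (hk : IntegrableOn k (Ioc 0 T)) :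
    ∑ n ∈ Finset.Icc 1 N,
        ‖∫ t in (((n : ℝ) - 1) * τ)..(n * τ), volterraConv k (gridError Y τ y) t‖
      ≤ (∫ r in (0 : ℝ)..T, |k r|) * (2 * C + 4 * (μ T - μ 0)) * τ ^ 2 := by
  have hT : 0 ≤ T := by rw [← h.steps]; have := h.step_pos; positivity
  have hki : ∀ x z, x ∈ Icc 0 T → z ∈ Icc 0 T → IntervalIntegrable k volume x z :=
    fun x z hx hz => intervalIntegrable_of_Ioc_subset hk hx hz
  have hI0 : 0 ≤ ∫ r in (0 : ℝ)..T, |k r| :=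
    intervalIntegral.integral_nonneg hT fun r _ => abs_nonneg _
  have s1 : ∑ n ∈ Finset.Icc 1 N, ∫ r in (((n : ℝ) - 1) * τ)..(n * τ), |k r|
      = ∫ r in (0 : ℝ)..T, |k r| := by
    rw [sum_Icc_one_eq_sum_range]
    have := intervalIntegral.sum_integral_adjacent_intervals (f := fun r => |k r|) (μ := volume)
      (a := fun i : ℕ => (i : ℝ) * τ) (n := N) (fun i hi => by
        have hi' : (i : ℝ) + 1 ≤ N := by exact_mod_cast hi
        refine (hki _ _ (h.grid_mem (by positivity) (by linarith)) ?_).abs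
        push_cast
        exact h.grid_mem (by positivity) hi')
    simp only [Nat.cast_zero, zero_mul, h.steps] at this
    rw [← this]
    refine Finset.sum_congr rfl fun i _ => ?_
    push_cast
    ring_nf
  have hδm : ∀ n : ℕ, AEStronglyMeasurable (fun r : ℝ => shiftBound C μ τ (n - 1 - ⌊r / τ⌋₊))
        (volume.restrict (Ioc 0 T)) := by
    intro n
    have h1 : Measurable fun s : ℝ => ⌊s / τ⌋₊ :=
      Nat.measurable_floor.comp (measurable_id.div_const τ)
    have h2 : Measurable fun i : ℕ => shiftBound C μ τ (n - 1 - i) := measurable_from_nat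
    exact (h2.comp h1).aestronglyMeasurable
  have hδi : ∀ n ∈ Finset.Icc 1 N,
      IntervalIntegrable (fun r => |k r| * shiftBound C μ τ (n - 1 - ⌊r / τ⌋₊)) volume 0 T := by
    intro n hn
    have hn := Finset.mem_Icc.1 hn
    rw [intervalIntegrable_iff, uIoc_of_le hT]
    refine Integrable.mul_bdd (c := ∑ j ∈ Finset.range N, shiftBound C μ τ j) hk.abs (hδm n) ?_
    refine Filter.Eventually.of_forall fun r => ?_
    rw [Real.norm_of_nonneg (h.shiftBound_nonneg _)]
    exact Finset.single_le_sum (f := fun j => shiftBound C μ τ j)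
      (fun j _ => h.shiftBound_nonneg j) (Finset.mem_range.2 (by omega))
  have s2 : ∑ n ∈ Finset.Icc 1 N,
      ∫ r in (0 : ℝ)..T, |k r| * shiftBound C μ τ (n - 1 - ⌊r / τ⌋₊)
      ≤ (∫ r in (0 : ℝ)..T, |k r|) * ((C + 4 * (μ T - μ 0)) * τ ^ 2) := by
    -- For fixed `r` the sum over `n` is a shifted sum of `shiftBound`, bounded independently of
    -- `r`; this is a discrete form of Young's inequality in `L¹`.
    rw [← intervalIntegral.integral_finsetSum hδi, ← intervalIntegral.integral_mul_const]
    refine intervalIntegral.integral_mono_on hT ?_ ?_ fun r _ => ?_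
    · have := IntervalIntegrable.sum (Finset.Icc 1 N) hδi
      refine this.congr fun r _ => ?_
      simp [Finset.sum_apply]
    · exact (hki 0 T ⟨le_rfl, hT⟩ ⟨hT, le_rfl⟩).abs.mul_const _
    · rw [← Finset.mul_sum]
      refine mul_le_mul_of_nonneg_left ?_ (abs_nonneg _)
      rw [sum_Icc_one_eq_sum_range]
      simp only [Nat.add_sub_cancel]
      exact (sum_range_sub_le_of_nonneg h.shiftBound_nonneg (by simp [shiftBound]) N _).trans
        h.sum_shiftBound_le
  calc _ ≤ ∑ n ∈ Finset.Icc 1 N, (C * τ ^ 2 * (∫ r in (((n : ℝ) - 1) * τ)..(n * τ), |k r|)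
        + ∫ r in (0 : ℝ)..T, |k r| * shiftBound C μ τ (n - 1 - ⌊r / τ⌋₊)) :=
        Finset.sum_le_sum fun n hn => h.norm_integral_volterraConv_cell_le hk
          (Finset.mem_Icc.1 hn).1 (Finset.mem_Icc.1 hn).2
    _ ≤ _ := by
        rw [Finset.sum_add_distrib, ← Finset.mul_sum, s1]
        linarith

end GridApprox

end Consistency

/-! ### Positivity of convex Toeplitz kernels -/

section Toeplitz

variable {H : Type*} [NormedAddCommGroup H] [InnerProductSpace ℝ H]

open Finset in
-- The triangle function is the autocorrelation of the indicator of a block of length `M`: it counts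
-- the `r` lying in both `[j, j + M)` and `[n, n + M)`. The double sum is therefore a sum over `r`
-- of squared norms.
theorem sum_triangle_inner_nonneg (M N : ℕ) (v : ℕ → H) :
    0 ≤ ∑ n ∈ range N, ∑ j ∈ range N, ((M - (n - j + (j - n)) : ℕ) : ℝ) * inner ℝ (v j) (v n) := by
  let χ : ℕ → ℕ → ℝ := fun r j => if j ≤ r ∧ r < j + M then 1 else 0
  have hχ : ∀ n ∈ range N, ∀ j ∈ range N,
      ∑ r ∈ range (N + M), χ r j * χ r n = ((M - (n - j + (j - n)) : ℕ) : ℝ) := by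
    intro n hn j hj
    have hn := mem_range.1 hn
    have hj := mem_range.1 hj
    have h1 : ∀ r, χ r j * χ r n = if r ∈ Finset.Ico (max n j) (min n j + M) then 1 else 0 := by
      intro r
      simp only [χ, Finset.mem_Ico, ← ite_and, mul_ite, mul_one, mul_zero]
      congr 1
      simp only [eq_iff_iff]
      omega
    simp only [h1]
    rw [sum_ite_mem, Finset.inter_eq_right.2, sum_const, Nat.card_Ico, nsmul_eq_mul, mul_one]
    · congr 1
      omega
    · intro r hr
      simp only [Finset.mem_Ico, Finset.mem_range] at hr ⊢
      omega
  have h2 : ∑ n ∈ range N, ∑ j ∈ range N,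
      ((M - (n - j + (j - n)) : ℕ) : ℝ) * inner ℝ (v j) (v n)
      = ∑ r ∈ range (N + M), inner ℝ (∑ j ∈ range N, χ r j • v j) (∑ n ∈ range N, χ r n • v n) := by
    simp only [sum_inner, inner_sum, real_inner_smul_left, real_inner_smul_right]
    rw [sum_comm (s := range (N + M))]
    refine sum_congr rfl fun n hn => ?_
    rw [sum_comm (s := range (N + M))]
    refine sum_congr rfl fun j hj => ?_
    rw [← hχ n hn j hj, sum_mul]
    exact sum_congr rfl fun r _ => by ring
  rw [h2]
  exact sum_nonneg fun r _ => real_inner_self_nonneg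

open Finset in
/-- A nonnegative, nonincreasing, convex sequence generates a positive semidefinite Toeplitz
kernel. -/
theorem sum_toeplitz_inner_nonneg {a : ℕ → ℝ} (h0 : ∀ k, 0 ≤ a k) (h1 : ∀ k, a (k + 1) ≤ a k)
    (h2 : ∀ k, 0 ≤ a k - 2 * a (k + 1) + a (k + 2)) (N : ℕ) (v : ℕ → H) :
    0 ≤ ∑ n ∈ range N, ∑ j ∈ range N, a (n - j + (j - n)) * inner ℝ (v j) (v n) := by
  -- Discrete Taylor expansion at `N`: on `k ≤ N` the sequence is a combination of a constant and of
  -- triangles `(i + 1 - k)₊`. The coefficients are `a N`, a decrement and second differences, all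
  -- nonnegative.
  have key : ∀ k N : ℕ, k ≤ N → a k = a N + (a N - a (N + 1)) * ((N - k : ℕ) : ℝ)
      + ∑ i ∈ range N, (a i - 2 * a (i + 1) + a (i + 2)) * ((i + 1 - k : ℕ) : ℝ) := by
    intro k N hkN
    induction N, hkN using Nat.le_induction with
    | base =>
      rw [sum_eq_zero]
      · simp
      · intro i hi
        rw [Nat.sub_eq_zero_of_le (Nat.succ_le_of_lt (mem_range.1 hi))]
        simp
    | succ N hkN ih =>
      rw [sum_range_succ]
      rw [ih]
      push_cast [hkN, Nat.le_succ_of_le hkN]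
      ring
  have e : ∑ n ∈ range N, ∑ j ∈ range N, a (n - j + (j - n)) * inner ℝ (v j) (v n)
      = a N * inner ℝ (∑ j ∈ range N, v j) (∑ n ∈ range N, v n)
        + (a N - a (N + 1)) * ∑ n ∈ range N, ∑ j ∈ range N,
          ((N - (n - j + (j - n)) : ℕ) : ℝ) * inner ℝ (v j) (v n)
        + ∑ i ∈ range N, (a i - 2 * a (i + 1) + a (i + 2)) * ∑ n ∈ range N, ∑ j ∈ range N,
          ((i + 1 - (n - j + (j - n)) : ℕ) : ℝ) * inner ℝ (v j) (v n) := by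
    have h3 : inner ℝ (∑ j ∈ range N, v j) (∑ n ∈ range N, v n)
        = ∑ n ∈ range N, ∑ j ∈ range N, inner ℝ (v j) (v n) := by
      simp only [sum_inner, inner_sum]
    have h4 : ∑ i ∈ range N, (a i - 2 * a (i + 1) + a (i + 2)) * ∑ n ∈ range N, ∑ j ∈ range N,
          ((i + 1 - (n - j + (j - n)) : ℕ) : ℝ) * inner ℝ (v j) (v n)
        = ∑ n ∈ range N, ∑ j ∈ range N, ∑ i ∈ range N, (a i - 2 * a (i + 1) + a (i + 2)) *
          (((i + 1 - (n - j + (j - n)) : ℕ) : ℝ) * inner ℝ (v j) (v n)) := by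
      simp only [mul_sum]
      rw [sum_comm]
      exact sum_congr rfl fun n _ => sum_comm
    rw [h3, h4, mul_sum, mul_sum, ← sum_add_distrib, ← sum_add_distrib]
    refine sum_congr rfl fun n hn => ?_
    rw [mul_sum, mul_sum, ← sum_add_distrib, ← sum_add_distrib]
    refine sum_congr rfl fun j hj => ?_
    have hn := mem_range.1 hn
    have hj := mem_range.1 hj
    rw [key (n - j + (j - n)) N (by omega), add_mul, add_mul, sum_mul]
    simp only [mul_assoc]
  rw [e]
  refine add_nonneg (add_nonneg (mul_nonneg (h0 N) real_inner_self_nonneg)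
    (mul_nonneg (sub_nonneg.2 (h1 N)) (sum_triangle_inner_nonneg N N v))) ?_
  exact sum_nonneg fun i _ => mul_nonneg (h2 i) (sum_triangle_inner_nonneg (i + 1) N v)

open Finset in
-- By symmetry the full form is twice its lower triangle, provided that the diagonal is halved. The
-- cell weights have exactly this halved diagonal.
theorem sum_toeplitz_inner_eq (a : ℕ → ℝ) (N : ℕ) (v : ℕ → H) :
    ∑ n ∈ range N, ∑ j ∈ range N, a (n - j + (j - n)) * inner ℝ (v j) (v n)
      = 2 * ∑ n ∈ range N, ∑ j ∈ range (n + 1),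
          (if j = n then a 0 / 2 else a (n - j)) * inner ℝ (v j) (v n) := by
  induction N with
  | zero => simp
  | succ N ih =>
    rw [sum_range_succ, sum_range_succ (fun j => a (N - j + (j - N)) * inner ℝ (v j) (v N)) N]
    simp only [fun n => sum_range_succ (fun j => a (n - j + (j - n)) * inner ℝ (v j) (v n)) N]
    rw [sum_add_distrib, ih, sum_range_succ _ N, sum_range_succ _ N]
    have h1 : ∑ n ∈ range N, a (n - N + (N - n)) * inner ℝ (v N) (v n)
        = ∑ j ∈ range N, (if j = N then a 0 / 2 else a (N - j)) * inner ℝ (v j) (v N) := by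
      refine sum_congr rfl fun n hn => ?_
      have hn := mem_range.1 hn
      rw [if_neg hn.ne, real_inner_comm, Nat.sub_eq_zero_of_le hn.le, zero_add]
    have h2 : ∑ j ∈ range N, a (N - j + (j - N)) * inner ℝ (v j) (v N)
        = ∑ j ∈ range N, (if j = N then a 0 / 2 else a (N - j)) * inner ℝ (v j) (v N) := by
      refine sum_congr rfl fun n hn => ?_
      have hn := mem_range.1 hn
      rw [if_neg hn.ne, Nat.sub_eq_zero_of_le hn.le, add_zero]
    rw [h1, h2]
    simp
    ring

end Toeplitz

/-! ### The weights of the product-integration rule -/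

/-- The second difference of `|x|^p` at `x = k`. -/
noncomputable def rpowSecondDiff (p : ℝ) (k : ℕ) : ℝ :=
  ((k : ℝ) + 1) ^ p - 2 * (k : ℝ) ^ p + |(k : ℝ) - 1| ^ p

theorem rpowSecondDiff_zero {p : ℝ} (hp : 0 < p) : rpowSecondDiff p 0 = 2 := by
  simp [rpowSecondDiff, Real.zero_rpow hp.ne']
  norm_num

theorem rpowSecondDiff_of_pos (p : ℝ) {k : ℕ} (hk : 1 ≤ k) :
    rpowSecondDiff p k = ((k : ℝ) + 1) ^ p - 2 * (k : ℝ) ^ p + ((k : ℝ) - 1) ^ p := by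
  have : (1 : ℝ) ≤ k := by exact_mod_cast hk
  rw [rpowSecondDiff, abs_of_nonneg (by linarith)]

theorem hasDerivAt_rpow_secondDiff {p x : ℝ} (hx : 1 < x) :
    HasDerivAt (fun x : ℝ => (x + 1) ^ p - 2 * x ^ p + (x - 1) ^ p)
      (p * ((x + 1) ^ (p - 1) - 2 * x ^ (p - 1) + (x - 1) ^ (p - 1))) x := by
  have h1 := ((hasDerivAt_id x).add_const 1).rpow_const (p := p) (Or.inl (by simp; linarith))
  have h2 := (hasDerivAt_id x).rpow_const (p := p) (Or.inl (by simp; linarith))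
  have h3 := ((hasDerivAt_id x).sub_const 1).rpow_const (p := p) (Or.inl (by simp; linarith))
  have h4 := (h1.sub (h2.const_mul 2)).add h3
  refine (h4.congr_deriv ?_)
  simp only [id]
  ring

theorem continuousOn_rpow_secondDiff {p : ℝ} (hp : 0 ≤ p) :
    ContinuousOn (fun x : ℝ => (x + 1) ^ p - 2 * x ^ p + (x - 1) ^ p) (Ici 1) := by
  refine Continuous.continuousOn ?_
  have h : Continuous fun x : ℝ => x ^ p := Real.continuous_rpow_const hp
  exact ((h.comp (continuous_id.add continuous_const)).sub (continuous_const.mul h)).add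
    (h.comp (continuous_id.sub continuous_const))

/-- The arithmetic-geometric mean inequality and `(x + 1) (x - 1) ≤ x²`, the latter reversed by the
nonpositive exponent. -/
theorem two_mul_rpow_le_of_nonpos {q x : ℝ} (hx : 1 < x) (hq : q ≤ 0) :
    2 * x ^ q ≤ (x + 1) ^ q + (x - 1) ^ q := by
  have hsq : ∀ y : ℝ, 0 < y → y ^ q = y ^ (q / 2) * y ^ (q / 2) := fun y hy => by
    rw [← Real.rpow_add hy, add_halves]
  have h1 : x ^ (q / 2) * x ^ (q / 2) ≤ (x + 1) ^ (q / 2) * (x - 1) ^ (q / 2) := by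
    rw [← Real.mul_rpow (by linarith) (by linarith), ← Real.mul_rpow (by linarith) (by linarith)]
    exact Real.rpow_le_rpow_of_nonpos (by nlinarith) (by nlinarith) (by linarith)
  rw [hsq x (by linarith), hsq (x + 1) (by linarith), hsq (x - 1) (by linarith)]
  nlinarith [sq_nonneg ((x + 1) ^ (q / 2) - (x - 1) ^ (q / 2))]

/-- Each differentiation reproduces the expression with the exponent lowered by one. After two of
them the exponent `p - 2` is negative and the expression is nonnegative. -/
theorem convexOn_rpow_secondDiff {p : ℝ} (hp1 : 1 < p) (hp2 : p < 2) :
    ConvexOn ℝ (Ici 1) (fun x : ℝ => (x + 1) ^ p - 2 * x ^ p + (x - 1) ^ p) := by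
  have hd : ∀ x ∈ interior (Ici (1 : ℝ)),
      deriv (fun x : ℝ => (x + 1) ^ p - 2 * x ^ p + (x - 1) ^ p) x
        = p * ((x + 1) ^ (p - 1) - 2 * x ^ (p - 1) + (x - 1) ^ (p - 1)) := fun x hx => by
    rw [interior_Ici] at hx
    exact (hasDerivAt_rpow_secondDiff hx).deriv
  refine MonotoneOn.convexOn_of_deriv (convex_Ici 1) (continuousOn_rpow_secondDiff (by linarith))
    (fun x hx => ?_) ?_
  · rw [interior_Ici] at hx
    exact (hasDerivAt_rpow_secondDiff hx).differentiableAt.differentiableWithinAt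
  · refine MonotoneOn.congr ?_ (fun x hx => (hd x hx).symm)
    refine fun x hx y hy hxy => mul_le_mul_of_nonneg_left ?_ (by linarith)
    have hm : MonotoneOn (fun x : ℝ => (x + 1) ^ (p - 1) - 2 * x ^ (p - 1) + (x - 1) ^ (p - 1))
        (Ici 1) := by
      refine monotoneOn_of_deriv_nonneg (convex_Ici 1)
        (continuousOn_rpow_secondDiff (by linarith)) (fun x hx => ?_) fun x hx => ?_
      · rw [interior_Ici] at hx
        exact (hasDerivAt_rpow_secondDiff hx).differentiableAt.differentiableWithinAt
      · rw [interior_Ici] at hx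
        have hx : 1 < x := hx
        rw [(hasDerivAt_rpow_secondDiff hx).deriv]
        refine mul_nonneg (by linarith) ?_
        have hc := two_mul_rpow_le_of_nonpos hx (show p - 1 - 1 ≤ 0 by linarith)
        linarith
    exact hm (interior_subset hx) (interior_subset hy) hxy

/-- The derivative is a second difference of the concave power `x^{p-1}`. -/
theorem antitoneOn_rpow_secondDiff {p : ℝ} (hp1 : 1 < p) (hp2 : p < 2) :
    AntitoneOn (fun x : ℝ => (x + 1) ^ p - 2 * x ^ p + (x - 1) ^ p) (Ici 1) := by
  refine antitoneOn_of_deriv_nonpos (convex_Ici 1)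
    (continuousOn_rpow_secondDiff (by linarith)) (fun x hx => ?_) fun x hx => ?_
  · rw [interior_Ici] at hx
    exact (hasDerivAt_rpow_secondDiff hx).differentiableAt.differentiableWithinAt
  · rw [interior_Ici] at hx
    have hx : 1 < x := hx
    rw [(hasDerivAt_rpow_secondDiff hx).deriv]
    refine mul_nonpos_of_nonneg_of_nonpos (by linarith) ?_
    have hc := (Real.concaveOn_rpow (p := p - 1) (by linarith) (by linarith)).2
      (show x + 1 ∈ Ici (0 : ℝ) by simp; linarith)
      (show x - 1 ∈ Ici (0 : ℝ) by simp; linarith)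
      (show (0 : ℝ) ≤ 1 / 2 by norm_num) (show (0 : ℝ) ≤ 1 / 2 by norm_num) (by norm_num)
    simp only [smul_eq_mul] at hc
    rw [show 1 / 2 * (x + 1) + 1 / 2 * (x - 1) = x by ring] at hc
    linarith

/-- This is convexity of the second differences at `k = 0`, where the kink of `|x|^p` rules out the
argument used for `k ≥ 1`. Equality holds at `p = 2`, so it is enough that the difference of the two
sides decreases in `p`. -/
theorem four_mul_two_rpow_le {p : ℝ} (hp1 : 1 < p) (hp2 : p < 2) :
    4 * (2 : ℝ) ^ p ≤ 7 + 3 ^ p := by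
  have hder : ∀ x : ℝ, HasDerivAt (fun x : ℝ => 7 + (3 : ℝ) ^ x - 4 * 2 ^ x)
      (3 ^ x * Real.log 3 - 4 * (2 ^ x * Real.log 2)) x := fun x => by
    have h3 := (hasDerivAt_id x).const_rpow (a := (3 : ℝ)) (by norm_num)
    have h2 := (hasDerivAt_id x).const_rpow (a := (2 : ℝ)) (by norm_num)
    refine ((h3.const_add 7).sub (h2.const_mul 4)).congr_deriv ?_
    simp only [id]
    ring
  have hanti : AntitoneOn (fun x : ℝ => 7 + (3 : ℝ) ^ x - 4 * 2 ^ x) (Icc 1 2) := by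
    refine antitoneOn_of_deriv_nonpos (convex_Icc 1 2)
      (fun x _ => (hder x).continuousAt.continuousWithinAt)
      (fun x _ => (hder x).differentiableAt.differentiableWithinAt) fun x hx => ?_
    rw [interior_Icc] at hx
    rw [(hder x).deriv]
    -- From `3⁹ ≤ 2¹⁶`. Together with `3^x ≤ (9/4) 2^x` for `x ≤ 2` it gives exactly the factor `4`
    -- needed for the sign of the derivative.
    have hlog : 9 * Real.log 3 ≤ 16 * Real.log 2 := by
      have h1 : Real.log ((3 : ℝ) ^ 9) ≤ Real.log ((2 : ℝ) ^ 16) :=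
        Real.log_le_log (by norm_num) (by norm_num)
      rw [Real.log_pow, Real.log_pow] at h1
      exact_mod_cast h1
    have hq : (3 : ℝ) ^ x ≤ 9 / 4 * 2 ^ x := by
      have h1 : ((3 : ℝ) / 2) ^ x ≤ (3 / 2 : ℝ) ^ (2 : ℝ) :=
        Real.rpow_le_rpow_of_exponent_le (by norm_num) hx.2.le
      rw [Real.div_rpow (by norm_num) (by norm_num), div_le_iff₀ (by positivity)] at h1
      norm_num at h1
      linarith
    have hl3 : 0 < Real.log 3 := Real.log_pos (by norm_num)
    have h2x : (0 : ℝ) < 2 ^ x := by positivity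
    nlinarith [mul_le_mul_of_nonneg_right hq hl3.le, mul_le_mul_of_nonneg_left hlog h2x.le]
  have := hanti ⟨hp1.le, hp2.le⟩ ⟨by norm_num, le_rfl⟩ hp2.le
  norm_num at this
  linarith

theorem rpowSecondDiff_nonneg {p : ℝ} (hp1 : 1 < p) (k : ℕ) : 0 ≤ rpowSecondDiff p k := by
  rcases Nat.eq_zero_or_pos k with rfl | hk
  · rw [rpowSecondDiff_zero (by linarith)]; norm_num
  · have hk' : (1 : ℝ) ≤ k := by exact_mod_cast hk
    rw [rpowSecondDiff_of_pos p hk]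
    have hc := (convexOn_rpow hp1.le).2
      (show (k : ℝ) + 1 ∈ Ici (0 : ℝ) by simp; linarith)
      (show (k : ℝ) - 1 ∈ Ici (0 : ℝ) by simp; linarith)
      (show (0 : ℝ) ≤ 1 / 2 by norm_num) (show (0 : ℝ) ≤ 1 / 2 by norm_num) (by norm_num)
    simp only [smul_eq_mul] at hc
    rw [show 1 / 2 * ((k : ℝ) + 1) + 1 / 2 * ((k : ℝ) - 1) = k by ring] at hc
    linarith

theorem two_rpow_le_four {p : ℝ} (hp2 : p < 2) : (2 : ℝ) ^ p ≤ 4 := by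
  have := Real.rpow_le_rpow_of_exponent_le (x := 2) (by norm_num) hp2.le
  norm_num at this
  exact this

theorem rpowSecondDiff_succ_le {p : ℝ} (hp1 : 1 < p) (hp2 : p < 2) (k : ℕ) :
    rpowSecondDiff p (k + 1) ≤ rpowSecondDiff p k := by
  rcases Nat.eq_zero_or_pos k with rfl | hk
  · rw [rpowSecondDiff_zero (by linarith), rpowSecondDiff_of_pos p (by norm_num)]
    have := two_rpow_le_four hp2
    norm_num [Real.zero_rpow (show p ≠ 0 by linarith)]
    linarith
  · have hk' : (1 : ℝ) ≤ k := by exact_mod_cast hk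
    rw [rpowSecondDiff_of_pos p hk, rpowSecondDiff_of_pos p (by omega)]
    push_cast
    exact antitoneOn_rpow_secondDiff hp1 hp2 (show (k : ℝ) ∈ Ici 1 from hk')
      (show (k : ℝ) + 1 ∈ Ici 1 by simp) (by linarith)

theorem rpowSecondDiff_convex {p : ℝ} (hp1 : 1 < p) (hp2 : p < 2) (k : ℕ) :
    0 ≤ rpowSecondDiff p k - 2 * rpowSecondDiff p (k + 1) + rpowSecondDiff p (k + 2) := by
  rcases Nat.eq_zero_or_pos k with rfl | hk
  · rw [rpowSecondDiff_zero (by linarith), rpowSecondDiff_of_pos p (by norm_num),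
      rpowSecondDiff_of_pos p (by norm_num)]
    have := four_mul_two_rpow_le hp1 hp2
    norm_num [Real.zero_rpow (show p ≠ 0 by linarith)]
    linarith
  · have hk' : (1 : ℝ) ≤ k := by exact_mod_cast hk
    rw [rpowSecondDiff_of_pos p hk, rpowSecondDiff_of_pos p (by omega),
      rpowSecondDiff_of_pos p (by omega)]
    push_cast
    have hc := (convexOn_rpow_secondDiff hp1 hp2).2 (show (k : ℝ) ∈ Ici 1 from hk')
      (show (k : ℝ) + 2 ∈ Ici 1 by simp; linarith)
      (show (0 : ℝ) ≤ 1 / 2 by norm_num) (show (0 : ℝ) ≤ 1 / 2 by norm_num) (by norm_num)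
    simp only [smul_eq_mul] at hc
    rw [show 1 / 2 * (k : ℝ) + 1 / 2 * ((k : ℝ) + 2) = k + 1 by ring] at hc
    linarith

/-! ### Cell weights as second differences of the double primitive of the kernel -/

/-- The primitive that vanishes at `0`. -/
noncomputable def prim (k : ℝ → ℝ) (x : ℝ) : ℝ := ∫ r in (0 : ℝ)..x, k r

/-- The integral of `k(t-s)` over the part `s ≤ t` of a cell of the grid. -/
noncomputable def cellWeight (k : ℝ → ℝ) (τ : ℝ) (n j : ℕ) : ℝ :=
  ∫ t in (((n : ℝ) - 1) * τ)..(n * τ), ∫ s in (((j : ℝ) - 1) * τ)..(min t (j * τ)), k (t - s)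

theorem continuousOn_prim {k : ℝ → ℝ} {T : ℝ} (hT : 0 ≤ T) (hk : IntegrableOn k (Ioc 0 T)) :
    ContinuousOn (prim k) (Icc 0 T) := by
  have := intervalIntegral.continuousOn_primitive_interval'
    (intervalIntegrable_of_Ioc_subset hk ⟨le_rfl, hT⟩ ⟨hT, le_rfl⟩) left_mem_uIcc
  rwa [uIcc_of_le hT] at this

theorem integral_sub_left_eq_prim {k : ℝ → ℝ} {T : ℝ} (hk : IntegrableOn k (Ioc 0 T)) {t a b : ℝ}
    (ha : t - a ∈ Icc 0 T) (hb : t - b ∈ Icc 0 T) :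
    ∫ s in a..b, k (t - s) = prim k (t - a) - prim k (t - b) := by
  have h0 : (0 : ℝ) ∈ Icc 0 T := ⟨le_rfl, ha.1.trans ha.2⟩
  rw [intervalIntegral.integral_comp_sub_left, prim, prim, eq_sub_iff_add_eq, add_comm]
  exact intervalIntegral.integral_add_adjacent_intervals
    (intervalIntegrable_of_Ioc_subset hk h0 hb) (intervalIntegrable_of_Ioc_subset hk hb ha)

theorem integral_prim_sub {k : ℝ → ℝ} {T : ℝ} (hk : IntegrableOn k (Ioc 0 T)) {c a b : ℝ}
    (ha : a - c ∈ Icc 0 T) (hb : b - c ∈ Icc 0 T) :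
    ∫ t in a..b, prim k (t - c) = prim (prim k) (b - c) - prim (prim k) (a - c) := by
  have hT : 0 ≤ T := ha.1.trans ha.2
  have hK : IntegrableOn (prim k) (Ioc 0 T) :=
    ((continuousOn_prim hT hk).integrableOn_Icc).mono_set Ioc_subset_Icc_self
  have h0 : (0 : ℝ) ∈ Icc 0 T := ⟨le_rfl, ha.1.trans ha.2⟩
  rw [intervalIntegral.integral_comp_sub_right, prim, prim, eq_sub_iff_add_eq, add_comm]
  exact intervalIntegral.integral_add_adjacent_intervals
    (intervalIntegrable_of_Ioc_subset hK h0 ha) (intervalIntegrable_of_Ioc_subset hK ha hb)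

section Cell

variable {k : ℝ → ℝ} {T τ : ℝ} {N : ℕ}

/-- The constraint `s ≤ t` cuts the square cell to a triangle, so a single value of the double
primitive remains in place of a second difference. -/
theorem cellWeight_self (hk : IntegrableOn k (Ioc 0 T)) (hτ : 0 < τ) (hN : N * τ = T) {n : ℕ}
    (hn : 1 ≤ n) (hnN : n ≤ N) : cellWeight k τ n n = prim (prim k) τ := by
  have hnN' : (n : ℝ) ≤ N := by exact_mod_cast hnN
  have hn' : (1 : ℝ) ≤ n := by exact_mod_cast hn
  have hτT : τ ≤ T := by rw [← hN]; nlinarith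
  have h1 : cellWeight k τ n n
      = ∫ t in (((n : ℝ) - 1) * τ)..(n * τ), prim k (t - ((n : ℝ) - 1) * τ) := by
    refine intervalIntegral.integral_congr fun t ht => ?_
    rw [uIcc_of_le (by nlinarith)] at ht
    have ht2 : t - ((n : ℝ) - 1) * τ ≤ τ := by linarith [ht.2]
    rw [min_eq_left ht.2, integral_sub_left_eq_prim hk ⟨by linarith [ht.1], by linarith⟩
      ⟨by linarith, by linarith⟩]
    simp [prim]
  rw [h1, integral_prim_sub hk ⟨by linarith, by linarith⟩
    ⟨by nlinarith, by nlinarith⟩]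
  rw [show (n : ℝ) * τ - ((n : ℝ) - 1) * τ = τ by ring, sub_self]
  simp [prim]

theorem cellWeight_of_lt (hk : IntegrableOn k (Ioc 0 T)) (hτ : 0 < τ) (hN : N * τ = T) {n j : ℕ}
    (hj : 1 ≤ j) (hjn : j < n) (hnN : n ≤ N) :
    cellWeight k τ n j = prim (prim k) (((n : ℝ) - j + 1) * τ) - 2 * prim (prim k) (((n : ℝ) - j) * τ)
      + prim (prim k) (((n : ℝ) - j - 1) * τ) := by
  have hnN' : (n : ℝ) ≤ N := by exact_mod_cast hnN
  have hj' : (1 : ℝ) ≤ j := by exact_mod_cast hj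
  have hjn' : (j : ℝ) + 1 ≤ n := by exact_mod_cast hjn
  have hnT : (n : ℝ) * τ ≤ T := by rw [← hN]; exact mul_le_mul_of_nonneg_right hnN' hτ.le
  have hT : 0 ≤ T := le_trans (by positivity) hnT
  have hjτ : τ ≤ j * τ := le_mul_of_one_le_left hτ.le hj'
  have hjnτ : ((j : ℝ) + 1) * τ ≤ n * τ := mul_le_mul_of_nonneg_right hjn' hτ.le
  have h1 : cellWeight k τ n j
      = ∫ t in (((n : ℝ) - 1) * τ)..(n * τ),
        (prim k (t - ((j : ℝ) - 1) * τ) - prim k (t - j * τ)) := by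
    refine intervalIntegral.integral_congr fun t ht => ?_
    rw [uIcc_of_le (by nlinarith)] at ht
    rw [min_eq_right (by linarith [ht.1]), integral_sub_left_eq_prim hk
      ⟨by linarith [ht.1], by linarith [ht.2]⟩ ⟨by linarith [ht.1], by linarith [ht.2]⟩]
  have hc : ∀ c, 0 ≤ c → c ≤ ((n : ℝ) - 1) * τ → IntervalIntegrable (fun t => prim k (t - c)) volume
      (((n : ℝ) - 1) * τ) (n * τ) := by
    intro c hc0 hc
    refine ContinuousOn.intervalIntegrable ((continuousOn_prim hT hk).comp
      (continuousOn_id.sub continuousOn_const) fun t ht => ?_)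
    rw [uIcc_of_le (by nlinarith)] at ht
    exact ⟨by change 0 ≤ t - c; linarith [ht.1], by change t - c ≤ T; linarith [ht.2]⟩
  rw [h1, intervalIntegral.integral_sub (hc _ (by linarith) (by linarith))
    (hc _ (by linarith) (by linarith)),
    integral_prim_sub hk ⟨by linarith, by linarith⟩ ⟨by linarith, by linarith⟩,
    integral_prim_sub hk ⟨by linarith, by linarith⟩ ⟨by linarith, by linarith⟩]
  rw [show (n : ℝ) * τ - ((j : ℝ) - 1) * τ = ((n : ℝ) - j + 1) * τ by ring,
    show ((n : ℝ) - 1) * τ - ((j : ℝ) - 1) * τ = ((n : ℝ) - j) * τ by ring,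
    show (n : ℝ) * τ - j * τ = ((n : ℝ) - j) * τ by ring,
    show ((n : ℝ) - 1) * τ - j * τ = ((n : ℝ) - j - 1) * τ by ring]
  ring

theorem abs_cellWeight_le {C : ℝ} (hC : ∀ x, |k x| ≤ C) (hτ : 0 < τ) {n j : ℕ}
    (hjn : j ≤ n) : |cellWeight k τ n j| ≤ C * τ ^ 2 := by
  have hC0 : 0 ≤ C := (abs_nonneg _).trans (hC 0)
  have hjn' : (j : ℝ) ≤ n := by exact_mod_cast hjn
  have h1 : |cellWeight k τ n j| ≤ C * τ * |(n : ℝ) * τ - ((n : ℝ) - 1) * τ| := by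
    refine intervalIntegral.norm_integral_le_of_norm_le_const (E := ℝ) (C := C * τ) fun t ht => ?_
    rw [uIoc_of_le (by nlinarith)] at ht
    have h2 := intervalIntegral.norm_integral_le_of_norm_le_const (E := ℝ) (C := C)
      (a := ((j : ℝ) - 1) * τ) (b := min t (j * τ)) (f := fun s => k (t - s)) fun s _ => by
        simpa using hC (t - s)
    refine h2.trans (mul_le_mul_of_nonneg_left ?_ hC0)
    have h3 : ((j : ℝ) - 1) * τ ≤ min t (j * τ) :=
      le_min (le_trans (by nlinarith) ht.1.le) (by nlinarith)
    rw [abs_of_nonneg (sub_nonneg.2 h3)]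
    linarith [min_le_right t (j * τ)]
  rw [show (n : ℝ) * τ - ((n : ℝ) - 1) * τ = τ by ring, abs_of_pos hτ] at h1
  linarith [show C * τ ^ 2 = C * τ * τ by ring]

end Cell

/-! ### The Abel kernel -/

theorem piWeight_eq (μ τ : ℝ) (n j : ℕ) :
    piWeight μ τ n j = (1 / τ) * cellWeight (abelKernel μ) τ n j := rfl

theorem integrableOn_abelKernel {μ : ℝ} (hμ : 0 < μ) (T : ℝ) :
    IntegrableOn (abelKernel μ) (Ioc 0 T) := by
  rcases le_total T 0 with hT | hT
  · simp [Ioc_eq_empty_of_le hT]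
  · have := (intervalIntegral.intervalIntegrable_rpow' (a := 0) (b := T) (r := μ - 1)
      (by linarith)).div_const (Real.Gamma μ)
    rwa [intervalIntegrable_iff, uIoc_of_le hT] at this

theorem prim_abelKernel {μ : ℝ} (hμ : 0 < μ) {x : ℝ} :
    prim (abelKernel μ) x = x ^ μ / (Real.Gamma μ * μ) := by
  simp only [prim, abelKernel]
  rw [intervalIntegral.integral_div, integral_rpow (Or.inl (by linarith)), sub_add_cancel,
    Real.zero_rpow hμ.ne', sub_zero, div_div, mul_comm]

theorem prim_prim_abelKernel {μ : ℝ} (hμ : 0 < μ) {x : ℝ} :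
    prim (prim (abelKernel μ)) x = x ^ (μ + 1) / (Real.Gamma μ * μ * (μ + 1)) := by
  rw [prim]
  simp only [prim_abelKernel hμ]
  rw [intervalIntegral.integral_div, integral_rpow (Or.inl (by linarith)),
    Real.zero_rpow (by linarith), sub_zero, div_div, mul_comm]

/-- The weights of the product-integration rule for the Abel kernel are positive. -/
theorem sum_cellWeight_abelKernel_inner_nonneg {H : Type*} [NormedAddCommGroup H]
    [InnerProductSpace ℝ H] {μ τ : ℝ} (hμ0 : 0 < μ) (hμ1 : μ < 1) (hτ : 0 < τ) (m : ℕ) (v : ℕ → H) :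
    0 ≤ ∑ n ∈ Finset.Icc 1 m, ∑ j ∈ Finset.Icc 1 n,
      cellWeight (abelKernel μ) τ n j * inner ℝ (v j) (v n) := by
  have hc : 0 < τ ^ (μ + 1) / (Real.Gamma μ * μ * (μ + 1)) := by
    have := Real.Gamma_pos_of_pos hμ0
    positivity
  set c := τ ^ (μ + 1) / (Real.Gamma μ * μ * (μ + 1)) with hcdef
  -- The double primitive is homogeneous of degree `μ + 1`, so up to the common factor `c` the
  -- weights are second differences of integer powers, independent of `τ`.
  have hp : ∀ x : ℝ, 0 ≤ x → prim (prim (abelKernel μ)) (x * τ) = c * x ^ (μ + 1) := by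
    intro x hx
    rw [prim_prim_abelKernel hμ0, Real.mul_rpow hx hτ.le, hcdef]
    ring
  have hw : ∀ n ∈ Finset.range m, ∀ j ∈ Finset.range (n + 1),
      cellWeight (abelKernel μ) τ (n + 1) (j + 1)
        = c * if j = n then rpowSecondDiff (μ + 1) 0 / 2 else rpowSecondDiff (μ + 1) (n - j) := by
    intro n hn j hj
    have hn := Finset.mem_range.1 hn
    have hj := Finset.mem_range.1 hj
    have hI := integrableOn_abelKernel hμ0 (m * τ)
    split_ifs with hjn
    · subst hjn
      rw [cellWeight_self hI hτ rfl (by omega) (by omega), rpowSecondDiff_zero (by linarith)]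
      have := hp 1 zero_le_one
      rw [one_mul, Real.one_rpow] at this
      linarith
    · have hjn' : (j : ℝ) + 1 ≤ n := by
        have : j + 1 ≤ n := by omega
        exact_mod_cast this
      rw [cellWeight_of_lt hI hτ rfl (by omega) (by omega) (by omega),
        rpowSecondDiff_of_pos _ (by omega)]
      push_cast [show j ≤ n by omega]
      rw [hp _ (by linarith), hp _ (by linarith), hp _ (by linarith)]
      rw [show (n : ℝ) + 1 - (j + 1) = n - j by ring]
      ring
  have e : ∑ n ∈ Finset.Icc 1 m, ∑ j ∈ Finset.Icc 1 n,
      cellWeight (abelKernel μ) τ n j * inner ℝ (v j) (v n)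
      = c * ∑ n ∈ Finset.range m, ∑ j ∈ Finset.range (n + 1),
        (if j = n then rpowSecondDiff (μ + 1) 0 / 2 else rpowSecondDiff (μ + 1) (n - j))
          * inner ℝ (v (j + 1)) (v (n + 1)) := by
    rw [sum_Icc_one_eq_sum_range, Finset.mul_sum]
    refine Finset.sum_congr rfl fun n hn => ?_
    rw [sum_Icc_one_eq_sum_range, Finset.mul_sum]
    refine Finset.sum_congr rfl fun j hj => ?_
    rw [hw n hn j hj]
    ring
  rw [e]
  refine mul_nonneg hc.le ?_
  have h1 := sum_toeplitz_inner_eq (rpowSecondDiff (μ + 1)) m (fun j => v (j + 1))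
  have h2 := sum_toeplitz_inner_nonneg (rpowSecondDiff_nonneg (p := μ + 1) (by linarith))
    (rpowSecondDiff_succ_le (by linarith) (by linarith))
    (rpowSecondDiff_convex (by linarith) (by linarith)) m (fun j => v (j + 1))
  linarith

/-! ### Regularity of the generalized identity function -/

/-- The density of the Beta integral in `genIdentity`. -/
noncomputable def betaDensity (a₀ z : ℝ) : ℝ := (1 - z) ^ (a₀ - 2) * z ^ (1 - a₀)

theorem betaDensity_ofReal {a₀ z : ℝ} (hz : z ∈ Ioo (0 : ℝ) 1) :
    ((betaDensity a₀ z : ℝ) : ℂ)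
      = (z : ℂ) ^ (((2 - a₀ : ℝ) : ℂ) - 1) * (1 - (z : ℂ)) ^ (((a₀ - 1 : ℝ) : ℂ) - 1) := by
  rw [betaDensity, Complex.ofReal_mul, Complex.ofReal_cpow (by linarith [hz.2]),
    Complex.ofReal_cpow hz.1.le, mul_comm]
  push_cast
  ring_nf

theorem integrableOn_betaDensity {a₀ : ℝ} (h1 : 1 < a₀) (h2 : a₀ < 2) :
    IntegrableOn (betaDensity a₀) (Ioo 0 1) := by
  have h := Complex.betaIntegral_convergent (u := ((2 - a₀ : ℝ) : ℂ)) (v := ((a₀ - 1 : ℝ) : ℂ))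
    (by rw [Complex.ofReal_re]; linarith) (by rw [Complex.ofReal_re]; linarith)
  rw [intervalIntegrable_iff_integrableOn_Ioo_of_le zero_le_one] at h
  have h' : IntegrableOn (fun z => ((betaDensity a₀ z : ℝ) : ℂ)) (Ioo 0 1) :=
    h.congr_fun (fun z hz => (betaDensity_ofReal hz).symm) measurableSet_Ioo
  exact h'.re

/-- The parameters `2 - a₀` and `a₀ - 1` add up to `1`, so the denominator of the Beta function is
`Γ(1) = 1`. This is the source of `g(0) = 1`. -/
theorem integral_betaDensity {a₀ : ℝ} (h1 : 1 < a₀) (h2 : a₀ < 2) :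
    ∫ z in Ioo 0 1, betaDensity a₀ z = Real.Gamma (a₀ - 1) * Real.Gamma (2 - a₀) := by
  have h := ProbabilityTheory.beta_eq_betaIntegralReal (2 - a₀) (a₀ - 1) (by linarith) (by linarith)
  have e : Complex.betaIntegral ((2 - a₀ : ℝ) : ℂ) ((a₀ - 1 : ℝ) : ℂ)
      = ((∫ z in Ioo 0 1, betaDensity a₀ z : ℝ) : ℂ) := by
    rw [Complex.betaIntegral, intervalIntegral.integral_of_le zero_le_one,
      integral_Ioc_eq_integral_Ioo, ← integral_complex_ofReal]
    exact setIntegral_congr_fun measurableSet_Ioo fun z hz => (betaDensity_ofReal hz).symm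
  rw [e, Complex.ofReal_re, ProbabilityTheory.beta,
    show 2 - a₀ + (a₀ - 1) = 1 by ring, Real.Gamma_one, div_one] at h
  rw [← h, mul_comm]

/-- The reciprocal of `Γ` is entire, so its restriction to the real line is smooth everywhere and
the poles of `Γ` need no care. -/
theorem exists_inv_Gamma_derivs (c : ℝ) : ∃ h₀ h₁ h₂ : ℝ → ℝ, Continuous h₀ ∧ Continuous h₁ ∧
    Continuous h₂ ∧ (∀ x, HasDerivAt h₀ (h₁ x) x) ∧ (∀ x, HasDerivAt h₁ (h₂ x) x) ∧
    ∀ x, h₀ x = 1 / (c * Real.Gamma (2 - x)) := by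
  have hc : ContDiff ℝ ∞ fun x : ℝ => c⁻¹ * ((Complex.Gamma ((2 - x : ℝ) : ℂ))⁻¹).re :=
    contDiff_const.mul ((Complex.differentiable_one_div_Gamma.contDiff.real_of_complex).comp
      (contDiff_const.sub contDiff_id))
  have hc1 : ContDiff ℝ ∞ (deriv fun x : ℝ => c⁻¹ * ((Complex.Gamma ((2 - x : ℝ) : ℂ))⁻¹).re) :=
    (contDiff_infty_iff_deriv.1 hc).2
  have hc2 := (contDiff_infty_iff_deriv.1 hc1).2
  refine ⟨_, _, _, hc.continuous, hc1.continuous, hc2.continuous,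
    fun x => ((contDiff_infty_iff_deriv.1 hc).1 x).hasDerivAt,
    fun x => ((contDiff_infty_iff_deriv.1 hc1).1 x).hasDerivAt, fun x => ?_⟩
  rw [Complex.Gamma_ofReal, ← Complex.ofReal_inv, Complex.ofReal_re, one_div, mul_inv]

/-- The bound on `α'''` is integrated three times from `0`; the vanishing of `α'(0)` and `α''(0)`
makes each integration gain a full power of `t`. -/
theorem IsSmoothExponent.exists_bounds {T : ℝ} {α : ℝ → ℝ} (hT : 0 < T) (hα : IsSmoothExponent T α)
    (hα1 : iteratedDerivWithin 1 α (Icc 0 T) 0 = 0)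
    (hα2 : iteratedDerivWithin 2 α (Icc 0 T) 0 = 0) :
    ∃ (α₁ α₂ : ℝ → ℝ) (L : ℝ), 0 ≤ L ∧ ContinuousOn α (Icc 0 T) ∧ ContinuousOn α₁ (Icc 0 T) ∧
      ContinuousOn α₂ (Icc 0 T) ∧ (∀ t ∈ Ioo 0 T, HasDerivAt α (α₁ t) t) ∧
      (∀ t ∈ Ioo 0 T, HasDerivAt α₁ (α₂ t) t) ∧
      ∀ t ∈ Icc 0 T, |α₂ t| ≤ L * t ∧ |α₁ t| ≤ L * t ^ 2 ∧ |α 0 - α t| ≤ L * t ^ 3 := by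
  obtain ⟨L, hL⟩ := hα.bounded
  have hL0 : 0 ≤ L := le_trans (by positivity) (hL 0 ⟨le_rfl, hT.le⟩)
  have d0 := hα.differentiable 0 (by norm_num)
  have d1 := hα.differentiable 1 (by norm_num)
  have d2 := hα.differentiable 2 (by norm_num)
  rw [iteratedDerivWithin_zero] at d0
  have mvt : ∀ (j : ℕ) (C t : ℝ), t ∈ Icc 0 T →
      DifferentiableOn ℝ (iteratedDerivWithin j α (Icc 0 T)) (Icc 0 T) →
      (∀ s ∈ Icc 0 t, |iteratedDerivWithin (j + 1) α (Icc 0 T) s| ≤ C) →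
      |iteratedDerivWithin j α (Icc 0 T) t - iteratedDerivWithin j α (Icc 0 T) 0| ≤ C * t := by
    intro j C t ht hd hC
    have hsub : Icc 0 t ⊆ Icc 0 T := Icc_subset_Icc_right ht.2
    have := Convex.norm_image_sub_le_of_norm_hasDerivWithin_le (𝕜 := ℝ)
      (f := iteratedDerivWithin j α (Icc 0 T)) (f' := iteratedDerivWithin (j + 1) α (Icc 0 T))
      (s := Icc 0 t) (x := 0) (y := t) (C := C) (fun x hx => ?_) hC (convex_Icc 0 t)
      ⟨le_rfl, ht.1⟩ ⟨ht.1, le_rfl⟩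
    · rw [sub_zero, Real.norm_of_nonneg ht.1] at this
      exact this
    · rw [iteratedDerivWithin_succ]
      exact ((hd x (hsub hx)).hasDerivWithinAt).mono hsub
  have b2 : ∀ t ∈ Icc 0 T, |iteratedDerivWithin 2 α (Icc 0 T) t| ≤ L * t := by
    intro t ht
    have := mvt 2 L t ht d2 fun s hs => by
      have := hL s ⟨hs.1, hs.2.trans ht.2⟩
      have h1 := abs_nonneg (iteratedDerivWithin 1 α (Icc 0 T) s)
      have h2 := abs_nonneg (iteratedDerivWithin 2 α (Icc 0 T) s)
      linarith
    rwa [hα2, sub_zero] at this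
  have b1 : ∀ t ∈ Icc 0 T, |iteratedDerivWithin 1 α (Icc 0 T) t| ≤ L * t ^ 2 := by
    intro t ht
    have := mvt 1 (L * t) t ht d1 fun s hs =>
      (b2 s ⟨hs.1, hs.2.trans ht.2⟩).trans (mul_le_mul_of_nonneg_left hs.2 hL0)
    rw [hα1, sub_zero] at this
    linarith [this, show L * t * t = L * t ^ 2 by ring]
  have b0 : ∀ t ∈ Icc 0 T, |α 0 - α t| ≤ L * t ^ 3 := by
    intro t ht
    have := mvt 0 (L * t ^ 2) t ht (by rwa [iteratedDerivWithin_zero]) fun s hs =>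
      (b1 s ⟨hs.1, hs.2.trans ht.2⟩).trans
        (mul_le_mul_of_nonneg_left (pow_le_pow_left₀ hs.1 hs.2 2) hL0)
    rw [iteratedDerivWithin_zero, abs_sub_comm] at this
    linarith [this, show L * t ^ 2 * t = L * t ^ 3 by ring]
  have hd : ∀ j : ℕ, DifferentiableOn ℝ (iteratedDerivWithin j α (Icc 0 T)) (Icc 0 T) →
      ∀ t ∈ Ioo 0 T, HasDerivAt (iteratedDerivWithin j α (Icc 0 T))
        (iteratedDerivWithin (j + 1) α (Icc 0 T) t) t := by
    intro j hj t ht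
    rw [iteratedDerivWithin_succ]
    exact (hj t (Ioo_subset_Icc_self ht)).hasDerivWithinAt.hasDerivAt (Icc_mem_nhds ht.1 ht.2)
  refine ⟨iteratedDerivWithin 1 α (Icc 0 T), iteratedDerivWithin 2 α (Icc 0 T), L, hL0,
    d0.continuousOn, d1.continuousOn, d2.continuousOn, fun t ht => ?_, hd 1 d1,
    fun t ht => ⟨b2 t ht, b1 t ht, b0 t ht⟩⟩
  have := hd 0 (by rwa [iteratedDerivWithin_zero]) t ht
  rwa [iteratedDerivWithin_zero] at this

/-! ### Integrals of dilated functions: continuity and differentiation under the integral sign -/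

section Dilation

variable {ψ ψ' w : ℝ → ℝ} {C : ℝ}

theorem aestronglyMeasurable_dilation {S : Set ℝ} (hS : ∀ t ∈ S, ∀ z ∈ Ioo (0 : ℝ) 1, t * z ∈ S)
    (hψ : ContinuousOn ψ S) (hw : IntegrableOn w (Ioo 0 1)) {t : ℝ} (ht : t ∈ S) :
    AEStronglyMeasurable (fun z => ψ (t * z) * w z) (volume.restrict (Ioo 0 1)) := by
  refine AEStronglyMeasurable.mul ?_ hw.aestronglyMeasurable
  exact (hψ.comp (continuousOn_const.mul continuousOn_id) fun z hz => hS t ht z hz).aestronglyMeasurable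
    measurableSet_Ioo

theorem ae_norm_dilation_le {S : Set ℝ} (hS : ∀ t ∈ S, ∀ z ∈ Ioo (0 : ℝ) 1, t * z ∈ S)
    (hC : ∀ s ∈ S, |ψ s| ≤ C) {t : ℝ} (ht : t ∈ S) :
    ∀ᵐ z ∂(volume.restrict (Ioo (0 : ℝ) 1)), ‖ψ (t * z) * w z‖ ≤ C * |w z| := by
  filter_upwards [ae_restrict_mem measurableSet_Ioo] with z hz
  rw [norm_mul]
  exact mul_le_mul_of_nonneg_right (hC _ (hS t ht z hz)) (abs_nonneg _)

theorem continuousOn_integral_dilation {S : Set ℝ}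
    (hS : ∀ t ∈ S, ∀ z ∈ Ioo (0 : ℝ) 1, t * z ∈ S) (hψ : ContinuousOn ψ S)
    (hC : ∀ s ∈ S, |ψ s| ≤ C) (hw : IntegrableOn w (Ioo 0 1)) :
    ContinuousOn (fun t => ∫ z in Ioo 0 1, ψ (t * z) * w z) S := by
  refine continuousOn_of_dominated (bound := fun z => C * |w z|)
    (fun t ht => aestronglyMeasurable_dilation hS hψ hw ht)
    (fun t ht => ae_norm_dilation_le hS hC ht) (hw.abs.const_mul C) ?_
  filter_upwards [ae_restrict_mem measurableSet_Ioo] with z hz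
  exact (hψ.comp (continuousOn_id.mul continuousOn_const) fun t ht => hS t ht z hz).mul
    continuousOn_const

theorem mul_mem_Ioo {T t z : ℝ} (ht : t ∈ Ioo 0 T) (hz : z ∈ Ioo (0 : ℝ) 1) : t * z ∈ Ioo 0 T :=
  ⟨mul_pos ht.1 hz.1, (mul_lt_of_lt_one_right ht.1 hz.2).trans ht.2⟩

theorem mul_mem_Icc {T t z : ℝ} (ht : t ∈ Icc 0 T) (hz : z ∈ Ioo (0 : ℝ) 1) : t * z ∈ Icc 0 T :=
  ⟨mul_nonneg ht.1 hz.1.le, (mul_le_of_le_one_right ht.1 hz.2.le).trans ht.2⟩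

theorem hasDerivAt_integral_dilation {T : ℝ} (hψ : ∀ s ∈ Ioo 0 T, HasDerivAt ψ (ψ' s) s)
    (hψ' : ContinuousOn ψ' (Ioo 0 T)) (hC : ∀ s ∈ Ioo 0 T, |ψ s| ≤ C)
    (hC' : ∀ s ∈ Ioo 0 T, |ψ' s| ≤ C) (hw : IntegrableOn w (Ioo 0 1)) {t : ℝ} (ht : t ∈ Ioo 0 T) :
    HasDerivAt (fun t => ∫ z in Ioo 0 1, ψ (t * z) * w z)
      (∫ z in Ioo 0 1, ψ' (t * z) * (z * w z)) t := by
  have hc : ContinuousOn ψ (Ioo 0 T) := fun s hs => (hψ s hs).continuousAt.continuousWithinAt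
  have hm : ∀ t ∈ Ioo 0 T, ∀ z ∈ Ioo (0 : ℝ) 1, t * z ∈ Ioo 0 T := fun t ht z hz => mul_mem_Ioo ht hz
  have hw' : IntegrableOn (fun z => z * w z) (Ioo 0 1) := by
    refine Integrable.bdd_mul (c := 1) hw measurable_id.aestronglyMeasurable ?_
    filter_upwards [ae_restrict_mem measurableSet_Ioo] with z hz
    change ‖z‖ ≤ 1
    rw [Real.norm_of_nonneg hz.1.le]
    exact hz.2.le
  refine (hasDerivAt_integral_of_dominated_loc_of_deriv_le (𝕜 := ℝ)
    (F := fun t z => ψ (t * z) * w z) (F' := fun t z => ψ' (t * z) * (z * w z))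
    (bound := fun z => C * |z * w z|) (s := Ioo 0 T) (Ioo_mem_nhds ht.1 ht.2) ?_ ?_ ?_ ?_ ?_ ?_).2
  · filter_upwards [Ioo_mem_nhds ht.1 ht.2] with x hx
    exact aestronglyMeasurable_dilation hm hc hw hx
  · exact (hw.abs.const_mul C).mono' (aestronglyMeasurable_dilation hm hc hw ht)
      (ae_norm_dilation_le hm hC ht)
  · exact aestronglyMeasurable_dilation hm hψ' hw' ht
  · filter_upwards [ae_restrict_mem measurableSet_Ioo] with z hz x hx
    rw [norm_mul]
    exact mul_le_mul_of_nonneg_right (hC' _ (mul_mem_Ioo hx hz)) (abs_nonneg _)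
  · exact hw'.abs.const_mul C
  · filter_upwards [ae_restrict_mem measurableSet_Ioo] with z hz x hx
    have h1 := (hψ _ (mul_mem_Ioo hx hz)).comp x ((hasDerivAt_id x).mul_const z)
    refine (h1.mul_const (w z)).congr_deriv ?_
    ring

end Dilation

/-- The function `s^{α(0)-α(s)} / (Γ(α(0)-1) Γ(2-α(s)))` is twice differentiable with bounded
second derivative, and its first derivative is `O(s)`. -/
theorem IsSmoothExponent.exists_integrand_derivs {T : ℝ} {α : ℝ → ℝ} (hT : 0 < T)
    (hα : IsSmoothExponent T α) (hα1 : iteratedDerivWithin 1 α (Icc 0 T) 0 = 0)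
    (hα2 : iteratedDerivWithin 2 α (Icc 0 T) 0 = 0) :
    ∃ (φ₀ φ₁ φ₂ : ℝ → ℝ) (C : ℝ), ContinuousOn φ₀ (Icc 0 T) ∧ ContinuousOn φ₁ (Ioo 0 T) ∧
      ContinuousOn φ₂ (Ioo 0 T) ∧ (∀ s ∈ Ioo 0 T, HasDerivAt φ₀ (φ₁ s) s) ∧
      (∀ s ∈ Ioo 0 T, HasDerivAt φ₁ (φ₂ s) s) ∧ (∀ s ∈ Icc 0 T, |φ₀ s| ≤ C) ∧
      (∀ s ∈ Ioo 0 T, |φ₁ s| ≤ C * s ∧ |φ₁ s| ≤ C ∧ |φ₂ s| ≤ C) ∧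
      ∀ s ∈ Icc 0 T,
        φ₀ s = s ^ (α 0 - α s) / (Real.Gamma (α 0 - 1) * Real.Gamma (2 - α s)) := by
  obtain ⟨α₁, α₂, L, hL, c0, c1, c2, d0, d1, hb⟩ := hα.exists_bounds hT hα1 hα2
  obtain ⟨h₀, h₁, h₂, k0, k1, k2, e0, e1, hh⟩ := exists_inv_Gamma_derivs (Real.Gamma (α 0 - 1))
  obtain ⟨K, hK⟩ := isCompact_Icc.exists_bound_of_continuousOn (s := Icc 0 T)
    Real.continuous_mul_log.continuousOn
  have hK0 : 0 ≤ K := (norm_nonneg _).trans (hK 0 ⟨le_rfl, hT.le⟩)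
  -- bounds for the functions of `Γ`
  have hbd : ∀ h : ℝ → ℝ, Continuous h → ∃ B, 0 ≤ B ∧ ∀ s ∈ Icc 0 T, |h (α s)| ≤ B := by
    intro h hc
    obtain ⟨B, hB⟩ := isCompact_Icc.exists_bound_of_continuousOn (s := Icc 0 T)
      (hc.comp_continuousOn c0)
    exact ⟨B, (norm_nonneg _).trans (hB 0 ⟨le_rfl, hT.le⟩), hB⟩
  obtain ⟨B₀, hB₀, b0⟩ := hbd h₀ k0
  obtain ⟨B₁, hB₁, b1⟩ := hbd h₁ k1
  obtain ⟨B₂, hB₂, b2⟩ := hbd h₂ k2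
  -- the exponent and its derivatives
  let E : ℝ → ℝ := fun s => (α 0 - α s) * Real.log s
  let E₁ : ℝ → ℝ := fun s => -α₁ s * Real.log s + (α 0 - α s) / s
  let E₂ : ℝ → ℝ := fun s => -α₂ s * Real.log s - 2 * (α₁ s / s) - (α 0 - α s) / s ^ 2
  have hlog : ∀ s ∈ Icc 0 T, s * |Real.log s| ≤ K := fun s hs => by
    have := hK s hs
    rwa [norm_mul, Real.norm_of_nonneg hs.1] at this
  -- A factor `log s` costs one power of `s`, by `s |log s| ≤ K`, and so does each division by `s`.
  -- Counted against `O(s³)`, `O(s²)`, `O(s)` for the exponent and its derivatives, this makes `E`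
  -- and `E₁` of order `s`, and `E₂` bounded.
  have bE : ∀ s ∈ Icc 0 T, |E s| ≤ L * T * K * s := by
    intro s hs
    have h1 := (hb s hs).2.2
    have h2 := hlog s hs
    calc |E s| = |α 0 - α s| * |Real.log s| := abs_mul _ _
      _ ≤ L * s ^ 3 * |Real.log s| := mul_le_mul_of_nonneg_right h1 (abs_nonneg _)
      _ = L * s ^ 2 * (s * |Real.log s|) := by ring
      _ ≤ L * s ^ 2 * K := mul_le_mul_of_nonneg_left h2 (mul_nonneg hL (sq_nonneg s))
      _ = L * K * s * s := by ring
      _ ≤ L * K * s * T := mul_le_mul_of_nonneg_left hs.2 (mul_nonneg (mul_nonneg hL hK0) hs.1)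
      _ = _ := by ring
  have bE₁ : ∀ s ∈ Ioo 0 T, |E₁ s| ≤ L * (K + T) * s := by
    intro s hs
    have hs' := Ioo_subset_Icc_self hs
    have h2 := hlog s hs'
    have p1 : |-α₁ s * Real.log s| ≤ L * K * s := by
      rw [abs_mul, abs_neg]
      calc _ ≤ L * s ^ 2 * |Real.log s| := mul_le_mul_of_nonneg_right (hb s hs').2.1 (abs_nonneg _)
        _ = L * s * (s * |Real.log s|) := by ring
        _ ≤ L * s * K := mul_le_mul_of_nonneg_left h2 (mul_nonneg hL hs.1.le)
        _ = _ := by ring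
    have p2 : |(α 0 - α s) / s| ≤ L * T * s := by
      rw [abs_div, abs_of_pos hs.1, div_le_iff₀ hs.1]
      refine (hb s hs').2.2.trans ?_
      have : L * s ^ 2 * s ≤ L * s ^ 2 * T :=
        mul_le_mul_of_nonneg_left hs.2.le (mul_nonneg hL (sq_nonneg s))
      linarith [show L * s ^ 2 * s = L * s ^ 3 by ring,
        show L * s ^ 2 * T = L * T * s * s by ring]
    linarith [abs_add_le (-α₁ s * Real.log s) ((α 0 - α s) / s)]
  have bE₂ : ∀ s ∈ Ioo 0 T, |E₂ s| ≤ L * (K + 3 * T) := by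
    intro s hs
    have hs' := Ioo_subset_Icc_self hs
    have h2 := hlog s hs'
    have p1 : |-α₂ s * Real.log s| ≤ L * K := by
      rw [abs_mul, abs_neg]
      calc _ ≤ L * s * |Real.log s| := mul_le_mul_of_nonneg_right (hb s hs').1 (abs_nonneg _)
        _ = L * (s * |Real.log s|) := by ring
        _ ≤ _ := mul_le_mul_of_nonneg_left h2 hL
    have p2 : |2 * (α₁ s / s)| ≤ 2 * L * T := by
      rw [abs_mul, abs_div, abs_of_pos hs.1, abs_two]
      have : |α₁ s| / s ≤ L * T := by
        rw [div_le_iff₀ hs.1]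
        refine (hb s hs').2.1.trans ?_
        have : L * s * s ≤ L * s * T := mul_le_mul_of_nonneg_left hs.2.le (mul_nonneg hL hs.1.le)
        linarith
      linarith
    have p3 : |(α 0 - α s) / s ^ 2| ≤ L * T := by
      have hs2 : 0 < s ^ 2 := pow_pos hs.1 2
      rw [abs_div, abs_of_pos hs2, div_le_iff₀ hs2]
      refine (hb s hs').2.2.trans ?_
      have : L * s ^ 2 * s ≤ L * s ^ 2 * T :=
        mul_le_mul_of_nonneg_left hs.2.le (mul_nonneg hL (sq_nonneg s))
      linarith
    have q1 := abs_sub (-α₂ s * Real.log s - 2 * (α₁ s / s)) ((α 0 - α s) / s ^ 2)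
    have q2 := abs_sub (-α₂ s * Real.log s) (2 * (α₁ s / s))
    change |-α₂ s * Real.log s - 2 * (α₁ s / s) - (α 0 - α s) / s ^ 2| ≤ _
    linarith
  have dE : ∀ s ∈ Ioo 0 T, HasDerivAt E (E₁ s) s := by
    intro s hs
    have := ((d0 s hs).const_sub (α 0)).mul (Real.hasDerivAt_log hs.1.ne')
    exact this.congr_deriv (by simp only [E₁]; ring)
  have dE₁ : ∀ s ∈ Ioo 0 T, HasDerivAt E₁ (E₂ s) s := by
    intro s hs
    have := ((d1 s hs).neg.mul (Real.hasDerivAt_log hs.1.ne')).add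
      (((d0 s hs).const_sub (α 0)).div (hasDerivAt_id s) hs.1.ne')
    refine this.congr_deriv ?_
    have := hs.1.ne'
    simp only [E₂, id, Pi.neg_apply]
    field_simp
    ring
  have hsub := Ioo_subset_Icc_self (a := (0 : ℝ)) (b := T)
  have cE : ContinuousOn E (Icc 0 T) := by
    intro s hs
    rcases hs.1.eq_or_lt with rfl | hs0
    · have hE0 : E 0 = 0 := by simp [E]
      rw [ContinuousWithinAt, hE0]
      refine squeeze_zero_norm' (a := fun s => L * T * K * s) ?_ ?_
      · filter_upwards [self_mem_nhdsWithin] with s hs using bE s hs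
      · have : Filter.Tendsto (fun s : ℝ => L * T * K * s) (nhds 0) (nhds (L * T * K * 0)) :=
          (continuous_const.mul continuous_id).tendsto 0
        rw [mul_zero] at this
        exact this.mono_left nhdsWithin_le_nhds
    · exact (continuousWithinAt_const.sub (c0 s hs)).mul
        (Real.continuousAt_log hs0.ne').continuousWithinAt
  have cE₁ : ContinuousOn E₁ (Ioo 0 T) := fun s hs => (dE₁ s hs).continuousAt.continuousWithinAt
  have cE₂ : ContinuousOn E₂ (Ioo 0 T) := by
    have cl : ContinuousOn Real.log (Ioo 0 T) := Real.continuousOn_log.mono fun s hs => hs.1.ne'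
    refine (((c2.mono hsub).neg.mul cl).sub (continuousOn_const.mul
      ((c1.mono hsub).div continuousOn_id fun s hs => hs.1.ne'))).sub
      ((continuousOn_const.sub (c0.mono hsub)).div (continuousOn_id.pow 2)
        fun s hs => pow_ne_zero 2 hs.1.ne')
  have cX : ContinuousOn (fun s => Real.exp (E s)) (Icc 0 T) := Real.continuous_exp.comp_continuousOn cE
  let X : ℝ → ℝ := fun s => Real.exp (E s)
  -- All derivatives of `φ₀ = X · h₀(α)` keep the exponential factor: `φ₀' = X D` and `φ₀'' = X (E₁
  -- D + D')`.
  let D : ℝ → ℝ := fun s => E₁ s * h₀ (α s) + h₁ (α s) * α₁ s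
  let D' : ℝ → ℝ := fun s => E₂ s * h₀ (α s) + E₁ s * (h₁ (α s) * α₁ s)
    + h₂ (α s) * α₁ s ^ 2 + h₁ (α s) * α₂ s
  have ch0 := k0.comp_continuousOn c0
  have ch1 := k1.comp_continuousOn c0
  have ch2 := k2.comp_continuousOn c0
  have bX : ∀ s ∈ Icc 0 T, |X s| ≤ Real.exp (L * T * K * T) := by
    intro s hs
    rw [abs_of_pos (Real.exp_pos _)]
    refine Real.exp_le_exp.2 ((le_abs_self _).trans ((bE s hs).trans ?_))
    exact mul_le_mul_of_nonneg_left hs.2 (mul_nonneg (mul_nonneg hL hT.le) hK0)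
  set BX := Real.exp (L * T * K * T) with hBX
  have hBX0 : 0 ≤ BX := (Real.exp_pos _).le
  set BE := L * (K + 3 * T) with hBE
  have hBE0 : 0 ≤ BE := mul_nonneg hL (by linarith)
  have bE₁' : ∀ s ∈ Ioo 0 T, |E₁ s| ≤ BE * s := fun s hs => (bE₁ s hs).trans
    (mul_le_mul_of_nonneg_right (mul_le_mul_of_nonneg_left (by linarith) hL) hs.1.le)
  have bα₁ : ∀ s ∈ Ioo 0 T, |α₁ s| ≤ L * T * s := fun s hs => by
    refine (hb s (hsub hs)).2.1.trans ?_
    have : L * s * s ≤ L * s * T := mul_le_mul_of_nonneg_left hs.2.le (mul_nonneg hL hs.1.le)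
    linarith
  have bα₂ : ∀ s ∈ Ioo 0 T, |α₂ s| ≤ L * T := fun s hs =>
    (hb s (hsub hs)).1.trans (mul_le_mul_of_nonneg_left hs.2.le hL)
  set BD := BE * B₀ + B₁ * (L * T) with hBD
  have hLT : 0 ≤ L * T := mul_nonneg hL hT.le
  have hBD0 : 0 ≤ BD := by positivity
  have bD : ∀ s ∈ Ioo 0 T, |D s| ≤ BD * s := by
    intro s hs
    have p1 : |E₁ s * h₀ (α s)| ≤ BE * s * B₀ := by
      rw [abs_mul]
      exact mul_le_mul (bE₁' s hs) (b0 s (hsub hs)) (abs_nonneg _) (mul_nonneg hBE0 hs.1.le)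
    have p2 : |h₁ (α s) * α₁ s| ≤ B₁ * (L * T * s) := by
      rw [abs_mul]
      exact mul_le_mul (b1 s (hsub hs)) (bα₁ s hs) (abs_nonneg _) hB₁
    have := abs_add_le (E₁ s * h₀ (α s)) (h₁ (α s) * α₁ s)
    change |E₁ s * h₀ (α s) + h₁ (α s) * α₁ s| ≤ _
    linarith [show BD * s = BE * s * B₀ + B₁ * (L * T * s) by rw [hBD]; ring]
  have bE₁T : ∀ s ∈ Ioo 0 T, |E₁ s| ≤ BE * T := fun s hs =>
    (bE₁' s hs).trans (mul_le_mul_of_nonneg_left hs.2.le hBE0)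
  have bα₁T : ∀ s ∈ Ioo 0 T, |α₁ s| ≤ L * T * T := fun s hs =>
    (bα₁ s hs).trans (mul_le_mul_of_nonneg_left hs.2.le hLT)
  set BD' := BE * B₀ + BE * T * (B₁ * (L * T * T)) + B₂ * (L * T * T) ^ 2 + B₁ * (L * T)
  have hBD'0 : 0 ≤ BD' := by positivity
  have bD' : ∀ s ∈ Ioo 0 T, |D' s| ≤ BD' := by
    intro s hs
    have p1 : |E₂ s * h₀ (α s)| ≤ BE * B₀ := by
      rw [abs_mul]
      exact mul_le_mul (bE₂ s hs) (b0 s (hsub hs)) (abs_nonneg _) hBE0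
    have p2 : |E₁ s * (h₁ (α s) * α₁ s)| ≤ BE * T * (B₁ * (L * T * T)) := by
      rw [abs_mul, abs_mul]
      exact mul_le_mul (bE₁T s hs) (mul_le_mul (b1 s (hsub hs)) (bα₁T s hs) (abs_nonneg _) hB₁)
        (by positivity) (by positivity)
    have p3 : |h₂ (α s) * α₁ s ^ 2| ≤ B₂ * (L * T * T) ^ 2 := by
      rw [abs_mul, abs_pow]
      exact mul_le_mul (b2 s (hsub hs)) (pow_le_pow_left₀ (abs_nonneg _) (bα₁T s hs) 2)
        (by positivity) hB₂
    have p4 : |h₁ (α s) * α₂ s| ≤ B₁ * (L * T) := by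
      rw [abs_mul]
      exact mul_le_mul (b1 s (hsub hs)) (bα₂ s hs) (abs_nonneg _) hB₁
    have q1 := abs_add_le (E₂ s * h₀ (α s) + E₁ s * (h₁ (α s) * α₁ s)
      + h₂ (α s) * α₁ s ^ 2) (h₁ (α s) * α₂ s)
    have q2 := abs_add_le (E₂ s * h₀ (α s) + E₁ s * (h₁ (α s) * α₁ s))
      (h₂ (α s) * α₁ s ^ 2)
    have q3 := abs_add_le (E₂ s * h₀ (α s)) (E₁ s * (h₁ (α s) * α₁ s))
    change |E₂ s * h₀ (α s) + E₁ s * (h₁ (α s) * α₁ s)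
      + h₂ (α s) * α₁ s ^ 2 + h₁ (α s) * α₂ s| ≤ _
    linarith
  have cD : ContinuousOn D (Ioo 0 T) :=
    (cE₁.mul (ch0.mono hsub)).add ((ch1.mono hsub).mul (c1.mono hsub))
  have cD' : ContinuousOn D' (Ioo 0 T) :=
    (((cE₂.mul (ch0.mono hsub)).add (cE₁.mul ((ch1.mono hsub).mul
      (c1.mono hsub)))).add ((ch2.mono hsub).mul ((c1.mono hsub).pow 2))).add
      ((ch1.mono hsub).mul (c2.mono hsub))
  have dX : ∀ s ∈ Ioo 0 T, HasDerivAt X (X s * E₁ s) s := fun s hs => (dE s hs).exp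
  have dh0 : ∀ s ∈ Ioo 0 T, HasDerivAt (fun s => h₀ (α s)) (h₁ (α s) * α₁ s) s :=
    fun s hs => (e0 (α s)).comp s (d0 s hs)
  have dh1 : ∀ s ∈ Ioo 0 T, HasDerivAt (fun s => h₁ (α s)) (h₂ (α s) * α₁ s) s :=
    fun s hs => (e1 (α s)).comp s (d0 s hs)
  have dD : ∀ s ∈ Ioo 0 T, HasDerivAt D (D' s) s := fun s hs => by
    refine (((dE₁ s hs).mul (dh0 s hs)).add ((dh1 s hs).mul (d1 s hs))).congr_deriv ?_
    simp only [D']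
    ring
  refine ⟨fun s => X s * h₀ (α s), fun s => X s * D s, fun s => X s * (E₁ s * D s + D' s),
    BX * B₀ + BX * BD + BX * BD * T + BX * (BE * T * (BD * T) + BD'), cX.mul ch0,
    (cX.mono hsub).mul cD, (cX.mono hsub).mul ((cE₁.mul cD).add cD'),
    fun s hs => ?_, fun s hs => ?_, fun s hs => ?_, fun s hs => ⟨?_, ?_, ?_⟩, fun s hs => ?_⟩
  · refine ((dX s hs).mul (dh0 s hs)).congr_deriv ?_
    simp only [D]
    ring
  · refine ((dX s hs).mul (dD s hs)).congr_deriv ?_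
    ring
  · rw [abs_mul]
    have h1 := mul_le_mul (bX s hs) (b0 s hs) (abs_nonneg _) hBX0
    have h2 : 0 ≤ BX * BD + BX * BD * T + BX * (BE * T * (BD * T) + BD') := by positivity
    linarith
  · rw [abs_mul]
    have h1 := mul_le_mul (bX s (hsub hs)) (bD s hs) (abs_nonneg _) hBX0
    have h2 : 0 ≤ (BX * B₀ + BX * BD * T + BX * (BE * T * (BD * T) + BD')) * s :=
      mul_nonneg (by positivity) hs.1.le
    linarith
  · rw [abs_mul]
    have h1 := mul_le_mul (bX s (hsub hs))
      ((bD s hs).trans (mul_le_mul_of_nonneg_left hs.2.le hBD0)) (abs_nonneg _) hBX0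
    have h2 : 0 ≤ BX * B₀ + BX * BD + BX * (BE * T * (BD * T) + BD') := by positivity
    linarith
  · rw [abs_mul]
    have h3 : |E₁ s * D s + D' s| ≤ BE * T * (BD * T) + BD' := by
      refine (abs_add_le _ _).trans (add_le_add ?_ (bD' s hs))
      rw [abs_mul]
      exact mul_le_mul (bE₁T s hs) ((bD s hs).trans (mul_le_mul_of_nonneg_left hs.2.le hBD0))
        (abs_nonneg _) (by positivity)
    have h1 := mul_le_mul (bX s (hsub hs)) h3 (abs_nonneg _) hBX0
    have h2 : 0 ≤ BX * B₀ + BX * BD + BX * BD * T := by positivity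
    linarith
  · have hX : X s = s ^ (α 0 - α s) := by
      rcases hs.1.eq_or_lt with rfl | hs0
      · simp [X, E]
      · rw [Real.rpow_def_of_pos hs0, mul_comm]
    change X s * h₀ (α s) = _
    rw [hX, hh, mul_one_div]

/-- The generalized identity function has a bounded second derivative `k`, and `g'(0) = 0`,
`g(0) = 1`. -/
theorem IsSmoothExponent.exists_kernel {T : ℝ} {α : ℝ → ℝ} (hT : 0 < T) (hα : IsSmoothExponent T α)
    (hα1 : iteratedDerivWithin 1 α (Icc 0 T) 0 = 0)
    (hα2 : iteratedDerivWithin 2 α (Icc 0 T) 0 = 0) :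
    ∃ (k : ℝ → ℝ) (C : ℝ), (∀ x, |k x| ≤ C) ∧ IntegrableOn k (Ioc 0 T) ∧ ContinuousOn k (Ioo 0 T) ∧
      (∀ x ∈ Ioo 0 T, HasDerivAt (genIdentity α) (prim k x) x) ∧
      (∀ x ∈ Icc 0 T, genIdentity α x = 1 + prim (prim k) x) ∧
      ∀ x ∈ Icc 0 T, 0 ≤ genIdentity α x := by
  obtain ⟨φ₀, φ₁, φ₂, C, c0, c1, c2, d0, d1, b0, b12, hφ⟩ :=
    hα.exists_integrand_derivs hT hα1 hα2
  have hα0 := hα.mem_Ioo 0 ⟨le_rfl, hT.le⟩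
  have hΓ : ∀ s ∈ Icc 0 T, 0 < Real.Gamma (α 0 - 1) * Real.Gamma (2 - α s) := fun s hs =>
    mul_pos (Real.Gamma_pos_of_pos (by linarith [hα0.1]))
      (Real.Gamma_pos_of_pos (by linarith [(hα.mem_Ioo s hs).2]))
  have hw := integrableOn_betaDensity hα0.1 hα0.2
  have hzw : ∀ w : ℝ → ℝ, IntegrableOn w (Ioo 0 1) → IntegrableOn (fun z => z * w z) (Ioo 0 1) := by
    intro w hw
    refine Integrable.bdd_mul (c := 1) hw measurable_id.aestronglyMeasurable ?_
    filter_upwards [ae_restrict_mem measurableSet_Ioo] with z hz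
    change ‖z‖ ≤ 1
    rw [Real.norm_of_nonneg hz.1.le]
    exact hz.2.le
  have hw1 := hzw _ hw
  have hw2 := hzw _ hw1
  have hsub := Ioo_subset_Icc_self (a := (0 : ℝ)) (b := T)
  have hm : ∀ t ∈ Ioo 0 T, ∀ z ∈ Ioo (0 : ℝ) 1, t * z ∈ Ioo 0 T := fun t ht z hz => mul_mem_Ioo ht hz
  have hg : ∀ t ∈ Icc 0 T, genIdentity α t = ∫ z in Ioo 0 1, φ₀ (t * z) * betaDensity (α 0) z := by
    intro t ht
    rw [genIdentity, intervalIntegral.integral_of_le zero_le_one, integral_Ioc_eq_integral_Ioo]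
    refine setIntegral_congr_fun measurableSet_Ioo fun z hz => ?_
    simp only [betaDensity]
    rw [hφ _ (mul_mem_Icc ht hz), mul_assoc]
  let g₁ : ℝ → ℝ := fun t => ∫ z in Ioo 0 1, φ₁ (t * z) * (z * betaDensity (α 0) z)
  let g₂ : ℝ → ℝ := fun t => ∫ z in Ioo 0 1, φ₂ (t * z) * (z * (z * betaDensity (α 0) z))
  have hd0 : ∀ t ∈ Ioo 0 T, HasDerivAt (genIdentity α) (g₁ t) t := by
    intro t ht
    refine (hasDerivAt_integral_dilation d0 c1 (fun s hs => b0 s (hsub hs))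
      (fun s hs => (b12 s hs).2.1) hw ht).congr_of_eventuallyEq ?_
    filter_upwards [Ioo_mem_nhds ht.1 ht.2] with x hx using hg x (hsub hx)
  have hd1 : ∀ t ∈ Ioo 0 T, HasDerivAt g₁ (g₂ t) t := fun t ht =>
    hasDerivAt_integral_dilation d1 c2 (fun s hs => (b12 s hs).2.1)
      (fun s hs => (b12 s hs).2.2) hw1 ht
  have hc2 : ContinuousOn g₂ (Ioo 0 T) :=
    continuousOn_integral_dilation hm c2 (fun s hs => (b12 s hs).2.2) hw2
  let C₂ := ∫ z in Ioo 0 1, C * |z * (z * betaDensity (α 0) z)|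
  have hb2 : ∀ t ∈ Ioo 0 T, |g₂ t| ≤ C₂ := fun t ht =>
    norm_integral_le_of_norm_le (hw2.abs.const_mul C)
      (ae_norm_dilation_le hm (fun s hs => (b12 s hs).2.2) ht)
  let C₁ := ∫ z in Ioo 0 1, C * |z * (z * betaDensity (α 0) z)|
  -- The bound `|φ₁ s| ≤ C s`, and not mere boundedness, makes `g'` tend to `0` at the origin.
  have hb1 : ∀ t ∈ Ioo 0 T, |g₁ t| ≤ C₁ * t := by
    intro t ht
    have e : C₁ * t = ∫ z in Ioo 0 1, C * |z * (z * betaDensity (α 0) z)| * t :=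
      (integral_mul_const _ _).symm
    rw [e]
    change ‖∫ z in Ioo 0 1, φ₁ (t * z) * (z * betaDensity (α 0) z)‖ ≤ _
    refine norm_integral_le_of_norm_le ((hw2.abs.const_mul C).mul_const t) ?_
    filter_upwards [ae_restrict_mem measurableSet_Ioo] with z hz
    rw [norm_mul]
    have := (b12 _ (mul_mem_Ioo ht hz)).1
    calc ‖φ₁ (t * z)‖ * ‖z * betaDensity (α 0) z‖
        ≤ C * (t * z) * |z * betaDensity (α 0) z| := mul_le_mul_of_nonneg_right this (abs_nonneg _)
      _ = C * |z * (z * betaDensity (α 0) z)| * t := by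
          rw [abs_mul z (z * _), abs_of_pos hz.1]
          ring
  have hki : IntegrableOn ((Ioo 0 T).indicator g₂) (Ioc 0 T) := by
    refine Integrable.integrableOn ?_
    rw [integrable_indicator_iff measurableSet_Ioo]
    refine Integrable.of_bound (hc2.aestronglyMeasurable measurableSet_Ioo) C₂ ?_
    filter_upwards [ae_restrict_mem measurableSet_Ioo] with t ht using hb2 t ht
  have hprim : ∀ x ∈ Ioo 0 T, prim ((Ioo 0 T).indicator g₂) x = g₁ x := by
    intro x hx
    -- Outside the open interval `g₁` is not controlled. Setting it to its limit `0` at the origin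
    -- gives a function continuous up to `0`, to which the fundamental theorem of calculus applies.
    let G : ℝ → ℝ := (Ioo 0 T).indicator g₁
    have hG : ContinuousOn G (Icc 0 x) := by
      intro t ht
      rcases ht.1.eq_or_lt with rfl | ht0
      · have hG0 : G 0 = 0 := indicator_of_notMem (fun h => lt_irrefl _ h.1) _
        rw [ContinuousWithinAt, hG0]
        refine squeeze_zero_norm' (a := fun s => C₁ * s) ?_ ?_
        · filter_upwards [self_mem_nhdsWithin] with s hs
          rcases hs.1.eq_or_lt with rfl | hs0
          · rw [hG0]; simp
          · rw [show G s = g₁ s from indicator_of_mem (show s ∈ Ioo 0 T from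
              ⟨hs0, hs.2.trans_lt hx.2⟩) _]
            exact hb1 s ⟨hs0, hs.2.trans_lt hx.2⟩
        · have : Filter.Tendsto (fun s : ℝ => C₁ * s) (nhds 0) (nhds (C₁ * 0)) :=
            (continuous_const.mul continuous_id).tendsto 0
          rw [mul_zero] at this
          exact this.mono_left nhdsWithin_le_nhds
      · have ht' : t ∈ Ioo 0 T := ⟨ht0, ht.2.trans_lt hx.2⟩
        refine ((hd1 t ht').continuousAt.congr ?_).continuousWithinAt
        filter_upwards [Ioo_mem_nhds ht'.1 ht'.2] with s hs using (indicator_of_mem hs _).symm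
    have hGd : ∀ t ∈ Ioo 0 x, HasDerivAt G ((Ioo 0 T).indicator g₂ t) t := by
      intro t ht
      have ht' : t ∈ Ioo 0 T := ⟨ht.1, ht.2.trans hx.2⟩
      rw [indicator_of_mem ht']
      refine (hd1 t ht').congr_of_eventuallyEq ?_
      filter_upwards [Ioo_mem_nhds ht'.1 ht'.2] with s hs using indicator_of_mem hs _
    have := intervalIntegral.integral_eq_sub_of_hasDerivAt_of_le hx.1.le hG hGd
      (intervalIntegrable_of_Ioc_subset hki ⟨le_rfl, hT.le⟩ (hsub hx))
    rw [prim, this, show G x = g₁ x from indicator_of_mem hx _,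
      show G 0 = 0 from indicator_of_notMem (fun h => lt_irrefl _ h.1) _, sub_zero]
  have hgc : ContinuousOn (genIdentity α) (Icc 0 T) :=
    (continuousOn_integral_dilation (fun t ht z hz => mul_mem_Icc ht hz) c0 b0 hw).congr hg
  have hg0 : genIdentity α 0 = 1 := by
    rw [hg 0 ⟨le_rfl, hT.le⟩]
    simp only [zero_mul]
    rw [integral_const_mul, integral_betaDensity hα0.1 hα0.2, hφ 0 ⟨le_rfl, hT.le⟩, sub_self,
      Real.rpow_zero]
    exact one_div_mul_cancel (hΓ 0 ⟨le_rfl, hT.le⟩).ne'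
  have hd : ∀ x ∈ Ioo 0 T, HasDerivAt (genIdentity α) (prim ((Ioo 0 T).indicator g₂) x) x :=
    fun x hx => by rw [hprim x hx]; exact hd0 x hx
  refine ⟨(Ioo 0 T).indicator g₂, |C₂|, fun x => ?_, hki, hc2.congr fun x hx =>
    indicator_of_mem hx _, hd, fun x hx => ?_, fun x hx => ?_⟩
  · by_cases hx : x ∈ Ioo 0 T
    · rw [indicator_of_mem hx]
      exact (hb2 x hx).trans (le_abs_self _)
    · rw [indicator_of_notMem hx, abs_zero]
      exact abs_nonneg _
  · have hpc := continuousOn_prim hT.le hki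
    have := intervalIntegral.integral_eq_sub_of_hasDerivAt_of_le hx.1
      (hgc.mono (Icc_subset_Icc_right hx.2)) (fun t ht => hd t ⟨ht.1, ht.2.trans_le hx.2⟩)
      (ContinuousOn.intervalIntegrable (hpc.mono (by
        rw [uIcc_of_le hx.1]; exact Icc_subset_Icc_right hx.2)))
    rw [prim, this, hg0]
    ring
  · rw [hg x hx]
    refine setIntegral_nonneg measurableSet_Ioo fun z hz => ?_
    have hxz := mul_mem_Icc hx hz
    rw [hφ _ hxz]
    refine mul_nonneg (div_nonneg (Real.rpow_nonneg hxz.1 _) (hΓ _ hxz).le) ?_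
    exact mul_nonneg (Real.rpow_nonneg (by linarith [hz.2]) _) (Real.rpow_nonneg hz.1.le _)

/-! ### The Dirichlet Laplacian: linearity, symmetry and duality -/

section Laplacian

variable {d : ℕ} {Ω : Set (EuclideanSpace ℝ (Fin d))}

theorem IsTestFunction.linear_comb {φ ψ : EuclideanSpace ℝ (Fin d) → ℝ} (hφ : IsTestFunction Ω φ)
    (hψ : IsTestFunction Ω ψ) (a b : ℝ) : IsTestFunction Ω (a • φ + b • ψ) where
  smooth := (hφ.smooth.const_smul a).add (hψ.smooth.const_smul b)
  hasCompactSupport := (hφ.hasCompactSupport.smul_left (f := fun _ => a)).add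
    (hψ.hasCompactSupport.smul_left (f := fun _ => b))
  tsupport_subset := by
    refine (tsupport_add _ _).trans (union_subset ?_ ?_)
    · exact (tsupport_smul_subset_right (fun _ => a) φ).trans hφ.tsupport_subset
    · exact (tsupport_smul_subset_right (fun _ => b) ψ).trans hψ.tsupport_subset

theorem partialDeriv_linear_comb {φ ψ : EuclideanSpace ℝ (Fin d) → ℝ} (hφ : IsTestFunction Ω φ)
    (hψ : IsTestFunction Ω ψ) (a b : ℝ) (i : Fin d) (x : EuclideanSpace ℝ (Fin d)) :
    partialDeriv i (a • φ + b • ψ) x = a * partialDeriv i φ x + b * partialDeriv i ψ x := by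
  have h1 := hφ.smooth.differentiable (by simp) x
  have h2 := hψ.smooth.differentiable (by simp) x
  rw [partialDeriv, fderiv_add (h1.const_smul a) (h2.const_smul b), fderiv_const_smul h1,
    fderiv_const_smul h2]
  rfl

theorem HasH10Gradient.linear_comb {v v' : L2 Ω} {w w' : Fin d → L2 Ω} (h : HasH10Gradient Ω v w)
    (h' : HasH10Gradient Ω v' w') (a b : ℝ) :
    HasH10Gradient Ω (a • v + b • v') (a • w + b • w') := by
  refine map_mem_closure₂ (f := fun p q : L2 Ω × (Fin d → L2 Ω) => a • p + b • q) (by fun_prop)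
    h h' ?_
  rintro p ⟨φ, hφ, hp, hpi⟩ q ⟨ψ, hψ, hq, hqi⟩
  refine ⟨a • φ + b • ψ, hφ.linear_comb hψ a b, ?_, fun i => ?_⟩
  · filter_upwards [Lp.coeFn_add (a • p.1) (b • q.1), Lp.coeFn_smul a p.1, Lp.coeFn_smul b q.1, hp,
      hq] with x h1 h2 h3 h4 h5
    simp only [Prod.fst_add, Prod.smul_fst, Pi.add_apply, Pi.smul_apply] at *
    rw [h1, h2, h3, h4, h5]
  · filter_upwards [Lp.coeFn_add (a • p.2 i) (b • q.2 i), Lp.coeFn_smul a (p.2 i),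
      Lp.coeFn_smul b (q.2 i), hpi i, hqi i] with x h1 h2 h3 h4 h5
    rw [partialDeriv_linear_comb hφ hψ]
    simp only [Prod.snd_add, Prod.smul_snd, Pi.add_apply, Pi.smul_apply, smul_eq_mul] at *
    rw [h1, h2, h3, h4, h5]

theorem hasDirichletLaplacian_iff {v q : L2 Ω} : HasDirichletLaplacian Ω v q ↔
    ∃ w : Fin d → L2 Ω, HasH10Gradient Ω v w ∧
      ∀ φ (hφ : IsTestFunction Ω φ),
        ∑ i, inner ℝ (hφ.partialDeriv i).memLp.toLp (w i) = -inner ℝ hφ.memLp.toLp q := by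
  refine exists_congr fun w => and_congr_right fun _ => forall₂_congr fun φ hφ => ?_
  rw [hφ.inner_toLp]
  simp only [fun i => (hφ.partialDeriv i).inner_toLp]

theorem HasDirichletLaplacian.linear_comb {v v' q q' : L2 Ω} (h : HasDirichletLaplacian Ω v q)
    (h' : HasDirichletLaplacian Ω v' q') (a b : ℝ) :
    HasDirichletLaplacian Ω (a • v + b • v') (a • q + b • q') := by
  rw [hasDirichletLaplacian_iff] at *
  obtain ⟨w, hw, hq⟩ := h
  obtain ⟨w', hw', hq'⟩ := h'
  refine ⟨_, hw.linear_comb hw' a b, fun φ hφ => ?_⟩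
  have h1 := hq φ hφ
  have h2 := hq' φ hφ
  simp only [Pi.add_apply, Pi.smul_apply, inner_add_right, real_inner_smul_right,
    Finset.sum_add_distrib, ← Finset.mul_sum]
  rw [h1, h2]
  ring

theorem hasDirichletLaplacian_dirichletLaplacian {v : L2 Ω} (hv : v ∈ HCheckTwo Ω) :
    HasDirichletLaplacian Ω v (dirichletLaplacian Ω v) := by
  obtain ⟨q, hq⟩ := hv
  have hex : ∃ q, HasDirichletLaplacian Ω v q := ⟨q, hq⟩
  rw [dirichletLaplacian, dif_pos hex]
  exact hex.choose_spec

theorem HCheckTwo.linear_comb {v v' : L2 Ω} (hv : v ∈ HCheckTwo Ω) (hv' : v' ∈ HCheckTwo Ω)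
    (a b : ℝ) : a • v + b • v' ∈ HCheckTwo Ω :=
  ⟨_, (hasDirichletLaplacian_dirichletLaplacian hv).linear_comb
    (hasDirichletLaplacian_dirichletLaplacian hv') a b⟩

theorem dirichletLaplacian_linear_comb (hΩ : IsOpen Ω) {v v' : L2 Ω} (hv : v ∈ HCheckTwo Ω)
    (hv' : v' ∈ HCheckTwo Ω) (a b : ℝ) : dirichletLaplacian Ω (a • v + b • v')
      = a • dirichletLaplacian Ω v + b • dirichletLaplacian Ω v' :=
  ((hasDirichletLaplacian_dirichletLaplacian hv).linear_comb
    (hasDirichletLaplacian_dirichletLaplacian hv') a b).dirichletLaplacian_eq hΩ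

/-- The weak formulation is a closed condition on the pair (function, gradient), so it passes from
test functions to their closure `H¹₀`. -/
theorem HasH10Gradient.inner_eq {q v' : L2 Ω} {w' : Fin d → L2 Ω} {w : Fin d → L2 Ω}
    (hw : ∀ φ (hφ : IsTestFunction Ω φ),
      ∑ i, inner ℝ (hφ.partialDeriv i).memLp.toLp (w i) = -inner ℝ hφ.memLp.toLp q)
    (h' : HasH10Gradient Ω v' w') : inner ℝ v' q = -∑ i, inner ℝ (w' i) (w i) := by
  have hcl : IsClosed {p : L2 Ω × (Fin d → L2 Ω) |
      inner ℝ p.1 q = -∑ i, inner ℝ (p.2 i) (w i)} := isClosed_eq (by fun_prop) (by fun_prop)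
  refine (hcl.closure_subset_iff.2 ?_) h'
  rintro ⟨u, z⟩ ⟨φ, hφ, hu, hz⟩
  have e1 : u = hφ.memLp.toLp := Lp.ext (hu.trans hφ.memLp.coeFn_toLp.symm)
  have e2 : ∀ i, z i = (hφ.partialDeriv i).memLp.toLp := fun i =>
    Lp.ext ((hz i).trans (hφ.partialDeriv i).memLp.coeFn_toLp.symm)
  simp only [mem_ofPred_eq, e1, e2]
  rw [hw φ hφ, neg_neg]

/-- Green's formula on the domain of the Dirichlet Laplacian. -/
theorem exists_gradient (v : ℕ → L2 Ω) (hv : ∀ n, v n ∈ HCheckTwo Ω) :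
    ∃ w : ℕ → Fin d → L2 Ω, ∀ j n,
      inner ℝ (dirichletLaplacian Ω (v j)) (v n) = -∑ i, inner ℝ (w j i) (w n i) := by
  -- One gradient is fixed per index, so that `(A v_j, v_n)` becomes a sum of Gram matrices over the
  -- components, the form in which Toeplitz positivity applies.
  choose w hw hq using fun n =>
    hasDirichletLaplacian_iff.1 (hasDirichletLaplacian_dirichletLaplacian (hv n))
  refine ⟨w, fun j n => ?_⟩
  rw [real_inner_comm, (hw n).inner_eq (hq j)]
  simp only [real_inner_comm]

theorem inner_dirichletLaplacian_self_nonpos {v : L2 Ω} (hv : v ∈ HCheckTwo Ω) :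
    inner ℝ (dirichletLaplacian Ω v) v ≤ 0 := by
  obtain ⟨w, hw⟩ := exists_gradient (fun _ => v) fun _ => hv
  rw [hw 0 0, neg_nonpos]
  refine Finset.sum_nonneg fun i _ => ?_
  exact real_inner_self_nonneg

/-- The Laplacian of a test function. -/
noncomputable def IsTestFunction.laplacian {φ : EuclideanSpace ℝ (Fin d) → ℝ}
    (hφ : IsTestFunction Ω φ) : L2 Ω :=
  ∑ i, ((hφ.partialDeriv i).partialDeriv i).memLp.toLp

/-- Two integrations by parts move `A` to the test function. Afterwards the pairing is a bounded
functional of `v`, which commutes with integrals in time. -/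
theorem IsTestFunction.inner_dirichletLaplacian {φ : EuclideanSpace ℝ (Fin d) → ℝ}
    (hφ : IsTestFunction Ω φ) {v : L2 Ω} (hv : v ∈ HCheckTwo Ω) :
    inner ℝ hφ.memLp.toLp (dirichletLaplacian Ω v) = inner ℝ hφ.laplacian v := by
  obtain ⟨w, hw, hq⟩ := hasDirichletLaplacian_iff.1 (hasDirichletLaplacian_dirichletLaplacian hv)
  have h1 := hq φ hφ
  rw [IsTestFunction.laplacian, sum_inner]
  have h2 : ∀ i, inner ℝ (hφ.partialDeriv i).memLp.toLp (w i)
      = -inner ℝ ((hφ.partialDeriv i).partialDeriv i).memLp.toLp v := fun i => by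
    rw [(hφ.partialDeriv i).inner_toLp, ((hφ.partialDeriv i).partialDeriv i).inner_toLp]
    exact hw.integral_mul_test i (hφ.partialDeriv i)
  simp only [h2, Finset.sum_neg_distrib] at h1
  linarith

/-- Nothing but `0` is orthogonal to all test functions, so they are dense. The inequality extends
by closedness to all of `L²` and is then applied to `x` itself. -/
theorem L2.norm_le_of_forall_testFunction (hΩ : IsOpen Ω) {x : L2 Ω} {C : ℝ} (hC : 0 ≤ C)
    (h : ∀ φ (hφ : IsTestFunction Ω φ), |inner ℝ hφ.memLp.toLp x| ≤ C * ‖hφ.memLp.toLp‖) :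
    ‖x‖ ≤ C := by
  let S : Set (L2 Ω) := {y | ∃ φ, ∃ hφ : IsTestFunction Ω φ, y = hφ.memLp.toLp}
  have hzero : IsTestFunction Ω (0 : EuclideanSpace ℝ (Fin d) → ℝ) :=
    ⟨contDiff_const, HasCompactSupport.zero, by simp⟩
  let K : Submodule ℝ (L2 Ω) :=
    { carrier := S
      add_mem' := by
        rintro _ _ ⟨φ, hφ, rfl⟩ ⟨ψ, hψ, rfl⟩
        have h1 := hφ.linear_comb hψ 1 1
        rw [one_smul, one_smul] at h1
        exact ⟨_, h1, rfl⟩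
      zero_mem' := ⟨0, hzero, rfl⟩
      smul_mem' := by
        rintro c _ ⟨φ, hφ, rfl⟩
        have h1 := hφ.linear_comb hφ c 0
        rw [zero_smul, add_zero] at h1
        exact ⟨_, h1, rfl⟩ }
  have horth : Kᗮ = ⊥ := by
    rw [Submodule.eq_bot_iff]
    intro y hy
    refine L2.eq_of_forall_testFunction hΩ fun φ hφ => ?_
    have h1 := (Submodule.mem_orthogonal K y).1 hy hφ.memLp.toLp ⟨φ, hφ, rfl⟩
    have h2 := hφ.inner_toLp (0 : L2 Ω)
    rw [inner_zero_right] at h2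
    rw [← hφ.inner_toLp, h1, h2]
  have hdense : x ∈ K.topologicalClosure := by
    rw [Submodule.topologicalClosure_eq_top_iff.2 horth]
    trivial
  have hcl : IsClosed {y : L2 Ω | |inner ℝ y x| ≤ C * ‖y‖} :=
    isClosed_le (by fun_prop) (by fun_prop)
  have hx : |inner ℝ x x| ≤ C * ‖x‖ := by
    refine (hcl.closure_subset_iff.2 ?_) hdense
    rintro _ ⟨φ, hφ, rfl⟩
    exact h φ hφ
  rw [real_inner_self_eq_norm_sq, abs_of_nonneg (sq_nonneg _)] at hx
  rcases (norm_nonneg x).eq_or_lt with h0 | h0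
  · rwa [← h0]
  · nlinarith

end Laplacian

/-! ### Time regularity of the solution -/

/-- The primitive of `|M| t^{a-1}`, extended by `0`. -/
noncomputable def powerMajorant (M a x : ℝ) : ℝ := |M| * (max x 0 ^ a / a)

theorem monotone_powerMajorant (M : ℝ) {a : ℝ} (ha : 0 < a) : Monotone (powerMajorant M a) :=
  fun _ _ hxy => mul_le_mul_of_nonneg_left (div_le_div_of_nonneg_right
    (Real.rpow_le_rpow (le_max_right _ _) (max_le_max_right 0 hxy) ha.le) ha.le) (abs_nonneg M)

theorem powerMajorant_zero (M : ℝ) {a : ℝ} (ha : 0 < a) : powerMajorant M a 0 = 0 := by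
  simp [powerMajorant, Real.zero_rpow ha.ne']

theorem powerMajorant_nonneg (M : ℝ) {a : ℝ} (ha : 0 < a) (x : ℝ) : 0 ≤ powerMajorant M a x :=
  mul_nonneg (abs_nonneg M) (div_nonneg (Real.rpow_nonneg (le_max_right _ _) a) ha.le)

theorem integral_powerMajorant (M : ℝ) {a s t : ℝ} (ha : 0 < a) (hs : 0 ≤ s) (ht : 0 ≤ t) :
    ∫ r in s..t, |M| * r ^ (a - 1) = powerMajorant M a t - powerMajorant M a s := by
  rw [intervalIntegral.integral_const_mul, integral_rpow (Or.inl (by linarith)), sub_add_cancel,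
    powerMajorant, powerMajorant, max_eq_left hs, max_eq_left ht]
  ring

/-! ### Increments and second differences of a function with weakly singular second derivative -/

section SecondPrimitive

variable {E : Type*} [NormedAddCommGroup E] [NormedSpace ℝ E] {T M a c : ℝ} {p p₁ p₂ : ℝ → E}
  {p₀ v : E}

theorem continuousOn_of_eq_primitive {q q₁ : ℝ → E} {q₀ : E} (hT : 0 ≤ T)
    (hi : IntegrableOn q₁ (Ioc 0 T)) (h : ∀ t ∈ Icc 0 T, q t = q₀ + ∫ s in (0 : ℝ)..t, q₁ s) :
    ContinuousOn q (Icc 0 T) := by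
  have := intervalIntegral.continuousOn_primitive_interval'
    (intervalIntegrable_of_Ioc_subset hi ⟨le_rfl, hT⟩ ⟨hT, le_rfl⟩) left_mem_uIcc
  rw [uIcc_of_le hT] at this
  exact (continuousOn_const.add this).congr h

theorem sub_eq_integral_of_eq_primitive {q q₁ : ℝ → E} {q₀ : E} (hi : IntegrableOn q₁ (Ioc 0 T))
    (h : ∀ t ∈ Icc 0 T, q t = q₀ + ∫ s in (0 : ℝ)..t, q₁ s) {s t : ℝ} (hs : s ∈ Icc 0 T)
    (ht : t ∈ Icc 0 T) : q t - q s = ∫ r in s..t, q₁ r := by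
  have h0 : (0 : ℝ) ∈ Icc 0 T := ⟨le_rfl, hs.1.trans hs.2⟩
  rw [h t ht, h s hs, ← intervalIntegral.integral_add_adjacent_intervals
    (intervalIntegrable_of_Ioc_subset hi h0 hs) (intervalIntegrable_of_Ioc_subset hi hs ht)]
  abel

/-- `p` is twice a primitive of `p₂`, which is dominated by `c |M| t^{a-1}`. -/
structure IsSecondPrimitive (T M a c : ℝ) (p₀ v : E) (p p₁ p₂ : ℝ → E) : Prop where
  pos : 0 < a
  nonneg : 0 ≤ c
  integrable : IntegrableOn p₂ (Ioc 0 T)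
  first_eq : ∀ t ∈ Icc 0 T, p₁ t = v + ∫ s in (0 : ℝ)..t, p₂ s
  eq : ∀ t ∈ Icc 0 T, p t = p₀ + ∫ s in (0 : ℝ)..t, p₁ s
  bound : ∀ᵐ t ∂(volume.restrict (Ioc 0 T)), ‖p₂ t‖ ≤ c * (|M| * t ^ (a - 1))

namespace IsSecondPrimitive

theorem norm_first_sub_le (h : IsSecondPrimitive T M a c p₀ v p p₁ p₂) {s t : ℝ} (hs : 0 ≤ s)
    (hst : s ≤ t) (ht : t ≤ T) :
    ‖p₁ t - p₁ s‖ ≤ c * (powerMajorant M a t - powerMajorant M a s) := by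
  rw [sub_eq_integral_of_eq_primitive h.integrable h.first_eq ⟨hs, hst.trans ht⟩
    ⟨hs.trans hst, ht⟩, ← integral_powerMajorant M h.pos hs (hs.trans hst),
    ← intervalIntegral.integral_const_mul]
  refine intervalIntegral.norm_integral_le_of_norm_le hst ?_ ?_
  · have h1 := (ae_restrict_iff' measurableSet_Ioc).1 h.bound
    filter_upwards [h1] with r hr hrs
    exact hr ⟨hs.trans_lt hrs.1, hrs.2.trans ht⟩
  · exact ((intervalIntegral.intervalIntegrable_rpow' (by linarith [h.pos])).const_mul _).const_mul _

theorem continuousOn_first (h : IsSecondPrimitive T M a c p₀ v p p₁ p₂) (hT : 0 ≤ T) :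
    ContinuousOn p₁ (Icc 0 T) := continuousOn_of_eq_primitive hT h.integrable h.first_eq

theorem integrableOn_first (h : IsSecondPrimitive T M a c p₀ v p p₁ p₂) (hT : 0 ≤ T) :
    IntegrableOn p₁ (Ioc 0 T) :=
  (h.continuousOn_first hT).integrableOn_Icc.mono_set Ioc_subset_Icc_self

theorem norm_sub_le (h : IsSecondPrimitive T M a c p₀ v p p₁ p₂) {s t : ℝ} (hs : s ∈ Icc 0 T)
    (ht : t ∈ Icc 0 T) : ‖p s - p t‖ ≤ (‖v‖ + c * powerMajorant M a T) * |s - t| := by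
  have hT : 0 ≤ T := hs.1.trans hs.2
  rw [sub_eq_integral_of_eq_primitive (h.integrableOn_first hT) h.eq ht hs]
  refine intervalIntegral.norm_integral_le_of_norm_le_const fun r hr => ?_
  have hr' : r ∈ Icc 0 T := by
    rw [uIoc, mem_Ioc] at hr
    exact ⟨(le_min ht.1 hs.1).trans hr.1.le, hr.2.trans (max_le ht.2 hs.2)⟩
  have h0 : p₁ 0 = v := by rw [h.first_eq 0 ⟨le_rfl, hT⟩]; simp
  have h1 := h.norm_first_sub_le le_rfl hr'.1 hr'.2
  rw [h0, powerMajorant_zero M h.pos, sub_zero] at h1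
  have h2 := mul_le_mul_of_nonneg_left (monotone_powerMajorant M h.pos hr'.2) h.nonneg
  have h3 := norm_add_le v (p₁ r - v)
  rw [add_sub_cancel] at h3
  linarith

/-- The second difference is the integral of `p₁ (r + x) - p₁ r` over an interval of length `l`, and
an increment of `p₁` is at most `c` times one of the majorant; the singularity of `p₂` at `0` enters
only through its integral. -/
theorem norm_second_diff_le (h : IsSecondPrimitive T M a c p₀ v p p₁ p₂) {s x l : ℝ} (hs : 0 ≤ s)
    (hx : 0 ≤ x) (hl : 0 ≤ l) (hT : s + x + l ≤ T) :
    ‖p (s + x + l) - p (s + x) - p (s + l) + p s‖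
      ≤ c * (l * (powerMajorant M a (s + x + l) - powerMajorant M a s)) := by
  have hT0 : 0 ≤ T := by linarith
  have hi := h.integrableOn_first hT0
  have m0 : s ∈ Icc 0 T := ⟨hs, by linarith⟩
  have m1 : s + l ∈ Icc 0 T := ⟨by linarith, by linarith⟩
  have m2 : s + x ∈ Icc 0 T := ⟨by linarith, by linarith⟩
  have m3 : s + x + l ∈ Icc 0 T := ⟨by linarith, hT⟩
  have h1 := sub_eq_integral_of_eq_primitive hi h.eq m2 m3
  have h2 := sub_eq_integral_of_eq_primitive hi h.eq m0 m1
  have h3 : ∫ r in (s + x)..(s + x + l), p₁ r = ∫ r in s..(s + l), p₁ (r + x) := by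
    rw [intervalIntegral.integral_comp_add_right]
    congr 1
    ring
  have hsh : IntervalIntegrable (fun r => p₁ (r + x)) volume s (s + l) := by
    have := (intervalIntegrable_of_Ioc_subset hi m2 m3).comp_add_right x
    rwa [show s + x - x = s by ring, show s + x + l - x = s + l by ring] at this
  have e : p (s + x + l) - p (s + x) - p (s + l) + p s
      = ∫ r in s..(s + l), (p₁ (r + x) - p₁ r) := by
    rw [intervalIntegral.integral_sub hsh (intervalIntegrable_of_Ioc_subset hi m0 m1), ← h3, ← h1,
      ← h2]
    abel
  rw [e]
  have := intervalIntegral.norm_integral_le_of_norm_le_const (a := s) (b := s + l)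
    (f := fun r => p₁ (r + x) - p₁ r)
    (C := c * (powerMajorant M a (s + x + l) - powerMajorant M a s)) fun r hr => by
      rw [uIoc_of_le (by linarith)] at hr
      refine (h.norm_first_sub_le (hs.trans hr.1.le) (by linarith) (by linarith [hr.2])).trans ?_
      refine mul_le_mul_of_nonneg_left ?_ h.nonneg
      have q1 := monotone_powerMajorant M h.pos (show r + x ≤ s + x + l by linarith [hr.2])
      have q2 := monotone_powerMajorant M h.pos hr.1.le
      linarith
  rw [show s + l - s = l by ring, abs_of_nonneg hl] at this
  linarith

/-- The bound on the pairing with `p₂` is a separate hypothesis because, for `ψ = Δφ`, it comes from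
the size of `A ∂ₜ²u` and involves `‖φ‖` only, not `‖Δφ‖`. -/
theorem inner_left {H : Type*} [NormedAddCommGroup H] [InnerProductSpace ℝ H] [CompleteSpace H]
    {p p₁ p₂ : ℝ → H} {p₀ v : H} (h : IsSecondPrimitive T M a c p₀ v p p₁ p₂) (hT : 0 ≤ T) (ψ : H)
    {c' : ℝ} (hc' : 0 ≤ c')
    (hb : ∀ᵐ t ∂(volume.restrict (Ioc 0 T)), |inner ℝ ψ (p₂ t)| ≤ c' * (|M| * t ^ (a - 1))) :
    IsSecondPrimitive T M a c' (inner ℝ ψ p₀) (inner ℝ ψ v) (fun t => inner ℝ ψ (p t))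
      (fun t => inner ℝ ψ (p₁ t)) (fun t => inner ℝ ψ (p₂ t)) where
  pos := h.pos
  nonneg := hc'
  integrable := (innerSL ℝ ψ).integrable_comp h.integrable
  first_eq t ht := by
    rw [h.first_eq t ht, inner_add_right]
    congr 1
    exact ((innerSL ℝ ψ).intervalIntegral_comp_comm
      (intervalIntegrable_of_Ioc_subset h.integrable ⟨le_rfl, hT⟩ ht)).symm
  eq t ht := by
    rw [h.eq t ht, inner_add_right]
    congr 1
    exact ((innerSL ℝ ψ).intervalIntegral_comp_comm
      (intervalIntegrable_of_Ioc_subset (h.integrableOn_first hT) ⟨le_rfl, hT⟩ ht)).symm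
  bound := hb

end IsSecondPrimitive

end SecondPrimitive

/-! ### The bounds for `u` and `A u` -/

section Regularity

variable {d : ℕ} {Ω : Set (EuclideanSpace ℝ (Fin d))}

theorem IsModelSolution.isSecondPrimitive {T κ M : ℝ} {α : ℝ → ℝ} {f : ℝ → L2 Ω} {u₀ v₀ : L2 Ω}
    {u ut utt : ℝ → L2 Ω} (hu : IsModelSolution T κ α f u₀ v₀ u ut utt) (hα : 1 < α 0)
    (hreg : ∀ᵐ t ∂(volume.restrict (Ioc 0 T)), utt t ∈ HCheckTwo Ω ∧
      ‖utt t‖ ≤ M * t ^ (α 0 - 2) ∧ ‖dirichletLaplacian Ω (utt t)‖ ≤ M * t ^ (α 0 - 2)) :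
    IsSecondPrimitive T M (α 0 - 1) 1 u₀ v₀ u ut utt where
  pos := by linarith
  nonneg := zero_le_one
  integrable := hu.integrable_utt
  first_eq := hu.ut_eq
  eq := hu.u_eq
  bound := by
    filter_upwards [hreg, ae_restrict_mem measurableSet_Ioc] with t ht htT
    rw [one_mul, show α 0 - 1 - 1 = α 0 - 2 by ring]
    exact ht.2.1.trans (mul_le_mul_of_nonneg_right (le_abs_self M) (Real.rpow_nonneg htT.1.le _))

theorem IsModelSolution.isSecondPrimitive_inner_laplacian {T κ M : ℝ} {α : ℝ → ℝ}
    {f : ℝ → L2 Ω} {u₀ v₀ : L2 Ω} {u ut utt : ℝ → L2 Ω} (hT : 0 ≤ T)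
    (hu : IsModelSolution T κ α f u₀ v₀ u ut utt) (hα : 1 < α 0)
    (hreg : ∀ᵐ t ∂(volume.restrict (Ioc 0 T)), utt t ∈ HCheckTwo Ω ∧
      ‖utt t‖ ≤ M * t ^ (α 0 - 2) ∧ ‖dirichletLaplacian Ω (utt t)‖ ≤ M * t ^ (α 0 - 2))
    {φ : EuclideanSpace ℝ (Fin d) → ℝ} (hφ : IsTestFunction Ω φ) :
    IsSecondPrimitive T M (α 0 - 1) ‖hφ.memLp.toLp‖ (inner ℝ hφ.laplacian u₀)
      (inner ℝ hφ.laplacian v₀) (fun t => inner ℝ hφ.laplacian (u t))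
      (fun t => inner ℝ hφ.laplacian (ut t)) (fun t => inner ℝ hφ.laplacian (utt t)) := by
  refine (hu.isSecondPrimitive hα hreg).inner_left hT _ (norm_nonneg _) ?_
  filter_upwards [hreg, ae_restrict_mem measurableSet_Ioc] with t ht htT
  rw [← hφ.inner_dirichletLaplacian ht.1, show α 0 - 1 - 1 = α 0 - 2 by ring]
  refine (abs_real_inner_le_norm _ _).trans (mul_le_mul_of_nonneg_left ?_ (norm_nonneg _))
  exact ht.2.2.trans (mul_le_mul_of_nonneg_right (le_abs_self M) (Real.rpow_nonneg htT.1.le _))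

/-- `A` is unbounded and is not interchanged with time integrals. Instead `(φ, A u(t)) = (Δφ, u(t))`
is estimated as a scalar function for each test function `φ`, with constants proportional to `‖φ‖`,
and duality returns the norm. -/
theorem IsModelSolution.norm_laplacian_sub_le {T κ M : ℝ} {α : ℝ → ℝ}
    {f : ℝ → L2 Ω} {u₀ v₀ : L2 Ω} {u ut utt : ℝ → L2 Ω} (hΩ : IsOpen Ω) (hv₀ : v₀ ∈ HCheckTwo Ω)
    (hu : IsModelSolution T κ α f u₀ v₀ u ut utt) (hα : 1 < α 0)
    (hreg : ∀ᵐ t ∂(volume.restrict (Ioc 0 T)), utt t ∈ HCheckTwo Ω ∧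
      ‖utt t‖ ≤ M * t ^ (α 0 - 2) ∧ ‖dirichletLaplacian Ω (utt t)‖ ≤ M * t ^ (α 0 - 2))
    {s t : ℝ} (hs : s ∈ Icc 0 T) (ht : t ∈ Icc 0 T) :
    ‖dirichletLaplacian Ω (u s) - dirichletLaplacian Ω (u t)‖
      ≤ (‖dirichletLaplacian Ω v₀‖ + powerMajorant M (α 0 - 1) T) * |s - t| := by
  have hT : 0 ≤ T := hs.1.trans hs.2
  have hμ : 0 ≤ powerMajorant M (α 0 - 1) T :=
        powerMajorant_nonneg M (by linarith) T
  refine L2.norm_le_of_forall_testFunction hΩ (by positivity) fun φ hφ => ?_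
  rw [inner_sub_right, hφ.inner_dirichletLaplacian (hu.mem_HCheckTwo s hs),
    hφ.inner_dirichletLaplacian (hu.mem_HCheckTwo t ht)]
  have h1 := (hu.isSecondPrimitive_inner_laplacian hT hα hreg hφ).norm_sub_le hs ht
  have h2 : ‖inner ℝ hφ.laplacian v₀‖ ≤ ‖hφ.memLp.toLp‖ * ‖dirichletLaplacian Ω v₀‖ := by
    rw [← hφ.inner_dirichletLaplacian hv₀]
    exact abs_real_inner_le_norm _ _
  refine h1.trans ?_
  rw [mul_right_comm]
  refine mul_le_mul_of_nonneg_right ?_ (abs_nonneg _)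
  linarith

theorem IsModelSolution.norm_laplacian_second_diff_le {T κ M : ℝ} {α : ℝ → ℝ}
    {f : ℝ → L2 Ω} {u₀ v₀ : L2 Ω} {u ut utt : ℝ → L2 Ω} (hΩ : IsOpen Ω)
    (hu : IsModelSolution T κ α f u₀ v₀ u ut utt) (hα : 1 < α 0)
    (hreg : ∀ᵐ t ∂(volume.restrict (Ioc 0 T)), utt t ∈ HCheckTwo Ω ∧
      ‖utt t‖ ≤ M * t ^ (α 0 - 2) ∧ ‖dirichletLaplacian Ω (utt t)‖ ≤ M * t ^ (α 0 - 2))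
    {s x l : ℝ} (hs : 0 ≤ s) (hx : 0 ≤ x) (hl : 0 ≤ l) (hT : s + x + l ≤ T) :
    ‖dirichletLaplacian Ω (u (s + x + l)) - dirichletLaplacian Ω (u (s + x))
        - dirichletLaplacian Ω (u (s + l)) + dirichletLaplacian Ω (u s)‖
      ≤ l * (powerMajorant M (α 0 - 1) (s + x + l) - powerMajorant M (α 0 - 1) s) := by
  have hμ : 0 ≤ powerMajorant M (α 0 - 1) (s + x + l) - powerMajorant M (α 0 - 1) s :=
    sub_nonneg.2 (monotone_powerMajorant M (by linarith) (by linarith))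
  refine L2.norm_le_of_forall_testFunction hΩ (by positivity) fun φ hφ => ?_
  rw [inner_add_right, inner_sub_right, inner_sub_right,
    hφ.inner_dirichletLaplacian (hu.mem_HCheckTwo _ ⟨by linarith, by linarith⟩),
    hφ.inner_dirichletLaplacian (hu.mem_HCheckTwo _ ⟨by linarith, by linarith⟩),
    hφ.inner_dirichletLaplacian (hu.mem_HCheckTwo _ ⟨by linarith, by linarith⟩),
    hφ.inner_dirichletLaplacian (hu.mem_HCheckTwo _ ⟨by linarith, by linarith⟩)]
  have h1 := (hu.isSecondPrimitive_inner_laplacian (by linarith) hα hreg hφ).norm_second_diff_le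
    hs hx hl hT
  rw [mul_comm _ ‖hφ.memLp.toLp‖]
  exact h1

/-- The value of the averaged rule on the `j`-th interval: `φ^1` on the first one, and the mean of
the values at the end points on the others. -/
noncomputable def startValue (v : ℕ → L2 Ω) (j : ℕ) : L2 Ω := if j = 1 then v 1 else midValue v j

theorem IsModelSolution.gridApprox {T κ M : ℝ} {α : ℝ → ℝ}
    {f : ℝ → L2 Ω} {u₀ v₀ : L2 Ω} {u ut utt : ℝ → L2 Ω}
    (hu : IsModelSolution T κ α f u₀ v₀ u ut utt) (hα : 1 < α 0)
    (hreg : ∀ᵐ t ∂(volume.restrict (Ioc 0 T)), utt t ∈ HCheckTwo Ω ∧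
      ‖utt t‖ ≤ M * t ^ (α 0 - 2) ∧ ‖dirichletLaplacian Ω (utt t)‖ ≤ M * t ^ (α 0 - 2))
    {τ : ℝ} (hτ : 0 < τ) {N : ℕ} (hN : 1 ≤ N) (hT : N * τ = T) :
    GridApprox T (‖v₀‖ + powerMajorant M (α 0 - 1) T) (powerMajorant M (α 0 - 1)) u τ N
      (midValue fun j => u (j * τ)) where
  step_pos := hτ
  steps := hT
  mono := monotone_powerMajorant M (by linarith)
  lipschitz s hs t ht := by
    have := (hu.isSecondPrimitive hα hreg).norm_sub_le hs ht
    rwa [one_mul] at this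
  second_diff s x l hs hx hl h := by
    have := (hu.isSecondPrimitive hα hreg).norm_second_diff_le hs hx hl h
    rwa [one_mul] at this
  first s hs := by
    have hN' : (1 : ℝ) ≤ N := by exact_mod_cast hN
    have hτT : τ ≤ T := by rw [← hT]; exact le_mul_of_one_le_left hτ.le hN'
    have h1 := (hu.isSecondPrimitive hα hreg).norm_sub_le (s := τ) (t := s) ⟨hτ.le, hτT⟩
      ⟨hs.1, hs.2.trans hτT⟩
    have h2 := (hu.isSecondPrimitive hα hreg).norm_sub_le (s := 0) (t := s)
      ⟨le_rfl, hτ.le.trans hτT⟩ ⟨hs.1, hs.2.trans hτT⟩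
    rw [one_mul, abs_of_nonneg (by linarith [hs.2])] at h1
    rw [one_mul, abs_of_nonpos (by linarith [hs.1])] at h2
    have e : midValue (fun j : ℕ => u (j * τ)) 1 - u s
        = (1 / 2 : ℝ) • ((u τ - u s) + (u 0 - u s)) := by
      simp only [midValue, Nat.cast_one, one_mul, le_refl, tsub_eq_zero_of_le, Nat.cast_zero, zero_mul]
      module
    have hn : ‖(1 / 2 : ℝ)‖ = 1 / 2 := by norm_num
    have h3 := norm_add_le (u τ - u s) (u 0 - u s)
    have hC : 0 ≤ (‖v₀‖ + powerMajorant M (α 0 - 1) T) * τ := by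
      have : 0 ≤ powerMajorant M (α 0 - 1) T :=
        powerMajorant_nonneg M (by linarith) T
      positivity
    rw [e, norm_smul, hn]
    linarith
  mean j hj hjN := by
    simp only [midValue]
    push_cast [show 1 ≤ j by omega]
    rfl

theorem IsModelSolution.gridApprox_laplacian {T κ M : ℝ} {α : ℝ → ℝ}
    {f : ℝ → L2 Ω} {u₀ v₀ : L2 Ω} {u ut utt : ℝ → L2 Ω} (hΩ : IsOpen Ω) (hv₀ : v₀ ∈ HCheckTwo Ω)
    (hu : IsModelSolution T κ α f u₀ v₀ u ut utt) (hα : 1 < α 0)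
    (hreg : ∀ᵐ t ∂(volume.restrict (Ioc 0 T)), utt t ∈ HCheckTwo Ω ∧
      ‖utt t‖ ≤ M * t ^ (α 0 - 2) ∧ ‖dirichletLaplacian Ω (utt t)‖ ≤ M * t ^ (α 0 - 2))
    {τ : ℝ} (hτ : 0 < τ) {N : ℕ} (hN : 1 ≤ N) (hT : N * τ = T) :
    GridApprox T (‖dirichletLaplacian Ω v₀‖ + powerMajorant M (α 0 - 1) T)
      (powerMajorant M (α 0 - 1)) (fun t => dirichletLaplacian Ω (u t)) τ N
      (startValue fun j => dirichletLaplacian Ω (u (j * τ))) where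
  step_pos := hτ
  steps := hT
  mono := monotone_powerMajorant M (by linarith)
  lipschitz s hs t ht := hu.norm_laplacian_sub_le hΩ hv₀ hα hreg hs ht
  second_diff s x l hs hx hl h := hu.norm_laplacian_second_diff_le hΩ hα hreg hs hx hl h
  first s hs := by
    have hN' : (1 : ℝ) ≤ N := by exact_mod_cast hN
    have hτT : τ ≤ T := by rw [← hT]; exact le_mul_of_one_le_left hτ.le hN'
    have h1 := hu.norm_laplacian_sub_le hΩ hv₀ hα hreg (s := τ) (t := s) ⟨hτ.le, hτT⟩
      ⟨hs.1, hs.2.trans hτT⟩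
    rw [startValue, if_pos rfl, Nat.cast_one, one_mul]
    refine h1.trans (mul_le_mul_of_nonneg_left ?_ ?_)
    · rw [abs_of_nonneg (by linarith [hs.2])]
      linarith [hs.1]
    · have : 0 ≤ powerMajorant M (α 0 - 1) T :=
        powerMajorant_nonneg M (by linarith) T
      positivity
  mean j hj hjN := by
    rw [startValue, if_neg (by omega)]
    simp only [midValue]
    push_cast [show 1 ≤ j by omega]
    rfl

end Regularity

/-! ### Stability -/

/-- The geometric sequence `A (1 + x)^m` solves the recursion with equality, so it dominates by
strong induction, whatever the sign of `A`. -/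
theorem discrete_gronwall_of_le_sum {b : ℕ → ℝ} {A x : ℝ} {N : ℕ} (hx : 0 ≤ x)
    (h : ∀ m ≤ N, b m ≤ A + x * ∑ j ∈ Finset.range m, b j) {m : ℕ} (hm : m ≤ N) :
    b m ≤ A * (1 + x) ^ m := by
  have hgeom : ∀ m : ℕ, A + x * ∑ j ∈ Finset.range m, A * (1 + x) ^ j = A * (1 + x) ^ m := by
    intro m
    induction m with
    | zero => simp
    | succ m ih =>
      rw [Finset.sum_range_succ, mul_add, ← add_assoc, ih]
      ring
  induction m using Nat.strong_induction_on with
  | _ m ih =>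
    refine (h m hm).trans ?_
    rw [← hgeom m]
    have := Finset.sum_le_sum fun j (hj : j ∈ Finset.range m) =>
      ih j (Finset.mem_range.1 hj) ((Finset.mem_range.1 hj).le.trans hm)
    have := mul_le_mul_of_nonneg_left this hx
    linarith

section Stability

variable {H : Type*} [NormedAddCommGroup H] [InnerProductSpace ℝ H]

/-- The test element in the energy argument. -/
noncomputable def energyTest (e : ℕ → H) (n : ℕ) : H :=
  if n = 1 then e 1 else (1 / 2 : ℝ) • (e n + e (n - 1))

/-- From the second step on, the pairing is exactly `(‖e n‖² - ‖e (n - 1)‖²) / 2` and telescopes;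
the first step, with `e 0 = 0`, gives `‖e 1‖²`, twice what is needed. -/
theorem half_norm_sq_le_sum_inner {e : ℕ → H} (h0 : e 0 = 0) (m : ℕ) :
    1 / 2 * ‖e m‖ ^ 2 ≤ ∑ n ∈ Finset.Icc 1 m, inner ℝ (e n - e (n - 1)) (energyTest e n) := by
  induction m with
  | zero => simp [h0]
  | succ m ih =>
    rw [Finset.sum_Icc_succ_top (by omega)]
    have hself : ∀ x : H, inner ℝ x x = ‖x‖ ^ 2 := fun x => real_inner_self_eq_norm_sq x
    rcases Nat.eq_zero_or_pos m with rfl | hm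
    · simp only [energyTest, zero_add, if_true, Nat.sub_self, h0, sub_zero, hself]
      simp
      nlinarith [sq_nonneg ‖e 1‖]
    · rw [energyTest, if_neg (by omega), Nat.add_sub_cancel, real_inner_smul_right, inner_sub_left,
        inner_add_right, inner_add_right, hself, hself, real_inner_comm (e m) (e (m + 1))]
      linarith

/-- Pairing with the test elements and summing, the term in `z` is dropped by its sign and the term
in `W` is a perturbation of size `C τ²` per entry, fit for Grönwall's lemma. -/
theorem energy_stability {N : ℕ} {τ T C : ℝ} (hτ : 0 < τ) (hN : N * τ = T) (hC : 0 ≤ C)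
    (hsmall : 4 * C * T * τ ≤ 1) {e z ρ : ℕ → H} {W : ℕ → ℕ → ℝ} (h0 : e 0 = 0)
    (hW : ∀ n ∈ Finset.Icc 1 N, ∀ j ∈ Finset.Icc 1 n, |W n j| ≤ C * τ ^ 2)
    (heq : ∀ n ∈ Finset.Icc 1 N, e n - e (n - 1)
      + ∑ j ∈ Finset.Icc 1 n, W n j • ((1 / 2 : ℝ) • (e j + e (j - 1))) + z n = ρ n)
    (hpos : ∀ m ≤ N, 0 ≤ ∑ n ∈ Finset.Icc 1 m, inner ℝ (z n) (energyTest e n))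
    {m : ℕ} (hm : m ≤ N) :
    ‖e m‖ ≤ 4 * (∑ n ∈ Finset.Icc 1 N, ‖ρ n‖) * Real.exp (4 * C * T ^ 2) := by
  set R := ∑ n ∈ Finset.Icc 1 N, ‖ρ n‖ with hR
  have hR0 : 0 ≤ R := Finset.sum_nonneg fun _ _ => norm_nonneg _
  have hT : 0 ≤ T := by rw [← hN]; positivity
  -- The running maximum of the norms: at an index where it is attained, the quadratic inequality
  -- can be divided by it.
  let b : ℕ → ℝ := fun m => (Finset.range (m + 1)).sup' ⟨0, by simp⟩ fun j => ‖e j‖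
  have hb_le : ∀ j m, j ≤ m → ‖e j‖ ≤ b m := fun j m hjm =>
    Finset.le_sup' (fun j => ‖e j‖) (Finset.mem_range.2 (by omega))
  have hb0 : ∀ m, 0 ≤ b m := fun m => (norm_nonneg _).trans (hb_le 0 m (Nat.zero_le m))
  have hmid : ∀ j m, j ≤ m → ‖(1 / 2 : ℝ) • (e j + e (j - 1))‖ ≤ b m := by
    intro j m hjm
    have hn : ‖(1 / 2 : ℝ)‖ = 1 / 2 := by norm_num
    rw [norm_smul, hn]
    have := norm_add_le (e j) (e (j - 1))
    linarith [hb_le j m hjm, hb_le (j - 1) m (by omega)]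
  have htest : ∀ n m, 1 ≤ n → n ≤ m → ‖energyTest e n‖ ≤ b m := by
    intro n m hn hnm
    unfold energyTest
    split_ifs with h1
    · exact hb_le 1 m (by omega)
    · exact hmid n m hnm
  have key : ∀ m ≤ N, b m ≤ 2 * R + 2 * (C * T * τ) * ∑ j ∈ Finset.range (m + 1), b j := by
    intro m hm
    obtain ⟨l, hl, hbl⟩ := Finset.exists_mem_eq_sup' (s := Finset.range (m + 1)) ⟨0, by simp⟩
      fun j => ‖e j‖
    have hl := Finset.mem_range.1 hl
    have hbl : b m = ‖e l‖ := hbl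
    set S := ∑ j ∈ Finset.range (m + 1), b j
    have hS0 : 0 ≤ S := Finset.sum_nonneg fun j _ => hb0 j
    have h1 := half_norm_sq_le_sum_inner h0 l
    have h2 : ∑ n ∈ Finset.Icc 1 l, inner ℝ (e n - e (n - 1)) (energyTest e n)
        = ∑ n ∈ Finset.Icc 1 l, inner ℝ (ρ n
          - ∑ j ∈ Finset.Icc 1 n, W n j • ((1 / 2 : ℝ) • (e j + e (j - 1)))) (energyTest e n)
          - ∑ n ∈ Finset.Icc 1 l, inner ℝ (z n) (energyTest e n) := by
      rw [← Finset.sum_sub_distrib]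
      refine Finset.sum_congr rfl fun n hn => ?_
      have hn := Finset.mem_Icc.1 hn
      rw [← inner_sub_left, ← heq n (Finset.mem_Icc.2 ⟨hn.1, by omega⟩)]
      congr 1
      abel
    have h3 : ∑ n ∈ Finset.Icc 1 l, inner ℝ (ρ n
          - ∑ j ∈ Finset.Icc 1 n, W n j • ((1 / 2 : ℝ) • (e j + e (j - 1)))) (energyTest e n)
        ≤ ∑ n ∈ Finset.Icc 1 l, (‖ρ n‖ + C * τ ^ 2 * S) * b m := by
      refine Finset.sum_le_sum fun n hn => ?_
      have hn := Finset.mem_Icc.1 hn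
      refine (real_inner_le_norm _ _).trans ?_
      refine mul_le_mul ((norm_sub_le _ _).trans (add_le_add le_rfl ?_))
        (htest n m hn.1 (by omega)) (norm_nonneg _) (by positivity)
      refine (norm_sum_le _ _).trans ?_
      have h4 : ∑ j ∈ Finset.Icc 1 n, b j ≤ S :=
        Finset.sum_le_sum_of_subset_of_nonneg (fun j hj => by
          have := Finset.mem_Icc.1 hj
          exact Finset.mem_range.2 (by omega)) fun j _ _ => hb0 j
      refine le_trans ?_ (mul_le_mul_of_nonneg_left h4 (by positivity))
      rw [Finset.mul_sum]
      refine Finset.sum_le_sum fun j hj => ?_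
      rw [norm_smul]
      exact mul_le_mul (hW n (Finset.mem_Icc.2 ⟨hn.1, by omega⟩) j hj) (hmid j j le_rfl)
        (norm_nonneg _) (by positivity)
    have h5 : ∑ n ∈ Finset.Icc 1 l, (‖ρ n‖ + C * τ ^ 2 * S) * b m ≤ (R + C * T * τ * S) * b m := by
      rw [← Finset.sum_mul, Finset.sum_add_distrib, Finset.sum_const, Nat.card_Icc,
        Nat.add_sub_cancel, nsmul_eq_mul]
      refine mul_le_mul_of_nonneg_right (add_le_add ?_ ?_) (hb0 m)
      · exact Finset.sum_le_sum_of_subset_of_nonneg (Finset.Icc_subset_Icc_right (by omega))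
          fun _ _ _ => norm_nonneg _
      · have hlN : (l : ℝ) ≤ N := by exact_mod_cast (show l ≤ N by omega)
        rw [← hN]
        have : (l : ℝ) * (C * τ ^ 2 * S) ≤ N * (C * τ ^ 2 * S) :=
          mul_le_mul_of_nonneg_right hlN (by positivity)
        linarith [show C * (N * τ) * τ * S = N * (C * τ ^ 2 * S) by ring]
    have h6 := hpos l (by omega)
    rw [← hbl] at h1
    have h7 : 1 / 2 * b m * b m ≤ (R + C * T * τ * S) * b m := by
      rw [show 1 / 2 * b m * b m = 1 / 2 * b m ^ 2 by ring]
      linarith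
    rcases (hb0 m).eq_or_lt with hz | hp
    · rw [← hz]
      positivity
    · have := le_of_mul_le_mul_right h7 hp
      linarith
  -- The implicit last term of the sum is absorbed on the left; here `4 C T τ ≤ 1` is used.
  have key2 : ∀ m ≤ N, b m ≤ 4 * R + 4 * (C * T * τ) * ∑ j ∈ Finset.range m, b j := by
    intro m hm
    have h1 := key m hm
    rw [Finset.sum_range_succ] at h1
    have h2 : 2 * (C * T * τ) * b m ≤ 1 / 2 * b m :=
      mul_le_mul_of_nonneg_right (by linarith) (hb0 m)
    linarith
  have h1 := discrete_gronwall_of_le_sum (by positivity) key2 hm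
  refine (hb_le m m le_rfl).trans (h1.trans (mul_le_mul_of_nonneg_left ?_ (by positivity)))
  have hmN : (m : ℝ) ≤ N := by exact_mod_cast hm
  calc (1 + 4 * (C * T * τ)) ^ m ≤ Real.exp (4 * (C * T * τ)) ^ m := by
        refine pow_le_pow_left₀ (by positivity) ?_ m
        linarith [Real.add_one_le_exp (4 * (C * T * τ))]
    _ = Real.exp (m * (4 * (C * T * τ))) := (Real.exp_nat_mul _ _).symm
    _ ≤ Real.exp (4 * C * T ^ 2) := by
        refine Real.exp_le_exp.2 ?_
        have : (m : ℝ) * (4 * (C * T * τ)) ≤ N * (4 * (C * T * τ)) :=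
          mul_le_mul_of_nonneg_right hmN (by positivity)
        have e : (N : ℝ) * (4 * (C * T * τ)) = 4 * C * T * (N * τ) := by ring
        rw [e, hN] at this
        linarith [show 4 * C * T * T = 4 * C * T ^ 2 by ring]

end Stability

/-! ### The averaged equation -/

section Averaged

variable {E : Type*} [NormedAddCommGroup E] [NormedSpace ℝ E] [CompleteSpace E]
  {k : ℝ → ℝ} {T τ : ℝ} {N : ℕ}

/-- The points `min t (i τ)` partition `[0, t]` into the full earlier cells and the last one cut at
`t`; the step function is constant on each piece. -/
theorem volterraConv_step (hk : IntegrableOn k (Ioc 0 T)) (hτ : 0 < τ) (hN : N * τ = T)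
    (y : ℕ → E) {n : ℕ} (hnN : n ≤ N) {t : ℝ} (ht : t ∈ Ioc (((n : ℝ) - 1) * τ) (n * τ))
    (ht0 : 0 ≤ t) :
    volterraConv k (fun s => y ⌈s / τ⌉₊) t = ∑ j ∈ Finset.Icc 1 n,
      (∫ s in (((j : ℝ) - 1) * τ)..(min t (j * τ)), k (t - s)) • y j := by
  have hnN' : (n : ℝ) ≤ N := by exact_mod_cast hnN
  have htT : t ≤ T := by rw [← hN]; exact ht.2.trans (mul_le_mul_of_nonneg_right hnN' hτ.le)
  have hki : IntervalIntegrable (fun s => k (t - s)) volume 0 t := by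
    have := (intervalIntegrable_of_Ioc_subset hk ⟨le_rfl, ht0.trans htT⟩ ⟨ht0, htT⟩).comp_sub_left t
    simpa using this.symm
  have hmin : ∀ i < n, min t ((i : ℝ) * τ) = i * τ := by
    intro i hi
    have hi' : (i : ℝ) ≤ (n : ℝ) - 1 := by
      have : (i : ℝ) + 1 ≤ n := by exact_mod_cast hi
      linarith
    exact min_eq_right ((mul_le_mul_of_nonneg_right hi' hτ.le).trans ht.1.le)
  have hcell : ∀ i < n, ∀ s ∈ uIoc (min t ((i : ℝ) * τ)) (min t (((i + 1 : ℕ) : ℝ) * τ)),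
      ⌈s / τ⌉₊ = i + 1 := by
    intro i hi s hs
    rw [uIoc_of_le (min_le_min_left t (mul_le_mul_of_nonneg_right (by simp) hτ.le)), hmin i hi] at hs
    refine ceil_div_eq hτ (by omega) ⟨?_, hs.2.trans (min_le_right _ _)⟩
    push_cast
    rw [add_sub_cancel_right]
    exact hs.1
  have hsub : ∀ i < n, IntervalIntegrable (fun s => k (t - s)) volume (min t ((i : ℝ) * τ))
      (min t (((i + 1 : ℕ) : ℝ) * τ)) := by
    intro i hi
    refine hki.mono_set ?_
    rw [uIcc_of_le ht0,
      uIcc_of_le (min_le_min_left t (mul_le_mul_of_nonneg_right (by simp) hτ.le))]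
    exact Icc_subset_Icc (le_min ht0 (by positivity)) (min_le_left _ _)
  have h1 := intervalIntegral.sum_integral_adjacent_intervals (μ := volume)
    (f := fun s => k (t - s) • y ⌈s / τ⌉₊) (a := fun i : ℕ => min t ((i : ℝ) * τ)) (n := n)
    fun i hi => by
      have hi' : IntervalIntegrable (fun s => k (t - s) • y (i + 1)) volume (min t ((i : ℝ) * τ))
          (min t (((i + 1 : ℕ) : ℝ) * τ)) :=
        ⟨(hsub i hi).1.smul_const _, (hsub i hi).2.smul_const _⟩
      refine hi'.congr fun s hs => ?_
      rw [hcell i hi s hs]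
  simp only [Nat.cast_zero, zero_mul, min_eq_right ht0, min_eq_left ht.2] at h1
  rw [volterraConv, ← h1, sum_Icc_one_eq_sum_range]
  refine Finset.sum_congr rfl fun i hi => ?_
  have hi := Finset.mem_range.1 hi
  rw [← intervalIntegral.integral_smul_const,
    show (((i + 1 : ℕ) : ℝ) - 1) * τ = min t ((i : ℝ) * τ) by rw [hmin i hi]; push_cast; ring]
  refine intervalIntegral.integral_congr_ae (Filter.Eventually.of_forall fun s hs => ?_)
  rw [hcell i hi s hs]

theorem integral_volterraConv_step (hk : IntegrableOn k (Ioc 0 T)) (hτ : 0 < τ) (hN : N * τ = T)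
    (y : ℕ → E) {n : ℕ} (hn : 1 ≤ n) (hnN : n ≤ N) :
    ∫ t in (((n : ℝ) - 1) * τ)..(n * τ), volterraConv k (fun s => y ⌈s / τ⌉₊) t
      = ∑ j ∈ Finset.Icc 1 n, cellWeight k τ n j • y j := by
  have hnN' : (n : ℝ) ≤ N := by exact_mod_cast hnN
  have hn' : (1 : ℝ) ≤ n := by exact_mod_cast hn
  have hnT : (n : ℝ) * τ ≤ T := by rw [← hN]; exact mul_le_mul_of_nonneg_right hnN' hτ.le
  have hn0 : 0 ≤ ((n : ℝ) - 1) * τ := mul_nonneg (by linarith) hτ.le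
  have hle : ((n : ℝ) - 1) * τ ≤ n * τ := by nlinarith
  have h1 : ∫ t in (((n : ℝ) - 1) * τ)..(n * τ), volterraConv k (fun s => y ⌈s / τ⌉₊) t
      = ∫ t in (((n : ℝ) - 1) * τ)..(n * τ), ∑ j ∈ Finset.Icc 1 n,
        (∫ s in (((j : ℝ) - 1) * τ)..(min t (j * τ)), k (t - s)) • y j := by
    refine intervalIntegral.integral_congr_ae (Filter.Eventually.of_forall fun t ht => ?_)
    rw [uIoc_of_le hle] at ht
    exact volterraConv_step hk hτ hN y hnN ht (hn0.trans ht.1.le)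
  rw [h1, intervalIntegral.integral_finsetSum]
  · refine Finset.sum_congr rfl fun j _ => ?_
    rw [intervalIntegral.integral_smul_const]
    rfl
  · intro j hj
    have hj := Finset.mem_Icc.1 hj
    have hj1 : (1 : ℝ) ≤ j := by exact_mod_cast hj.1
    have hjn : (j : ℝ) ≤ n := by exact_mod_cast hj.2
    have hj0 : 0 ≤ ((j : ℝ) - 1) * τ := mul_nonneg (by linarith) hτ.le
    have hjn2 : ((j : ℝ) - 1) * τ ≤ ((n : ℝ) - 1) * τ :=
      mul_le_mul_of_nonneg_right (by linarith) hτ.le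
    have hcp := continuousOn_prim (hn0.trans (hle.trans hnT)) hk
    have hmem : ∀ t ∈ Icc (((n : ℝ) - 1) * τ) (n * τ), t - ((j : ℝ) - 1) * τ ∈ Icc 0 T ∧
        t - min t (j * τ) ∈ Icc 0 T := fun t ht => by
      have hm0 : 0 ≤ min t (j * τ) := le_min (hn0.trans ht.1) (by positivity)
      exact ⟨⟨by linarith [ht.1], by linarith [ht.2]⟩,
        ⟨sub_nonneg.2 (min_le_left _ _), by linarith [ht.2]⟩⟩
    have hc : ContinuousOn (fun t => (prim k (t - ((j : ℝ) - 1) * τ) - prim k (t - min t (j * τ))) • y j)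
        (Icc (((n : ℝ) - 1) * τ) (n * τ)) := by
      refine ((hcp.comp (Continuous.continuousOn (by fun_prop)) fun t ht => (hmem t ht).1).sub
        (hcp.comp (Continuous.continuousOn (by fun_prop)) fun t ht => (hmem t ht).2)).smul
        continuousOn_const
    rw [← uIcc_of_le hle] at hc
    refine hc.intervalIntegrable.congr fun t ht => ?_
    rw [uIoc_of_le hle] at ht
    have hm := hmem t (Ioc_subset_Icc_self ht)
    rw [integral_sub_left_eq_prim hk hm.1 hm.2]

/-- The rule is exact for the step function with values `y`, so by linearity its error is the
convolution of the kernel with `gridError`. -/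
theorem GridApprox.sum_cellWeight_sub {C : ℝ} {μ : ℝ → ℝ} {Y : ℝ → E} {y : ℕ → E}
    (h : GridApprox T C μ Y τ N y) (hk : IntegrableOn k (Ioc 0 T)) {n : ℕ} (hn : 1 ≤ n)
    (hnN : n ≤ N) :
    ∑ j ∈ Finset.Icc 1 n, cellWeight k τ n j • y j
        - ∫ t in (((n : ℝ) - 1) * τ)..(n * τ), volterraConv k Y t
      = ∫ t in (((n : ℝ) - 1) * τ)..(n * τ), volterraConv k (gridError Y τ y) t := by
  have hnN' : (n : ℝ) ≤ N := by exact_mod_cast hnN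
  have hn' : (1 : ℝ) ≤ n := by exact_mod_cast hn
  have hτ := h.step_pos
  have ha := h.grid_mem (j := (n : ℝ) - 1) (by linarith) (by linarith)
  have hb := h.grid_mem (j := (n : ℝ)) (by linarith) hnN'
  have hT : 0 ≤ T := ha.1.trans ha.2
  obtain ⟨B, hB⟩ := isCompact_Icc.exists_bound_of_continuousOn h.continuousOn
  have hYi : IntegrableOn Y (Ioc 0 T) :=
    h.continuousOn.integrableOn_Icc.mono_set Ioc_subset_Icc_self
  rw [← integral_volterraConv_step hk hτ h.steps y hn hnN, sub_eq_iff_eq_add,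
    ← intervalIntegral.integral_add
      (intervalIntegrable_of_Ioc_subset (integrableOn_volterraConv hk h.integrableOn_gridError) ha hb)
      (intervalIntegrable_of_Ioc_subset (integrableOn_volterraConv hk hYi) ha hb)]
  refine intervalIntegral.integral_congr fun t ht => ?_
  rw [uIcc_of_le (by nlinarith)] at ht
  have ht' : t ∈ Icc 0 T := ⟨ha.1.trans ht.1, ht.2.trans hb.2⟩
  simp only [volterraConv]
  rw [← intervalIntegral.integral_add
    (intervalIntegrable_volterra_integrand hk h.aestronglyMeasurable_gridError
      (fun s hs => h.norm_gridError_le hs) ht')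
    (intervalIntegrable_volterra_integrand hk hYi.aestronglyMeasurable
      (fun s hs => hB s (Ioc_subset_Icc_self hs)) ht')]
  refine intervalIntegral.integral_congr fun s _ => ?_
  simp only [gridError]
  rw [← smul_add, sub_add_cancel]

end Averaged

/-! ### The averaged model and the scheme in terms of cell weights -/

section Model

variable {d : ℕ} {Ω : Set (EuclideanSpace ℝ (Fin d))}

/-- What is used of the generalized identity function `g`: its second derivative `k` is bounded,
`g'(0) = 0` and `g(0) = 1`. -/
structure IsGenIdentityKernel (T C : ℝ) (α k : ℝ → ℝ) : Prop where
  bound : ∀ x, |k x| ≤ C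
  integrable : IntegrableOn k (Ioc 0 T)
  continuousOn : ContinuousOn k (Ioo 0 T)
  hasDerivAt : ∀ x ∈ Ioo 0 T, HasDerivAt (genIdentity α) (prim k x) x
  eq : ∀ x ∈ Icc 0 T, genIdentity α x = 1 + prim (prim k) x
  nonneg : ∀ x ∈ Icc 0 T, 0 ≤ genIdentity α x

variable {T κ C : ℝ} {α k : ℝ → ℝ} {f : ℝ → L2 Ω} {u₀ v₀ : L2 Ω} {u ut utt : ℝ → L2 Ω}

theorem IsGenIdentityKernel.hasDerivAt_prim (hk : IsGenIdentityKernel T C α k) {x : ℝ}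
    (hx : x ∈ Ioo 0 T) : HasDerivAt (prim k) (k x) x :=
  intervalIntegral.integral_hasDerivAt_right
    (intervalIntegrable_of_Ioc_subset hk.integrable ⟨le_rfl, hx.1.le.trans hx.2.le⟩
      (Ioo_subset_Icc_self hx))
    (hk.continuousOn.stronglyMeasurableAtFilter isOpen_Ioo x hx)
    (hk.continuousOn.continuousAt (Ioo_mem_nhds hx.1 hx.2))

theorem IsModelSolution.continuousOn_ut (hT : 0 ≤ T) (hu : IsModelSolution T κ α f u₀ v₀ u ut utt) :
    ContinuousOn ut (Icc 0 T) := continuousOn_of_eq_primitive hT hu.integrable_utt hu.ut_eq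

theorem IsModelSolution.integrableOn_ut (hT : 0 ≤ T) (hu : IsModelSolution T κ α f u₀ v₀ u ut utt) :
    IntegrableOn ut (Ioc 0 T) :=
  (hu.continuousOn_ut hT).integrableOn_Icc.mono_set Ioc_subset_Icc_self

theorem IsModelSolution.continuousOn_u (hT : 0 ≤ T) (hu : IsModelSolution T κ α f u₀ v₀ u ut utt) :
    ContinuousOn u (Icc 0 T) := continuousOn_of_eq_primitive hT (hu.integrableOn_ut hT) hu.u_eq

theorem IsModelSolution.hasDerivAt_u (hu : IsModelSolution T κ α f u₀ v₀ u ut utt) {s : ℝ}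
    (hs : s ∈ Ioo 0 T) : HasDerivAt u (ut s) s := by
  have hT : 0 ≤ T := hs.1.le.trans hs.2.le
  have hc : ContinuousOn ut (Ioo 0 T) := (hu.continuousOn_ut hT).mono Ioo_subset_Icc_self
  have h1 := intervalIntegral.integral_hasDerivAt_right
    (intervalIntegrable_of_Ioc_subset (hu.integrableOn_ut hT) ⟨le_rfl, hT⟩ (Ioo_subset_Icc_self hs))
    (hc.stronglyMeasurableAtFilter isOpen_Ioo s hs) (hc.continuousAt (Ioo_mem_nhds hs.1 hs.2))
  refine (h1.const_add u₀).congr_of_eventuallyEq ?_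
  filter_upwards [Ioo_mem_nhds hs.1 hs.2] with x hx using hu.u_eq x (Ioo_subset_Icc_self hx)

theorem IsModelSolution.u_zero (hT : 0 ≤ T) (hu : IsModelSolution T κ α f u₀ v₀ u ut utt) :
    u 0 = u₀ := by
  rw [hu.u_eq 0 ⟨le_rfl, hT⟩]; simp

/-- Integration by parts in the convolution with `g'`. -/
theorem IsModelSolution.integral_deriv_genIdentity (hk : IsGenIdentityKernel T C α k)
    (hu : IsModelSolution T κ α f u₀ v₀ u ut utt) {t : ℝ} (ht : t ∈ Icc 0 T) :
    ∫ s in (0 : ℝ)..t, deriv (genIdentity α) (t - s) • ut s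
      = volterraConv k u t - prim k t • u₀ := by
  have hT : 0 ≤ T := ht.1.trans ht.2
  have hcu := hu.continuousOn_u hT
  have hcp := continuousOn_prim hT hk.integrable
  have hcp' : ContinuousOn (fun s => prim k (t - s)) (Icc 0 t) :=
    hcp.comp (continuousOn_const.sub continuousOn_id) fun s hs =>
      ⟨sub_nonneg.2 hs.2, by change t - s ≤ T; linarith [hs.1, ht.2]⟩
  have hsub : Icc 0 t ⊆ Icc 0 T := Icc_subset_Icc_right ht.2
  obtain ⟨B, hB⟩ := isCompact_Icc.exists_bound_of_continuousOn hcu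
  have i1 : IntervalIntegrable (fun s => prim k (t - s) • ut s) volume 0 t := by
    refine ContinuousOn.intervalIntegrable ?_
    rw [uIcc_of_le ht.1]
    exact hcp'.smul ((hu.continuousOn_ut hT).mono hsub)
  have i2 : IntervalIntegrable (fun s => k (t - s) • u s) volume 0 t :=
    intervalIntegrable_volterra_integrand hk.integrable
      ((hcu.mono Ioc_subset_Icc_self).aestronglyMeasurable measurableSet_Ioc)
      (fun s hs => hB s (Ioc_subset_Icc_self hs)) ht
  have e1 : ∫ s in (0 : ℝ)..t, deriv (genIdentity α) (t - s) • ut s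
      = ∫ s in (0 : ℝ)..t, prim k (t - s) • ut s := by
    refine intervalIntegral.integral_congr_ae ?_
    have hne : ∀ᵐ r : ℝ, r ≠ t := by simp [ae_iff, measure_singleton]
    filter_upwards [hne] with s hst hs
    rw [uIoc_of_le ht.1] at hs
    rw [(hk.hasDerivAt (t - s) ⟨sub_pos.2 (lt_of_le_of_ne hs.2 hst),
      by linarith [hs.1, ht.2]⟩).deriv]
  have e2 := intervalIntegral.integral_eq_sub_of_hasDerivAt_of_le ht.1
    (f := fun s => prim k (t - s) • u s)
    (f' := fun s => prim k (t - s) • ut s - k (t - s) • u s)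
    (hcp'.smul (hcu.mono hsub)) (fun s hs => by
      have h1 := (hk.hasDerivAt_prim (x := t - s)
        ⟨sub_pos.2 hs.2, by linarith [hs.1, ht.2]⟩).comp_const_sub t s
      have h2 := hu.hasDerivAt_u (s := s) ⟨hs.1, hs.2.trans_le ht.2⟩
      refine (h1.smul h2).congr_deriv ?_
      module) (i1.sub i2)
  rw [intervalIntegral.integral_sub i1 i2] at e2
  simp only [sub_self, sub_zero] at e2
  -- The boundary term at `s = t` vanishes because `g'(0) = 0`; the one at `s = 0` leaves `g'(t)
  -- u₀`.
  rw [show prim k 0 = 0 by simp [prim], zero_smul, zero_sub, hu.u_zero hT] at e2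
  rw [e1, volterraConv, eq_sub_iff_add_eq, ← sub_eq_zero]
  rw [← sub_eq_zero] at e2
  rw [← e2]
  abel

theorem IsModelSolution.averaged_equation (hk : IsGenIdentityKernel T C α k) (hα : 1 < α 0)
    (hu : IsModelSolution T κ α f u₀ v₀ u ut utt)
    (hLu : ContinuousOn (fun t => dirichletLaplacian Ω (u t)) (Icc 0 T)) {a b : ℝ} (ha : 0 ≤ a)
    (hab : a ≤ b) (hb : b ≤ T) :
    ∫ t in a..b, modelRhs α f v₀ t = u b - u a + (∫ t in a..b, volterraConv k u t)
      - (prim (prim k) b - prim (prim k) a) • u₀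
      - κ • ∫ t in a..b, volterraConv (abelKernel (α 0 - 1)) (fun s => dirichletLaplacian Ω (u s)) t := by
  have ha' : a ∈ Icc 0 T := ⟨ha, hab.trans hb⟩
  have hb' : b ∈ Icc 0 T := ⟨ha.trans hab, hb⟩
  have hT : 0 ≤ T := ha'.1.trans ha'.2
  have hui : IntegrableOn u (Ioc 0 T) :=
    (hu.continuousOn_u hT).integrableOn_Icc.mono_set Ioc_subset_Icc_self
  have hLi : IntegrableOn (fun t => dirichletLaplacian Ω (u t)) (Ioc 0 T) :=
    hLu.integrableOn_Icc.mono_set Ioc_subset_Icc_self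
  have i1 := intervalIntegrable_of_Ioc_subset (hu.integrableOn_ut hT) ha' hb'
  have i2 := intervalIntegrable_of_Ioc_subset (integrableOn_volterraConv hk.integrable hui) ha' hb'
  have i3 := intervalIntegrable_of_Ioc_subset (integrableOn_volterraConv
    (integrableOn_abelKernel (μ := α 0 - 1) (by linarith) T) hLi) ha' hb'
  have i4 : IntervalIntegrable (prim k) volume a b := by
    refine ContinuousOn.intervalIntegrable ((continuousOn_prim hT hk.integrable).mono ?_)
    rw [uIcc_of_le hab]
    exact Icc_subset_Icc ha hb
  have i5 : IntervalIntegrable (fun t => prim k t • u₀) volume a b :=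
    ⟨i4.1.smul_const _, i4.2.smul_const _⟩
  have e : ∫ t in a..b, modelRhs α f v₀ t = ∫ t in a..b, (ut t + volterraConv k u t
      - prim k t • u₀
      - κ • volterraConv (abelKernel (α 0 - 1)) (fun s => dirichletLaplacian Ω (u s)) t) := by
    refine intervalIntegral.integral_congr_ae (Filter.Eventually.of_forall fun t ht => ?_)
    rw [uIoc_of_le hab] at ht
    have ht' : t ∈ Ioc 0 T := ⟨ha.trans_lt ht.1, ht.2.trans hb⟩
    rw [← hu.equation t ht', hu.integral_deriv_genIdentity hk (Ioc_subset_Icc_self ht')]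
    simp only [volterraConv]
    abel
  have e4 := integral_prim_sub hk.integrable (c := 0) (a := a) (b := b) (by simpa using ha')
    (by simpa using hb')
  simp only [sub_zero] at e4
  have i6 : IntervalIntegrable (fun t => κ •
      volterraConv (abelKernel (α 0 - 1)) (fun s => dirichletLaplacian Ω (u s)) t) volume a b :=
    i3.smul κ
  have i7 : IntervalIntegrable (fun t => ut t + volterraConv k u t) volume a b := i1.add i2
  have i8 : IntervalIntegrable (fun t => ut t + volterraConv k u t - prim k t • u₀) volume a b :=
    i7.sub i5
  rw [e, intervalIntegral.integral_sub i8 i6, intervalIntegral.integral_sub i7 i5,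
    intervalIntegral.integral_add i1 i2,
    intervalIntegral.integral_smul, intervalIntegral.integral_smul_const, e4,
    sub_eq_integral_of_eq_primitive (hu.integrableOn_ut hT) hu.u_eq ha' hb']

/-- The left-hand side of the scheme, multiplied by the step size. -/
noncomputable def schemeOperator (κ : ℝ) (α k : ℝ → ℝ) (τ : ℝ) (U : ℕ → L2 Ω) (n : ℕ) : L2 Ω :=
  U n - U (n - 1) + ∑ j ∈ Finset.Icc 1 n, cellWeight k τ n j • midValue U j
    - κ • ∑ j ∈ Finset.Icc 1 n, cellWeight (abelKernel (α 0 - 1)) τ n j •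
        startValue (fun j => dirichletLaplacian Ω (U j)) j

/-- The `w_k` are first differences of `g = 1 + prim (prim k)`, so the `w_k - w_{k-1}` are its
second differences, that is, the cell weights of `k`; the constant `1` drops out. The scheme thus
contains the integration by parts already. -/
theorem sum_convWeight_eq (hk : IsGenIdentityKernel T C α k) {τ : ℝ} (hτ : 0 < τ) {N : ℕ}
    (hN : N * τ = T) (v : ℕ → L2 Ω) {n : ℕ} (hn : 1 ≤ n) (hnN : n ≤ N) :
    convWeight α τ 0 • midValue v n
      - ∑ j ∈ Finset.Icc 1 (n - 1), (convWeight α τ (j - 1) - convWeight α τ j) • midValue v (n - j)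
      = ∑ j ∈ Finset.Icc 1 n, cellWeight k τ n j • midValue v j := by
  have hg : ∀ i : ℕ, i ≤ N → genIdentity α (i * τ) = 1 + prim (prim k) (i * τ) := fun i hi => by
    have hi' : (i : ℝ) ≤ N := by exact_mod_cast hi
    refine hk.eq _ ⟨by positivity, ?_⟩
    rw [← hN]
    exact mul_le_mul_of_nonneg_right hi' hτ.le
  obtain ⟨m, rfl⟩ : ∃ m, n = m + 1 := ⟨n - 1, by omega⟩
  rw [Finset.sum_Icc_succ_top (by omega), Nat.add_sub_cancel,
    cellWeight_self hk.integrable hτ hN hn hnN]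
  have h0 : convWeight α τ 0 = prim (prim k) τ := by
    have h1 := hg 1 (by omega)
    have h2 := hg 0 (by omega)
    simp only [Nat.cast_one, one_mul, Nat.cast_zero, zero_mul] at h1 h2
    simp only [convWeight, Nat.cast_zero, zero_add, one_mul, zero_mul]
    rw [h1, h2]
    simp [prim]
  have hsum : ∑ j ∈ Finset.Icc 1 m, cellWeight k τ (m + 1) j • midValue v j
      = ∑ j ∈ Finset.Icc 1 m, -((convWeight α τ (j - 1) - convWeight α τ j) • midValue v (m + 1 - j)) := by
    refine Finset.sum_nbij' (fun j => m + 1 - j) (fun j => m + 1 - j) ?_ ?_ ?_ ?_ ?_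
    · intro j hj
      have := Finset.mem_Icc.1 hj
      exact Finset.mem_Icc.2 (by omega)
    · intro j hj
      have := Finset.mem_Icc.1 hj
      exact Finset.mem_Icc.2 (by omega)
    · intro j hj
      have := Finset.mem_Icc.1 hj
      omega
    · intro j hj
      have := Finset.mem_Icc.1 hj
      omega
    · intro j hj
      have hj := Finset.mem_Icc.1 hj
      rw [cellWeight_of_lt hk.integrable hτ hN hj.1 (by omega) hnN,
        show m + 1 - (m + 1 - j) = j by omega, ← neg_smul]
      congr 1
      have h1 := hg (m + 1 - j) (by omega)
      have h2 := hg (m + 1 - j - 1) (by omega)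
      have h3 := hg (m + 1 - j + 1) (by omega)
      push_cast [show j ≤ m + 1 by omega, show 1 ≤ m + 1 - j by omega] at h1 h2 h3 ⊢
      simp only [convWeight]
      push_cast [show j ≤ m + 1 by omega, show 1 ≤ m + 1 - j by omega]
      rw [show (m : ℝ) + 1 - j - 1 + 1 = m + 1 - j by ring, h1, h2, h3]
      ring
  rw [hsum, h0, Finset.sum_neg_distrib]
  abel

/-- The term `w_{n-1} U⁰` moved to the right is the exact cell integral of `g'(t) u₀`, so it cancels
against the same term of the averaged model. -/
theorem IsSecondOrderScheme.schemeOperator_eq (hk : IsGenIdentityKernel T C α k) {τ : ℝ} (hτ : 0 < τ)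
    {N : ℕ} (hN : N * τ = T) {U : ℕ → L2 Ω} (hU : IsSecondOrderScheme κ α f u₀ v₀ τ N U) {n : ℕ}
    (hn : n ∈ Finset.Icc 1 N) :
    schemeOperator κ α k τ U n = (∫ t in (((n : ℝ) - 1) * τ)..(n * τ), modelRhs α f v₀ t)
      + (prim (prim k) (n * τ) - prim (prim k) (((n : ℝ) - 1) * τ)) • u₀ := by
  have hn' := Finset.mem_Icc.1 hn
  have h1 := hU.equation n hn
  have hw : convWeight α τ (n - 1) = prim (prim k) (n * τ) - prim (prim k) (((n : ℝ) - 1) * τ) := by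
    have hnN : (n : ℝ) ≤ N := by exact_mod_cast hn'.2
    have hn1 : (1 : ℝ) ≤ n := by exact_mod_cast hn'.1
    have hnT : (n : ℝ) * τ ≤ T := by rw [← hN]; exact mul_le_mul_of_nonneg_right hnN hτ.le
    rw [convWeight]
    push_cast [hn'.1]
    rw [sub_add_cancel, hk.eq _ ⟨by positivity, hnT⟩,
      hk.eq _ ⟨mul_nonneg (by linarith) hτ.le, by linarith⟩]
    ring
  have hpi : averagedPI (α 0 - 1) τ (fun j => dirichletLaplacian Ω (U j)) n
      = (1 / τ) • ∑ j ∈ Finset.Icc 1 n, cellWeight (abelKernel (α 0 - 1)) τ n j •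
        startValue (fun j => dirichletLaplacian Ω (U j)) j := by
    rw [← Finset.add_sum_Ioc_eq_sum_Icc hn'.1, smul_add, Finset.smul_sum, averagedPI, startValue,
      if_pos rfl, piWeight_eq, mul_smul]
    congr 1
    refine Finset.sum_congr (by ext j; simp [Nat.succ_le_iff]) fun j hj => ?_
    have hj := Finset.mem_Ioc.1 hj
    rw [startValue, if_neg (by omega), piWeight_eq, mul_smul]
  rw [hpi, sum_convWeight_eq hk hτ hN U hn'.1 hn'.2, hU.init, averagedRhs, hw] at h1
  have h2 := congrArg (fun x => τ • x) h1
  simp only [smul_add, smul_sub, smul_smul, mul_one_div_cancel hτ.ne', one_smul] at h2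
  rw [schemeOperator, ← h2]
  have e1 : τ * (κ * (1 / τ)) = κ := by field_simp
  have e2 : τ * (1 / τ * (prim (prim k) (n * τ) - prim (prim k) (((n : ℝ) - 1) * τ)))
      = prim (prim k) (n * τ) - prim (prim k) (((n : ℝ) - 1) * τ) := by field_simp
  rw [e1]
  rw [e2]
  abel

/-- The consistency error of the scheme. -/
noncomputable def consistencyError (κ : ℝ) (α k : ℝ → ℝ) (u : ℝ → L2 Ω) (τ : ℝ) (n : ℕ) : L2 Ω :=
  (∫ t in (((n : ℝ) - 1) * τ)..(n * τ),
      volterraConv k (gridError u τ (midValue fun j => u (j * τ))) t)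
    - κ • ∫ t in (((n : ℝ) - 1) * τ)..(n * τ), volterraConv (abelKernel (α 0 - 1))
      (gridError (fun t => dirichletLaplacian Ω (u t)) τ
        (startValue fun j => dirichletLaplacian Ω (u (j * τ)))) t

theorem IsModelSolution.schemeOperator_eq {M : ℝ} (hΩ : IsOpen Ω) (hv₀ : v₀ ∈ HCheckTwo Ω)
    (hk : IsGenIdentityKernel T C α k) (hα : 1 < α 0)
    (hu : IsModelSolution T κ α f u₀ v₀ u ut utt)
    (hreg : ∀ᵐ t ∂(volume.restrict (Ioc 0 T)), utt t ∈ HCheckTwo Ω ∧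
      ‖utt t‖ ≤ M * t ^ (α 0 - 2) ∧ ‖dirichletLaplacian Ω (utt t)‖ ≤ M * t ^ (α 0 - 2))
    {τ : ℝ} (hτ : 0 < τ) {N : ℕ} (hN : N * τ = T) {n : ℕ} (hn : n ∈ Finset.Icc 1 N) :
    schemeOperator κ α k τ (fun j => u (j * τ)) n
      = (∫ t in (((n : ℝ) - 1) * τ)..(n * τ), modelRhs α f v₀ t)
        + (prim (prim k) (n * τ) - prim (prim k) (((n : ℝ) - 1) * τ)) • u₀
        + consistencyError κ α k u τ n := by
  have hn' := Finset.mem_Icc.1 hn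
  have hnN : (n : ℝ) ≤ N := by exact_mod_cast hn'.2
  have hn1 : (1 : ℝ) ≤ n := by exact_mod_cast hn'.1
  have h1 := hu.gridApprox hα hreg hτ (by omega) hN
  have h2 := hu.gridApprox_laplacian hΩ hv₀ hα hreg hτ (by omega) hN
  have e1 := h1.sum_cellWeight_sub hk.integrable hn'.1 hn'.2
  have e2 := h2.sum_cellWeight_sub
    (integrableOn_abelKernel (μ := α 0 - 1) (by linarith) T) hn'.1 hn'.2
  have e3 := hu.averaged_equation hk hα h2.continuousOn (a := ((n : ℝ) - 1) * τ) (b := n * τ)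
    (mul_nonneg (by linarith) hτ.le) (by nlinarith)
    (by rw [← hN]; exact mul_le_mul_of_nonneg_right hnN hτ.le)
  rw [consistencyError, ← e1, ← e2, e3, schemeOperator]
  push_cast [hn'.1]
  rw [smul_sub]
  abel

theorem sum_norm_consistencyError_le {M : ℝ} (hΩ : IsOpen Ω) (hv₀ : v₀ ∈ HCheckTwo Ω)
    (hk : IsGenIdentityKernel T C α k) (hα : 1 < α 0)
    (hu : IsModelSolution T κ α f u₀ v₀ u ut utt)
    (hreg : ∀ᵐ t ∂(volume.restrict (Ioc 0 T)), utt t ∈ HCheckTwo Ω ∧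
      ‖utt t‖ ≤ M * t ^ (α 0 - 2) ∧ ‖dirichletLaplacian Ω (utt t)‖ ≤ M * t ^ (α 0 - 2)) :
    ∃ R : ℝ, ∀ (τ : ℝ) (N : ℕ), 0 < τ → 1 ≤ N → N * τ = T →
      ∑ n ∈ Finset.Icc 1 N, ‖consistencyError κ α k u τ n‖ ≤ R * τ ^ 2 := by
  have hβ := integrableOn_abelKernel (μ := α 0 - 1) (by linarith) T
  refine ⟨(∫ r in (0 : ℝ)..T, |k r|) * (2 * (‖v₀‖ + powerMajorant M (α 0 - 1) T)
      + 4 * (powerMajorant M (α 0 - 1) T - powerMajorant M (α 0 - 1) 0))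
    + |κ| * ((∫ r in (0 : ℝ)..T, |abelKernel (α 0 - 1) r|)
      * (2 * (‖dirichletLaplacian Ω v₀‖ + powerMajorant M (α 0 - 1) T)
      + 4 * (powerMajorant M (α 0 - 1) T - powerMajorant M (α 0 - 1) 0))),
    fun τ N hτ hN1 hN => ?_⟩
  have h1 := (hu.gridApprox hα hreg hτ hN1 hN).sum_norm_integral_volterraConv_le hk.integrable
  have h2 := (hu.gridApprox_laplacian hΩ hv₀ hα hreg hτ hN1 hN).sum_norm_integral_volterraConv_le hβ
  have h3 := mul_le_mul_of_nonneg_left h2 (abs_nonneg κ)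
  rw [Finset.mul_sum] at h3
  rw [add_mul]
  refine le_trans ?_ (add_le_add h1 (h3.trans (le_of_eq (by ring))))
  rw [← Finset.sum_add_distrib]
  refine Finset.sum_le_sum fun n _ => ?_
  refine (norm_sub_le _ _).trans (add_le_add le_rfl ?_)
  rw [norm_smul, Real.norm_eq_abs]

/-! ### Stability of the scheme -/

theorem midValue_sub (v w : ℕ → L2 Ω) (j : ℕ) :
    midValue (fun j => v j - w j) j = midValue v j - midValue w j := by
  simp only [midValue]
  module

theorem startValue_sub (v w : ℕ → L2 Ω) (j : ℕ) :
    startValue (fun j => v j - w j) j = startValue v j - startValue w j := by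
  unfold startValue
  split_ifs
  · rfl
  · exact midValue_sub v w j

theorem HCheckTwo.sub {v w : L2 Ω} (hv : v ∈ HCheckTwo Ω) (hw : w ∈ HCheckTwo Ω) :
    v - w ∈ HCheckTwo Ω := by
  have := HCheckTwo.linear_comb hv hw 1 (-1)
  rwa [one_smul, neg_one_smul, ← sub_eq_add_neg] at this

theorem dirichletLaplacian_sub (hΩ : IsOpen Ω) {v w : L2 Ω} (hv : v ∈ HCheckTwo Ω)
    (hw : w ∈ HCheckTwo Ω) :
    dirichletLaplacian Ω (v - w) = dirichletLaplacian Ω v - dirichletLaplacian Ω w := by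
  have := dirichletLaplacian_linear_comb hΩ hv hw 1 (-1)
  simpa only [one_smul, neg_one_smul, ← sub_eq_add_neg] using this

theorem HCheckTwo.startValue {N : ℕ} {e : ℕ → L2 Ω} (he : ∀ j ≤ N, e j ∈ HCheckTwo Ω) {j : ℕ}
    (hj : 1 ≤ j) (hjN : j ≤ N) : startValue e j ∈ HCheckTwo Ω := by
  unfold _root_.startValue
  split_ifs with h1
  · exact he 1 (by omega)
  · rw [midValue, smul_add]
    exact HCheckTwo.linear_comb (he j hjN) (he (j - 1) (by omega)) _ _

theorem dirichletLaplacian_startValue (hΩ : IsOpen Ω) {N : ℕ} {e : ℕ → L2 Ω}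
    (he : ∀ j ≤ N, e j ∈ HCheckTwo Ω) {j : ℕ} (hjN : j ≤ N) :
    startValue (fun j => dirichletLaplacian Ω (e j)) j = dirichletLaplacian Ω (startValue e j) := by
  unfold startValue
  split_ifs with h1
  · rfl
  · rw [midValue, midValue, smul_add, smul_add,
      dirichletLaplacian_linear_comb hΩ (he j hjN) (he (j - 1) (by omega))]

theorem schemeOperator_sub (hΩ : IsOpen Ω) {N : ℕ} {τ : ℝ} {V U : ℕ → L2 Ω}
    (hV : ∀ j ≤ N, V j ∈ HCheckTwo Ω) (hU : ∀ j ≤ N, U j ∈ HCheckTwo Ω) {n : ℕ} (hn : n ≤ N) :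
    schemeOperator κ α k τ (fun j => V j - U j) n
      = schemeOperator κ α k τ V n - schemeOperator κ α k τ U n := by
  have e1 : ∀ j ∈ Finset.Icc 1 n, cellWeight (abelKernel (α 0 - 1)) τ n j •
        startValue (fun j => dirichletLaplacian Ω (V j - U j)) j
      = cellWeight (abelKernel (α 0 - 1)) τ n j • startValue (fun j => dirichletLaplacian Ω (V j)) j
        - cellWeight (abelKernel (α 0 - 1)) τ n j •
          startValue (fun j => dirichletLaplacian Ω (U j)) j := by
    intro j hj
    have hj := Finset.mem_Icc.1 hj
    have hVU : ∀ j ≤ N, V j - U j ∈ HCheckTwo Ω := fun j hj => HCheckTwo.sub (hV j hj) (hU j hj)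
    rw [dirichletLaplacian_startValue hΩ hVU (by omega), dirichletLaplacian_startValue hΩ hV (by omega),
      dirichletLaplacian_startValue hΩ hU (by omega), startValue_sub, dirichletLaplacian_sub hΩ
      (HCheckTwo.startValue hV hj.1 (by omega)) (HCheckTwo.startValue hU hj.1 (by omega)), smul_sub]
  have e2 : ∀ j ∈ Finset.Icc 1 n, cellWeight k τ n j • midValue (fun j => V j - U j) j
      = cellWeight k τ n j • midValue V j - cellWeight k τ n j • midValue U j := fun j _ => by
    rw [midValue_sub, smul_sub]
  simp only [schemeOperator]
  rw [Finset.sum_congr rfl e1, Finset.sum_congr rfl e2, Finset.sum_sub_distrib,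
    Finset.sum_sub_distrib, smul_sub]
  abel

theorem norm_le_of_schemeOperator_eq (hΩ : IsOpen Ω) (hκ : 0 ≤ κ) (hα1 : 1 < α 0) (hα2 : α 0 < 2)
    (hk : IsGenIdentityKernel T C α k) {τ : ℝ} (hτ : 0 < τ) {N : ℕ} (hN : N * τ = T)
    (hsmall : 4 * C * T * τ ≤ 1) {e ρ : ℕ → L2 Ω} (h0 : e 0 = 0)
    (he : ∀ j ≤ N, e j ∈ HCheckTwo Ω)
    (heq : ∀ n ∈ Finset.Icc 1 N, schemeOperator κ α k τ e n = ρ n) {m : ℕ} (hm : m ≤ N) :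
    ‖e m‖ ≤ 4 * (∑ n ∈ Finset.Icc 1 N, ‖ρ n‖) * Real.exp (4 * C * T ^ 2) := by
  have hC : 0 ≤ C := (abs_nonneg _).trans (hk.bound 0)
  let β := abelKernel (α 0 - 1)
  -- Cut off outside `1, …, N`, since `exists_gradient` needs every member of the sequence in the
  -- domain of `A`.
  let v : ℕ → L2 Ω := fun n => if 1 ≤ n ∧ n ≤ N then startValue e n else e 0
  have hv : ∀ n, v n ∈ HCheckTwo Ω := fun n => by
    by_cases h : 1 ≤ n ∧ n ≤ N
    · simp only [v, if_pos h]
      exact HCheckTwo.startValue he h.1 h.2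
    · simp only [v, if_neg h]
      exact he 0 (Nat.zero_le N)
  obtain ⟨w, hw⟩ := exists_gradient v hv
  refine energy_stability hτ hN hC hsmall (W := cellWeight k τ)
    (z := fun n => -(κ • ∑ j ∈ Finset.Icc 1 n, cellWeight β τ n j •
        startValue (fun j => dirichletLaplacian Ω (e j)) j)) h0
    (fun n _ j hj => abs_cellWeight_le hk.bound hτ (Finset.mem_Icc.1 hj).2) (fun n hn => ?_)
    (fun m hm => ?_) hm
  · rw [← heq n hn, schemeOperator, ← sub_eq_add_neg]
    rfl
  · have e1 : ∑ n ∈ Finset.Icc 1 m, inner ℝ (-(κ • ∑ j ∈ Finset.Icc 1 n, cellWeight β τ n j •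
        startValue (fun j => dirichletLaplacian Ω (e j)) j)) (energyTest e n)
        = κ * ∑ i, ∑ n ∈ Finset.Icc 1 m, ∑ j ∈ Finset.Icc 1 n,
          cellWeight β τ n j * inner ℝ (w j i) (w n i) := by
      rw [Finset.sum_comm, Finset.mul_sum]
      refine Finset.sum_congr rfl fun n hn => ?_
      have hn := Finset.mem_Icc.1 hn
      rw [inner_neg_left, real_inner_smul_left, sum_inner, Finset.sum_comm, ← mul_neg,
        ← Finset.sum_neg_distrib]
      congr 1
      refine Finset.sum_congr rfl fun j hj => ?_
      have hj := Finset.mem_Icc.1 hj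
      have h1 : v j = startValue e j := if_pos ⟨hj.1, by omega⟩
      -- The averages to which the rule applies `A` and the test elements agree by definition; this
      -- makes the double sum a quadratic form.
      have h2 : v n = energyTest e n := if_pos ⟨hn.1, by omega⟩
      rw [dirichletLaplacian_startValue hΩ he (by omega), ← h1, ← h2, real_inner_smul_left, hw j n,
        ← Finset.mul_sum]
      ring
    rw [e1]
    exact mul_nonneg hκ (Finset.sum_nonneg fun i _ =>
      sum_cellWeight_abelKernel_inner_nonneg (by linarith) (by linarith) hτ m fun n => w n i)

/-- Uniqueness without restriction on the step. If all earlier values vanish, pairing with `e m`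
leaves `(1 + w₀ / 2) ‖e m‖²` plus a nonnegative elliptic term, and `w₀ = g(τ) - 1 ≥ -1` because `g ≥
0`. -/
theorem eq_zero_of_schemeOperator_eq_zero (hΩ : IsOpen Ω) (hκ : 0 ≤ κ) (hα1 : 1 < α 0)
    (hk : IsGenIdentityKernel T C α k) {τ : ℝ} (hτ : 0 < τ) {N : ℕ} (hN : N * τ = T)
    {e : ℕ → L2 Ω} (h0 : e 0 = 0) (he : ∀ j ≤ N, e j ∈ HCheckTwo Ω)
    (heq : ∀ n ∈ Finset.Icc 1 N, schemeOperator κ α k τ e n = 0) {m : ℕ} (hm : m ≤ N) :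
    e m = 0 := by
  induction m using Nat.strong_induction_on with
  | _ m ih =>
    rcases Nat.eq_zero_or_pos m with rfl | hm0
    · exact h0
    · have hprev : ∀ j < m, e j = 0 := fun j hj => ih j hj (by omega)
      have hm' : m ∈ Finset.Icc 1 m := Finset.mem_Icc.2 ⟨hm0, le_rfl⟩
      have hL0 : dirichletLaplacian Ω (0 : L2 Ω) = 0 := by
        have h00 : (0 : L2 Ω) ∈ HCheckTwo Ω := h0 ▸ he 0 (Nat.zero_le N)
        have := dirichletLaplacian_sub hΩ h00 h00
        simpa using this
      have h1 := heq m (Finset.mem_Icc.2 ⟨hm0, hm⟩)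
      have hmid : ∀ j ∈ Finset.Icc 1 m, j ≠ m → midValue e j = 0 := fun j hj hjm => by
        have hj := Finset.mem_Icc.1 hj
        rw [midValue, hprev j (by omega), hprev (j - 1) (by omega)]
        simp
      have hst : ∀ j ∈ Finset.Icc 1 m, j ≠ m →
          startValue (fun j => dirichletLaplacian Ω (e j)) j = 0 := fun j hj hjm => by
        have hj' := Finset.mem_Icc.1 hj
        rw [dirichletLaplacian_startValue hΩ he (by omega)]
        have : startValue e j = 0 := by
          unfold startValue
          split_ifs with hj1
          · exact hprev 1 (by omega)
          · exact hmid j hj hjm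
        rw [this, hL0]
      obtain ⟨c, hc, hce⟩ : ∃ c : ℝ, 0 ≤ c ∧
          startValue (fun j => dirichletLaplacian Ω (e j)) m = c • dirichletLaplacian Ω (e m) := by
        unfold startValue
        split_ifs with hm1
        · exact ⟨1, zero_le_one, by rw [one_smul, hm1]⟩
        · refine ⟨1 / 2, by norm_num, ?_⟩
          rw [midValue, hprev (m - 1) (by omega), hL0, add_zero]
      have hmm : midValue e m = (1 / 2 : ℝ) • e m := by
        rw [midValue, hprev (m - 1) (by omega), add_zero]
      rw [schemeOperator, Finset.sum_eq_single_of_mem m hm' fun j hj hjm => by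
          rw [hmid j hj hjm, smul_zero], Finset.sum_eq_single_of_mem m hm' fun j hj hjm => by
          rw [hst j hj hjm, smul_zero], hprev (m - 1) (by omega), sub_zero, hmm, hce,
        cellWeight_self hk.integrable hτ hN hm0 hm,
        cellWeight_self (integrableOn_abelKernel (μ := α 0 - 1) (by linarith) T) hτ hN hm0 hm] at h1
      have hN1 : (1 : ℝ) ≤ N := by exact_mod_cast (show 1 ≤ N by omega)
      have hτT : τ ∈ Icc 0 T := ⟨hτ.le, by rw [← hN]; exact le_mul_of_one_le_left hτ.le hN1⟩
      have hw : -1 ≤ prim (prim k) τ := by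
        have h2 := hk.nonneg τ hτT
        rw [hk.eq τ hτT] at h2
        linarith
      have hb : 0 ≤ prim (prim (abelKernel (α 0 - 1))) τ := by
        rw [prim_prim_abelKernel (by linarith)]
        have := Real.Gamma_pos_of_pos (show 0 < α 0 - 1 by linarith)
        have : 0 < α 0 - 1 := by linarith
        positivity
      have h3 := congrArg (fun x => inner ℝ x (e m)) h1
      simp only [inner_sub_left, inner_add_left, real_inner_smul_left, inner_zero_left,
        real_inner_self_eq_norm_sq] at h3
      have h4 := inner_dirichletLaplacian_self_nonpos (he m hm)
      have h5 : 0 ≤ κ * (prim (prim (abelKernel (α 0 - 1))) τ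
          * (c * -inner ℝ (dirichletLaplacian Ω (e m)) (e m))) := by
        have : 0 ≤ -inner ℝ (dirichletLaplacian Ω (e m)) (e m) := by linarith
        positivity
      have h6 : ‖e m‖ ^ 2 ≤ 0 := by nlinarith [sq_nonneg ‖e m‖]
      exact norm_eq_zero.1 (pow_eq_zero_iff two_ne_zero |>.1 (le_antisymm h6 (sq_nonneg _)))

end Model

/-! ### Assembly: small steps by stability, the finitely many others by uniqueness -/

theorem mainTheorem5 {d : ℕ} (Ω : Set (EuclideanSpace ℝ (Fin d))) (hΩ : IsOpen Ω)
    (hΩb : Bornology.IsBounded Ω)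
    (T κ : ℝ) (hT : 0 < T) (hκ : 0 < κ)
    (α : ℝ → ℝ) (hα : IsSmoothExponent T α)
    (hα1 : iteratedDerivWithin 1 α (Icc 0 T) 0 = 0)
    (hα2 : iteratedDerivWithin 2 α (Icc 0 T) 0 = 0)
    (f : ℝ → L2 Ω) (hf : ContinuousOn f (Icc 0 T))
    (u₀ v₀ : L2 Ω) (hu₀ : u₀ ∈ HCheckTwo Ω) (hv₀ : v₀ ∈ HCheckTwo Ω)
    (u ut utt : ℝ → L2 Ω) (hu : IsModelSolution T κ α f u₀ v₀ u ut utt)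
    (M : ℝ)
    (hreg : ∀ᵐ t ∂(volume.restrict (Ioc 0 T)), utt t ∈ HCheckTwo Ω ∧
      ‖utt t‖ ≤ M * t ^ (α 0 - 2) ∧
      ‖dirichletLaplacian Ω (utt t)‖ ≤ M * t ^ (α 0 - 2)) :
    ∃ Q : ℝ, 0 < Q ∧ ∀ N : ℕ, 1 ≤ N → ∀ U : ℕ → L2 Ω,
      IsSecondOrderScheme κ α f u₀ v₀ (T / N) N U →
      ∀ m ∈ Finset.Icc 1 N, ‖u (m * (T / N)) - U m‖ ≤ Q * (T / N) ^ 2 := by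
  have hα0 := hα.mem_Ioo 0 ⟨le_rfl, hT.le⟩
  obtain ⟨k, C, k1, k2, k3, k4, k5, k6⟩ := hα.exists_kernel hT hα1 hα2
  have hk : IsGenIdentityKernel T C α k := ⟨k1, k2, k3, k4, k5, k6⟩
  have hC : 0 ≤ C := (abs_nonneg _).trans (hk.bound 0)
  obtain ⟨R, hR⟩ := sum_norm_consistencyError_le hΩ hv₀ hk hα0.1 hu hreg
  have hstep : ∀ N : ℕ, 1 ≤ N → 0 < T / N ∧ N * (T / N) = T := fun N hN => by
    have : (0 : ℝ) < N := by exact_mod_cast hN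
    exact ⟨by positivity, by field_simp⟩
  have hUmem : ∀ (N : ℕ) (U : ℕ → L2 Ω), IsSecondOrderScheme κ α f u₀ v₀ (T / N) N U →
      ∀ j ≤ N, U j ∈ HCheckTwo Ω := by
    intro N U hU j hj
    rcases Nat.eq_zero_or_pos j with rfl | hj0
    · rw [hU.init]; exact hu₀
    · exact hU.mem_HCheckTwo j (Finset.mem_Icc.2 ⟨hj0, hj⟩)
  -- the error for small steps
  have hlarge : ∀ N : ℕ, 1 ≤ N → 4 * C * T * (T / N) ≤ 1 → ∀ U : ℕ → L2 Ω,
      IsSecondOrderScheme κ α f u₀ v₀ (T / N) N U → ∀ m ∈ Finset.Icc 1 N,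
      ‖u (m * (T / N)) - U m‖ ≤ 4 * R * Real.exp (4 * C * T ^ 2) * (T / N) ^ 2 := by
    intro N hN hsmall U hU m hm
    obtain ⟨hτ, hNτ⟩ := hstep N hN
    have humem : ∀ j ≤ N, u (j * (T / N)) ∈ HCheckTwo Ω := fun j hj => by
      have hj' : (j : ℝ) ≤ N := by exact_mod_cast hj
      refine hu.mem_HCheckTwo _ ⟨by positivity, ?_⟩
      calc (j : ℝ) * (T / N) ≤ N * (T / N) := mul_le_mul_of_nonneg_right hj' hτ.le
        _ = T := hNτ
    have h1 := norm_le_of_schemeOperator_eq hΩ hκ.le hα0.1 hα0.2 hk hτ hNτ hsmall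
      (e := fun j => u (j * (T / N)) - U j) (ρ := consistencyError κ α k u (T / N))
      (by rw [Nat.cast_zero, zero_mul, hu.u_zero hT.le, hU.init, sub_self])
      (fun j hj => HCheckTwo.sub (humem j hj) (hUmem N U hU j hj)) (fun n hn => by
        rw [schemeOperator_sub hΩ humem (hUmem N U hU) (Finset.mem_Icc.1 hn).2,
          hu.schemeOperator_eq hΩ hv₀ hk hα0.1 hreg hτ hNτ hn, hU.schemeOperator_eq hk hτ hNτ hn,
          add_sub_cancel_left]) (Finset.mem_Icc.1 hm).2
    refine h1.trans ?_
    have h2 := mul_le_mul_of_nonneg_right (hR (T / N) N hτ hN hNτ) (Real.exp_pos (4 * C * T ^ 2)).le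
    linarith
  -- for a fixed number of steps the scheme has at most one solution
  have hfixed : ∀ N : ℕ, ∃ Q : ℝ, 0 ≤ Q ∧ (1 ≤ N → ∀ U : ℕ → L2 Ω,
      IsSecondOrderScheme κ α f u₀ v₀ (T / N) N U → ∀ m ∈ Finset.Icc 1 N,
      ‖u (m * (T / N)) - U m‖ ≤ Q * (T / N) ^ 2) := by
    intro N
    by_cases hex : ∃ V : ℕ → L2 Ω, 1 ≤ N ∧ IsSecondOrderScheme κ α f u₀ v₀ (T / N) N V
    · obtain ⟨V, hN, hV⟩ := hex
      obtain ⟨hτ, hNτ⟩ := hstep N hN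
      -- Any solution equals the chosen `V`, so the errors of `V` alone, divided by `τ²`, give a
      -- constant for this `N`.
      refine ⟨(∑ m ∈ Finset.Icc 1 N, ‖u (m * (T / N)) - V m‖) / (T / N) ^ 2, by positivity,
        fun _ U hU m hm => ?_⟩
      have hUV := eq_zero_of_schemeOperator_eq_zero hΩ hκ.le hα0.1 hk hτ hNτ
        (e := fun j => U j - V j) (by rw [hU.init, hV.init, sub_self])
        (fun j hj => HCheckTwo.sub (hUmem N U hU j hj) (hUmem N V hV j hj)) (fun n hn => by
          rw [schemeOperator_sub hΩ (hUmem N U hU) (hUmem N V hV) (Finset.mem_Icc.1 hn).2,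
            hU.schemeOperator_eq hk hτ hNτ hn, hV.schemeOperator_eq hk hτ hNτ hn, sub_self])
        (Finset.mem_Icc.1 hm).2
      rw [sub_eq_zero.1 hUV, div_mul_cancel₀ _ (by positivity)]
      exact Finset.single_le_sum (f := fun m : ℕ => ‖u (m * (T / N)) - V m‖)
        (fun _ _ => norm_nonneg _) hm
    · exact ⟨0, le_rfl, fun hN U hU => absurd ⟨U, hN, hU⟩ hex⟩
  choose Q hQ0 hQ using hfixed
  -- For `N ≥ N₀` the condition `4 C T τ ≤ 1` holds, as `τ = T / N`.
  obtain ⟨N₀, hN₀⟩ := exists_nat_gt (4 * C * T * T)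
  have hS0 : 0 ≤ ∑ N ∈ Finset.range N₀, Q N := Finset.sum_nonneg fun N _ => hQ0 N
  -- The constant for small steps plus those of the finitely many `N < N₀`; the absolute value
  -- spares the sign of `R`, and `+ 1` makes the total positive.
  refine ⟨|4 * R * Real.exp (4 * C * T ^ 2)| + ∑ N ∈ Finset.range N₀, Q N + 1, by positivity,
    fun N hN U hU m hm => ?_⟩
  by_cases hNN : N < N₀
  · refine (hQ N hN U hU m hm).trans (mul_le_mul_of_nonneg_right ?_ (sq_nonneg _))
    have := Finset.single_le_sum (f := Q) (fun N _ => hQ0 N) (Finset.mem_range.2 hNN)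
    have := abs_nonneg (4 * R * Real.exp (4 * C * T ^ 2))
    linarith
  · have hN' : (0 : ℝ) < N := by exact_mod_cast hN
    have hNN' : (N₀ : ℝ) ≤ N := by exact_mod_cast not_lt.1 hNN
    refine (hlarge N hN ?_ U hU m hm).trans (mul_le_mul_of_nonneg_right ?_ (sq_nonneg _))
    · rw [mul_div_assoc', div_le_one hN']
      linarith
    · linarith [le_abs_self (4 * R * Real.exp (4 * C * T ^ 2))]
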